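/- **Setting.** Let $\mathrm E\in\mathbb R^{2\times2}$ be invertible, $\mathrm R_t$ the rotation of the plane by the angle $t$, $\mathrm E_0=\mathrm R_{-\pi/2}\mathrm E$, $\mathcal R_0=\mathrm E_0\mathbb Z^2$ and $\Gamma_0=\mathbb R^2/\mathcal R_0\equiv \mathrm E_0[-\tfrac12,\tfrac12)^2$. Functions on $\Gamma_0$ are $\mathcal R_0$-periodic functions on $\mathbb R^2$; write $\langle f\rangle=\frac1{|\Gamma_0|}\int_{\Gamma_0}f\,dx$ and $\|f\|_{L^2}=\langle|f|^2\rangle^{1/2}$. Let $W^{1,2}_\#=\{u\in W^{1,2}(\Gamma_0;\mathbb R^2): \langle u\rangle=0\}$ with $\|u\|_{1,2}=(\|u\|_{L^2}^2+\|\nabla u\|_{L^2}^2)^{1/2}$. Let $\lambda\ge0$, $\mu>0$ be the Lamé parameters, $\varepsilon(u)=\frac12(\nabla u+\nabla u^T)$, $\Phi_0:\Gamma_0\to\mathbb R$ the generalized stacking fault energy (GSFE), $\theta$ the twist angle, and $$F_\theta(x,v)=\tfrac12 \mathrm R_{\frac{\pi-\theta}2}^T\nabla\Phi_0\big(x-\mathrm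 R_{\frac{\pi-\theta}2}v\big)+\tfrac12 \mathrm R_{\frac{\pi+\theta}2}^T\nabla\Phi_0\big(x-\mathrm R_{\frac{\pi+\theta}2}v\big).$$ A *solution* of the Euler–Lagrange equation $$-\mathrm{div}\big(\lambda\,\mathrm{div}(u)\mathrm I+2\mu\,\varepsilon(u)\big)=\frac1{4\sin^2(\theta/2)}F_\theta(x,2u)$$ is a $u\in W^{1,2}_\#$ such that $$\big\langle\lambda\,\mathrm{div}(u)\,\mathrm{div}(v)+2\mu\,\varepsilon(u):\varepsilon(v)\big\rangle=\frac1{4\sin^2(\theta/2)}\big\langle F_\theta(\cdot,2u)\cdot v\big\rangle\qquad\text{for all } v\in W^{1,2}_\# .$$ (Since the test functions have mean zero, this is the displayed equation up to an additive constant vector, the multiplier of the constraint $\langle u\rangle=0$.) Norms $\|\nabla^m\Phi_0\|_\infty$ are suprema over $\Gamma_0$ of Euclidean ($m=1$) and operator norms, and $\|\Phi_0\|_{C^m}=\sum_{j\le m}\|\nabla^j\Phi_0\|_\infty$. **Theorem.** There are constants $C^0_{\mathrm E}, C^1_{\mathrm E}$ depending only on $\mathrm E$, with $C^0_{\mathrm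 E}>2C^1_{\mathrm E}>0$, and numbers $C_k=C_k(\mathrm E,\mu,\|\Phi_0\|_{C^{k+1}})$ depending only on the quantities shown, such that the following holds for all $\lambda\ge0$, $\mu>0$, all twice continuously differentiable $\Phi_0$ on $\Gamma_0$ and all real $\theta\notin\pi\mathbb Z$. (a) A solution $u^*\in W^{1,2}_\#$ exists, and every solution satisfies $$\|u^*\|_{1,2}\le\frac1{\mu C^1_{\mathrm E}}\,\frac{\|\nabla\Phi_0\|_\infty}{4\sin^2(\theta/2)} .$$ (b) If $|\theta|<\pi$ and $\|\nabla^2\Phi_0\|_\infty/\theta^2<\mu C^0_{\mathrm E}/2$, the solution is unique (almost everywhere). (c) If $\Phi_0$ is smooth, every solution is (almost everywhere equal to) a smooth function on $\Gamma_0$, and for all $k=2,3,\dots$ $$\|\nabla^k u^*\|_{L^2}\le\frac{C_k}{\sin^{2k}(\theta/2)} .$$ Moreover, with $\Lambda=\min\{|2\pi k|^2: k\in\mathcal R_0^*\setminus\{0\}\}$, where $\mathcal R_0^*$ is the dual lattice of $\mathcal R_0$, the bound in (a) holds with $\Lambda/(1+\Lambda)$ in place of $C^1_{\mathrm E}$,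 and for every real $\theta\notin\pi\mathbb Z$ the solution is unique whenever $\|\nabla^2\Phi_0\|_\infty/(4\sin^2(\theta/2))<\mu\Lambda/2$. -/

import Mathlib

open MeasureTheory Matrix
open scoped ContDiff

noncomputable section

namespace Bilayer

/-- The plane `ℝ²` with its Euclidean norm. -/
abbrev Plane : Type := EuclideanSpace ℝ (Fin 2)

/-- Real `2 × 2` matrices. -/
abbrev Mat : Type := Matrix (Fin 2) (Fin 2) ℝ

/-- The matrix-vector product `M x`. -/
def act (M : Mat) (x : Plane) : Plane := WithLp.toLp 2 (M *ᵥ x.ofLp)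

/-- The rotation matrix `R_t`. -/
def rot (t : ℝ) : Mat := !![Real.cos t, -Real.sin t; Real.sin t, Real.cos t]

/-- The basis `E₀ = R_{-π/2} E` of the reference lattice. -/
def refBasis (E : Mat) : Mat := rot (-(Real.pi / 2)) * E

/-- The point `E₀ n` of the reference lattice `𝓡₀ = E₀ ℤ²`. -/
def latticePoint (E : Mat) (n : Fin 2 → ℤ) : Plane :=
  act (refBasis E) (WithLp.toLp 2 fun i => (n i : ℝ))

/-- The reference cell `E₀ [-1/2, 1/2)²`, a fundamental domain of `Γ₀ = ℝ² / 𝓡₀`. -/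
def cell (E : Mat) : Set Plane :=
  act (refBasis E) '' {t : Plane | ∀ i, t i ∈ Set.Ico (-(1 / 2) : ℝ) (1 / 2)}

/-- Functions on the torus `Γ₀` are `𝓡₀`-periodic functions on the plane. -/
def IsPeriodic {β : Type*} (E : Mat) (f : Plane → β) : Prop :=
  ∀ (n : Fin 2 → ℤ) (x : Plane), f (x + latticePoint E n) = f x

/-- The dual lattice `𝓡₀* = {k | k · r ∈ ℤ for every r ∈ 𝓡₀}`. -/
def dualLattice (E : Mat) : Set Plane :=
  {k | ∀ n : Fin 2 → ℤ, ∃ m : ℤ, inner ℝ k (latticePoint E n) = (m : ℝ)}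

/-- `min {|2πk|² : k ∈ 𝓡₀* ∖ {0}}`, the smallest positive eigenvalue of `-Δ` on `Γ₀`. -/
def gap (E : Mat) : ℝ :=
  sInf {r : ℝ | ∃ k ∈ dualLattice E, k ≠ 0 ∧ r = ‖(2 * Real.pi) • k‖ ^ 2}

/-- `u ∈ W^{1,2}_#(Γ₀; ℝ²)` with weak gradient `G`, where `G x i j` stands for `∂_j u_i (x)`:
both are periodic and square integrable over the cell, `u` has mean zero, and `G` is the
gradient of `u` in the sense of distributions on the torus. -/
structure MemSobolev (E : Mat) (u : Plane → Plane) (G : Plane → Mat) : Prop where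
  periodic : IsPeriodic E u
  periodic_grad : IsPeriodic E G
  memLp : MemLp u 2 (volume.restrict (cell E))
  memLp_grad : ∀ i j, MemLp (fun x => G x i j) 2 (volume.restrict (cell E))
  mean_zero : ⨍ x in cell E, u x = 0
  weak_grad : ∀ φ : Plane → ℝ, ContDiff ℝ ∞ φ → IsPeriodic E φ → ∀ i j : Fin 2,
    ∫ x in cell E, u x i * fderiv ℝ φ x (EuclideanSpace.single j 1) =
      -∫ x in cell E, G x i j * φ x

/-- The norm `‖u‖_{1,2} = (⨍ |u|² + ⨍ |∇u|²)^{1/2}`, for `u` with weak gradient `G`. -/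
def sobolevNorm (E : Mat) (u : Plane → Plane) (G : Plane → Mat) : ℝ :=
  Real.sqrt ((⨍ x in cell E, ‖u x‖ ^ 2) + ⨍ x in cell E, ∑ i, ∑ j, G x i j ^ 2)

/-- The symmetrized gradient `ε(u) = (∇u + ∇uᵀ) / 2`. -/
def strain (A : Mat) : Mat := (1 / 2 : ℝ) • (A + Aᵀ)

/-- The elastic energy pairing `λ div(u) div(v) + 2 μ ε(u) : ε(v)` of two gradients. -/
def elasticPairing (lam mu : ℝ) (A B : Mat) : ℝ :=
  lam * A.trace * B.trace + 2 * mu * ∑ i, ∑ j, strain A i j * strain B i j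

/-- The misfit force
`F_θ(x, v) = ½ R_{(π-θ)/2}ᵀ ∇Φ₀(x - R_{(π-θ)/2} v) + ½ R_{(π+θ)/2}ᵀ ∇Φ₀(x - R_{(π+θ)/2} v)`. -/
def misfitForce (Φ : Plane → ℝ) (θ : ℝ) (x v : Plane) : Plane :=
  (1 / 2 : ℝ) • act (rot ((Real.pi - θ) / 2))ᵀ
      (gradient Φ (x - act (rot ((Real.pi - θ) / 2)) v)) +
    (1 / 2 : ℝ) • act (rot ((Real.pi + θ) / 2))ᵀ
      (gradient Φ (x - act (rot ((Real.pi + θ) / 2)) v))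

/-- `u ∈ W^{1,2}_#(Γ₀; ℝ²)`, with weak gradient `G`, is a weak solution of the rescaled
Euler-Lagrange equation
`-div (λ div(u) I + 2 μ ε(u)) = (4 sin²(θ/2))⁻¹ F_θ(x, 2u)`:
the equation holds when tested against every element of `W^{1,2}_#(Γ₀; ℝ²)`. -/
def IsSolution (E : Mat) (lam mu : ℝ) (Φ : Plane → ℝ) (θ : ℝ)
    (u : Plane → Plane) (G : Plane → Mat) : Prop :=
  MemSobolev E u G ∧
    ∀ (v : Plane → Plane) (H : Plane → Mat), MemSobolev E v H →
      ⨍ x in cell E, elasticPairing lam mu (G x) (H x) =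
        1 / (4 * Real.sin (θ / 2) ^ 2) *
          ⨍ x in cell E, inner ℝ (misfitForce Φ θ x ((2 : ℝ) • u x)) (v x)

/-- `‖∇Φ‖_∞`. -/
def supGrad (Φ : Plane → ℝ) : ℝ := ⨆ x, ‖gradient Φ x‖

/-- `‖∇^m Φ‖_∞`, with the operator norm of multilinear forms. -/
def supDeriv (m : ℕ) (Φ : Plane → ℝ) : ℝ := ⨆ x, ‖iteratedFDeriv ℝ m Φ x‖

/-- `‖Φ‖_{C^m} = ∑_{j ≤ m} ‖∇^j Φ‖_∞`. -/
def cNorm (m : ℕ) (Φ : Plane → ℝ) : ℝ := ∑ j ∈ Finset.range (m + 1), supDeriv j Φ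

/-- `‖∇^k w‖_{L²} = (⨍ |∇^k w|²)^{1/2}` for a smooth `w`, where `|∇^k w|²` is the sum of the
squares of all the partial derivatives of order `k`. -/
def derivL2Norm (E : Mat) (k : ℕ) (w : Plane → Plane) : ℝ :=
  Real.sqrt (⨍ x in cell E, ∑ s : Fin k → Fin 2,
    ‖iteratedFDeriv ℝ k w x fun i => EuclideanSpace.single (s i) 1‖ ^ 2)

end Bilayer

end

noncomputable section

namespace Bilayer

open Complex (I)
open scoped ComplexConjugate

/-! Everything is done with Fourier coefficients on the torus, where `u` in the Sobolev space means
that `ξ_n û(n)` is square summable and `û(0) = 0`.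

Existence is the direct method. A solution is a critical point of the elastic energy plus `1 / (4
sin²(θ/2))` times the integral of `misfitEnergy`, whose density is bounded because `Φ` is continuous
and periodic. Displacements of bounded Dirichlet energy form a compact set for pointwise convergence
of the coefficients (`isCompact_coefSet`); on it the elastic energy is lower semicontinuous and the
misfit energy continuous, so a minimizer exists (`exists_minimizer`) and solves the equation
(`isSolution_of_minimizer`).

The estimates rest on the Poincaré inequality with constant `gap E` and on Korn's identity, by which
the elastic form is at least `mu` times the Dirichlet energy, whatever `lam ≥ 0` is. Testing the
equation with the solution gives the bound of (a), since the force never exceeds `supGrad Φ`.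
Testing the difference of the equations of two solutions with the difference of the solutions gives
uniqueness, since the force is Lipschitz in the displacement.

Regularity is a bootstrap. Testing with the modes `±n` shows that `u` has two more derivatives than
the force (`IsSolution.elliptic`, `IsSolution.gain`). Conversely, the chain rule bounds `m + 1`
derivatives of the force by the `L²` norm of `∇^(m+1) u` and by sup norms of the lower derivatives
(`misfitForce_bound`); the latter are replaced by weighted `ℓ¹` sums of coefficients. In dimension
two an `ℓ¹` sum of order `m + 1` narrowly fails to be controlled by an `L²` norm of order `m + 2`,
so `wiener_bound` interpolates with order `m + 3` and loses a factor `τ`, a small power of the load.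
If the load is at most `τ^q`, each derivative costs `τ^(q+1)`, and order `k` is bounded by a
multiple of `τ^q (τ^(q+1))^(k-2)`: the load to the power `k - 1` times `τ^(k-2)`. For `q = k - 1`
this is within the claimed `sin^(-2k)`, the losses being covered by the one spare factor `1 /
sin²(θ/2)`. -/

/-- The matrix-vector product as a continuous linear map. -/
def actL (M : Mat) : Plane →L[ℝ] Plane := (Matrix.toEuclideanLin M).toContinuousLinearMap

lemma actL_apply (M : Mat) (x : Plane) : actL M x = act M x := rfl

lemma act_apply (M : Mat) (x : Plane) (i : Fin 2) : act M x i = M i 0 * x 0 + M i 1 * x 1 := by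
  fin_cases i <;> simp [act]

lemma act_mul (M N : Mat) (x : Plane) : act M (act N x) = act (M * N) x := by
  rw [act, act, act, Matrix.mulVec_mulVec]

lemma act_one (x : Plane) : act 1 x = x := by
  simp [act]

lemma det_rot (t : ℝ) : (rot t).det = 1 := by
  simp [rot, Matrix.det_fin_two_of, ← sq]

lemma det_refBasis {E : Mat} (hE : E.det ≠ 0) : (refBasis E).det ≠ 0 := by
  simpa [refBasis, det_rot] using hE

lemma act_refBasis_inv {E : Mat} (hE : E.det ≠ 0) (x : Plane) :
    act (refBasis E) (act (refBasis E)⁻¹ x) = x := by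
  rw [act_mul, Matrix.mul_nonsing_inv _ (det_refBasis hE).isUnit, act_one]

lemma act_inv_refBasis {E : Mat} (hE : E.det ≠ 0) (x : Plane) :
    act (refBasis E)⁻¹ (act (refBasis E) x) = x := by
  rw [act_mul, Matrix.nonsing_inv_mul _ (det_refBasis hE).isUnit, act_one]

/-! ### The cell as a fundamental domain, and its comparison with the unit torus. -/

/-- The normalized Lebesgue measure on the reference cell. -/
def cellMeasure (E : Mat) : Measure Plane :=
  (volume.restrict (cell E) Set.univ)⁻¹ • volume.restrict (cell E)

lemma average_cell {F : Type*} [NormedAddCommGroup F] [NormedSpace ℝ F] (E : Mat)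
    (f : Plane → F) : ⨍ x in cell E, f x = ∫ x, f x ∂cellMeasure E := rfl

/-- The Haar probability measure on the two-dimensional unit torus. -/
def torusMeasure : Measure (UnitAddTorus (Fin 2)) :=
  Measure.pi fun _ => AddCircle.haarAddCircle

instance : IsProbabilityMeasure torusMeasure :=
  inferInstanceAs (IsProbabilityMeasure (Measure.pi fun _ => AddCircle.haarAddCircle))

instance : Measure.IsAddHaarMeasure torusMeasure :=
  inferInstanceAs (Measure.IsAddHaarMeasure (Measure.pi fun _ => AddCircle.haarAddCircle))

/-- The covering map of the plane onto the unit torus with kernel `𝓡₀`. -/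
def toTorus (E : Mat) (x : Plane) : UnitAddTorus (Fin 2) :=
  fun i => ((act (refBasis E)⁻¹ x i : ℝ) : UnitAddCircle)

/-- A measurable section of `toTorus`. -/
def ofTorus (E : Mat) (y : UnitAddTorus (Fin 2)) : Plane :=
  act (refBasis E) (WithLp.toLp 2 fun i => (AddCircle.equivIoc 1 (-(1 / 2)) (y i)).1)

lemma toTorus_ofTorus {E : Mat} (hE : E.det ≠ 0) (y : UnitAddTorus (Fin 2)) :
    toTorus E (ofTorus E y) = y := by
  funext i
  simp [toTorus, ofTorus, act_inv_refBasis hE]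

lemma toTorus_add (E : Mat) (x y : Plane) : toTorus E (x + y) = toTorus E x + toTorus E y := by
  funext i
  simp [toTorus, ← actL_apply]

lemma continuous_toTorus (E : Mat) : Continuous (toTorus E) := by
  refine continuous_pi fun i => ?_
  have h : Continuous fun x : Plane => actL (refBasis E)⁻¹ x i := by fun_prop
  exact (AddCircle.continuous_mk' 1).comp h

lemma exists_eq_add_latticePoint {E : Mat} (hE : E.det ≠ 0) {x y : Plane}
    (h : toTorus E x = toTorus E y) : ∃ n, x = y + latticePoint E n := by
  have h1 : ∀ i, ∃ n : ℤ, act (refBasis E)⁻¹ x i = act (refBasis E)⁻¹ y i + n := by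
    intro i
    have h2 := congrFun h i
    simp only [toTorus] at h2
    rw [← sub_eq_zero, ← AddCircle.coe_sub, AddCircle.coe_eq_zero_iff] at h2
    obtain ⟨n, hn⟩ := h2
    exact ⟨n, by simp at hn; linarith⟩
  choose n hn using h1
  refine ⟨n, ?_⟩
  have h3 : act (refBasis E)⁻¹ x = act (refBasis E)⁻¹ y + WithLp.toLp 2 fun i => (n i : ℝ) := by
    ext i
    simpa using hn i
  rw [← act_refBasis_inv hE x, h3, ← actL_apply, map_add, actL_apply, actL_apply,
    act_refBasis_inv hE]
  rfl

lemma toTorus_latticePoint {E : Mat} (hE : E.det ≠ 0) (n : Fin 2 → ℤ) :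
    toTorus E (latticePoint E n) = 0 := by
  funext i
  simp only [toTorus, latticePoint, act_inv_refBasis hE, Pi.zero_apply]
  rw [AddCircle.coe_eq_zero_iff]
  exact ⟨n i, by simp⟩

lemma IsPeriodic.eq_of_toTorus {β : Type*} {E : Mat} (hE : E.det ≠ 0) {f : Plane → β}
    (hf : IsPeriodic E f) {x y : Plane} (h : toTorus E x = toTorus E y) : f x = f y := by
  obtain ⟨n, rfl⟩ := exists_eq_add_latticePoint hE h
  exact hf n y

lemma isPeriodic_comp_toTorus {β : Type*} {E : Mat} (hE : E.det ≠ 0)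
    (g : UnitAddTorus (Fin 2) → β) : IsPeriodic E fun x => g (toTorus E x) := by
  intro n x
  simp only [toTorus_add, toTorus_latticePoint hE, add_zero]

/-- The linear automorphism of the plane given by the lattice basis. -/
def basisEquiv {E : Mat} (hE : E.det ≠ 0) : Plane ≃L[ℝ] Plane :=
  ContinuousLinearEquiv.equivOfInverse (actL (refBasis E)) (actL (refBasis E)⁻¹)
    (act_inv_refBasis hE) (act_refBasis_inv hE)

section
-- Makes `volume` on the circle the Haar probability measure, so that results about `volume` on the
-- torus apply to `torusMeasure`.
local instance : MeasureSpace UnitAddCircle := ⟨AddCircle.haarAddCircle⟩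

lemma map_ofTorus_aux :
    Measure.map (fun y : UnitAddTorus (Fin 2) =>
      (fun i => (AddCircle.equivIoc 1 (-(1 / 2) : ℝ) (y i)).1 : Fin 2 → ℝ)) torusMeasure =
    volume.restrict {t : Fin 2 → ℝ | ∀ i, t i ∈ Set.Ioc (-(1 / 2) : ℝ) (-(1 / 2) + 1)} := by
  have h1 := UnitAddTorus.measurePreserving_equivPiIoc (d := Fin 2) (fun _ => -(1 / 2))
  have h2 : MeasurableSet {t : Fin 2 → ℝ | ∀ i, t i ∈ Set.Ioc (-(1 / 2) : ℝ) (-(1 / 2) + 1)} :=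
    MeasurableSet.univ_pi' (fun i => measurableSet_Ioc)
  have h3 := (measurePreserving_subtype_coe (μa := volume) h2).comp h1
  exact h3.map_eq

lemma measurable_equivIoc_pi : Measurable (fun y : UnitAddTorus (Fin 2) =>
      (fun i => (AddCircle.equivIoc 1 (-(1 / 2) : ℝ) (y i)).1 : Fin 2 → ℝ)) := by
  refine measurable_pi_lambda _ fun i => ?_
  exact measurable_subtype_coe.comp
    ((AddCircle.measurableEquivIoc 1 (-(1 / 2) : ℝ)).measurable.comp (measurable_pi_apply i))

end

lemma measurable_ofTorus (E : Mat) : Measurable (ofTorus E) :=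
  (actL (refBasis E)).continuous.measurable.comp
    ((PiLp.continuous_toLp 2 _).measurable.comp measurable_equivIoc_pi)

lemma map_basisEquiv {E : Mat} (hE : E.det ≠ 0) :
    ∃ c : ENNReal, c ≠ 0 ∧ Measure.map (basisEquiv hE) (volume : Measure Plane) = c • volume := by
  have hd : LinearMap.det (basisEquiv hE : Plane →ₗ[ℝ] Plane) ≠ 0 :=
    (LinearEquiv.isUnit_det' (basisEquiv hE).toLinearEquiv).ne_zero
  exact ⟨_, by simpa using hd, Measure.map_linearMap_addHaar_eq_smul_addHaar volume hd⟩

/-- A linear image of Lebesgue measure on the unit square is a multiple of Lebesgue measure on the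
cell; both sides have mass one, which fixes the multiple without computing a determinant. The
section takes values in half-open intervals `Ioc` while the cell uses `Ico`; they differ by a null
set. -/
lemma map_ofTorus {E : Mat} (hE : E.det ≠ 0) :
    Measure.map (ofTorus E) torusMeasure = cellMeasure E := by
  obtain ⟨c, hc, hmap⟩ := map_basisEquiv hE
  set S : Set (Fin 2 → ℝ) := {t | ∀ i, t i ∈ Set.Ioc (-(1 / 2) : ℝ) (-(1 / 2) + 1)}
  set S' : Set (Fin 2 → ℝ) := {t | ∀ i, t i ∈ Set.Ico (-(1 / 2) : ℝ) (1 / 2)}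
  have hS : (volume : Measure (Fin 2 → ℝ)).restrict S = volume.restrict S' := by
    refine Measure.restrict_congr_set ?_
    have h1 := Measure.univ_pi_Ioc_ae_eq_Icc (μ := fun _ : Fin 2 => (volume : Measure ℝ))
      (f := fun _ => (-(1 / 2) : ℝ)) (g := fun _ => (1 / 2 : ℝ))
    have h2 := Measure.univ_pi_Ico_ae_eq_Icc (μ := fun _ : Fin 2 => (volume : Measure ℝ))
      (f := fun _ => (-(1 / 2) : ℝ)) (g := fun _ => (1 / 2 : ℝ))
    have h3 := h1.trans h2.symm
    have e1 : S = Set.univ.pi fun _ : Fin 2 => Set.Ioc (-(1 / 2) : ℝ) (1 / 2) := by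
      ext t; simp only [S, Set.mem_ofPred_eq, Set.mem_pi, Set.mem_univ, true_imp_iff]; norm_num
    have e2 : S' = Set.univ.pi fun _ : Fin 2 => Set.Ico (-(1 / 2) : ℝ) (1 / 2) := by
      ext t; simp [S']
    rw [e1, e2]
    exact h3
  have hcell : cell E = (basisEquiv hE) '' (WithLp.toLp 2 '' S') := by
    rw [cell]
    congr 1
    ext t
    simp only [Set.mem_image, Set.mem_ofPred_eq, S']
    constructor
    · intro h; exact ⟨t.ofLp, h, rfl⟩
    · rintro ⟨s, hs, rfl⟩; exact hs
  have hpre : (basisEquiv hE) ⁻¹' (cell E) = WithLp.toLp 2 '' S' := by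
    rw [hcell, Set.preimage_image_eq _ (basisEquiv hE).injective]
  have hS'm : MeasurableSet S' := MeasurableSet.univ_pi' (fun i => measurableSet_Ico)
  let e := (MeasurableEquiv.toLp 2 (Fin 2 → ℝ))
  have hem : MeasurableSet (WithLp.toLp 2 '' S' : Set Plane) :=
    e.measurableEmbedding.measurableSet_image.2 hS'm
  have hcm : MeasurableSet (cell E) := by
    rw [hcell]
    exact (basisEquiv hE).toHomeomorph.measurableEmbedding.measurableSet_image.2 hem
  have key : Measure.map (ofTorus E) torusMeasure = c • volume.restrict (cell E) := by
    have h1 : ofTorus E = (basisEquiv hE) ∘ (WithLp.toLp 2) ∘ (fun y : UnitAddTorus (Fin 2) =>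
      (fun i => (AddCircle.equivIoc 1 (-(1 / 2) : ℝ) (y i)).1 : Fin 2 → ℝ)) := rfl
    have hm2 : Measurable (WithLp.toLp 2 : (Fin 2 → ℝ) → Plane) := e.measurable
    rw [h1, ← Measure.map_map (basisEquiv hE).continuous.measurable
      (hm2.comp measurable_equivIoc_pi), ← Measure.map_map hm2 measurable_equivIoc_pi,
      map_ofTorus_aux, hS]
    have h2 : Measure.map (WithLp.toLp 2) ((volume : Measure (Fin 2 → ℝ)).restrict S') =
        (volume : Measure Plane).restrict (WithLp.toLp 2 '' S') := by
      rw [← (PiLp.volume_preserving_toLp (Fin 2)).map_eq, Measure.restrict_map hm2 hem,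
        Set.preimage_image_eq _ (WithLp.toLp_injective 2)]
    rw [h2, ← hpre, ← Measure.restrict_map (basisEquiv hE).continuous.measurable hcm, hmap,
      Measure.restrict_smul]
  have h1 : Measure.map (ofTorus E) torusMeasure Set.univ = 1 := by
    rw [Measure.map_apply (measurable_ofTorus E) MeasurableSet.univ]; simp
  rw [key] at h1
  rw [key, cellMeasure]
  congr 1
  simp only [Measure.smul_apply, smul_eq_mul] at h1
  exact ENNReal.eq_inv_of_mul_eq_one_left h1

lemma measurePreserving_ofTorus {E : Mat} (hE : E.det ≠ 0) :
    MeasurePreserving (ofTorus E) torusMeasure (cellMeasure E) :=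
  ⟨measurable_ofTorus E, map_ofTorus hE⟩

lemma isProbabilityMeasure_cellMeasure {E : Mat} (hE : E.det ≠ 0) :
    IsProbabilityMeasure (cellMeasure E) := by
  rw [← map_ofTorus hE]
  exact Measure.isProbabilityMeasure_map (measurable_ofTorus E).aemeasurable

lemma measurePreserving_toTorus {E : Mat} (hE : E.det ≠ 0) :
    MeasurePreserving (toTorus E) (cellMeasure E) torusMeasure := by
  refine ⟨(continuous_toTorus E).measurable, ?_⟩
  rw [← map_ofTorus hE, Measure.map_map (continuous_toTorus E).measurable (measurable_ofTorus E)]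
  have : toTorus E ∘ ofTorus E = id := funext (toTorus_ofTorus hE)
  rw [this, Measure.map_id]

lemma volume_cell_ne {E : Mat} (hE : E.det ≠ 0) :
    volume.restrict (cell E) Set.univ ≠ 0 ∧ volume.restrict (cell E) Set.univ ≠ ⊤ := by
  have h := (isProbabilityMeasure_cellMeasure hE).measure_univ
  simp only [cellMeasure, Measure.smul_apply, smul_eq_mul] at h
  constructor <;> intro h0 <;> rw [h0] at h <;> simp at h

lemma memLp_cellMeasure_iff {E : Mat} (hE : E.det ≠ 0) {F : Type*} [NormedAddCommGroup F]
    {f : Plane → F} : MemLp f 2 (cellMeasure E) ↔ MemLp f 2 (volume.restrict (cell E)) := by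
  obtain ⟨h1, h2⟩ := volume_cell_ne hE
  constructor
  · intro h
    have h3 := h.smul_measure h2
    rwa [cellMeasure, smul_smul, ENNReal.mul_inv_cancel h1 h2, one_smul] at h3
  · intro h
    exact h.smul_measure (ENNReal.inv_ne_top.2 h1)

lemma setIntegral_cell {E : Mat} (hE : E.det ≠ 0) {F : Type*} [NormedAddCommGroup F]
    [NormedSpace ℝ F] (f : Plane → F) :
    ∫ x in cell E, f x = (volume.real (cell E)) • ∫ x, f x ∂cellMeasure E := by
  obtain ⟨h1, h2⟩ := volume_cell_ne hE
  rw [cellMeasure, integral_smul_measure, smul_smul, ENNReal.toReal_inv]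
  simp only [Measure.restrict_apply_univ] at h1 h2 ⊢
  rw [Measure.real, mul_inv_cancel₀ (ENNReal.toReal_ne_zero.2 ⟨h1, h2⟩), one_smul]

lemma exists_mem_cell {E : Mat} (hE : E.det ≠ 0) (x : Plane) :
    ∃ z ∈ cell E, ∃ n, x = z + latticePoint E n := by
  set t := act (refBasis E)⁻¹ x with ht
  refine ⟨act (refBasis E) (WithLp.toLp 2 fun i => t i - ⌊t i + 1 / 2⌋), ⟨_, ?_, rfl⟩,
    fun i => ⌊t i + 1 / 2⌋, ?_⟩
  · intro i
    have h1 := Int.floor_le (t i + 1 / 2)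
    have h2 := Int.lt_floor_add_one (t i + 1 / 2)
    simp only [Set.mem_Ico]
    constructor <;> linarith
  · rw [latticePoint, ← actL_apply, ← actL_apply, ← map_add, actL_apply]
    conv_lhs => rw [← act_refBasis_inv hE x, ← ht]
    congr 1
    ext i
    simp

/-- A periodic identity which holds almost everywhere on the cell holds almost everywhere. -/
lemma IsPeriodic.ae_eq_of_cellMeasure {E : Mat} (hE : E.det ≠ 0) {β : Type*} {f g : Plane → β}
    (hf : IsPeriodic E f) (hg : IsPeriodic E g) (h : f =ᵐ[cellMeasure E] g) :
    f =ᵐ[volume] g := by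
  obtain ⟨h1, h2⟩ := volume_cell_ne hE
  have h3 : volume ({x | f x ≠ g x} ∩ cell E) = 0 := by
    have h4 : f =ᵐ[volume.restrict (cell E)] g := by
      have h5 : volume.restrict (cell E) ≪ cellMeasure E := by
        rw [cellMeasure]
        exact Measure.absolutelyContinuous_smul (ENNReal.inv_ne_zero.2 h2)
      exact h5.ae_le h
    exact nonpos_iff_eq_zero.1 ((Measure.le_restrict_apply _ _).trans (ae_iff.1 h4).le)
  -- The translates of the cell by the lattice cover the plane, so the exceptional set lies in a
  -- countable union of null sets.
  have h6 : {x | f x ≠ g x} ⊆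
      ⋃ n, (fun x => x + -latticePoint E n) ⁻¹' ({x | f x ≠ g x} ∩ cell E) := by
    intro x hx
    obtain ⟨z, hz, n, rfl⟩ := exists_mem_cell hE x
    refine Set.mem_iUnion.2 ⟨n, ?_, ?_⟩
    · have hx' : f (z + latticePoint E n) ≠ g (z + latticePoint E n) := hx
      rw [hf, hg] at hx'
      simpa using hx'
    · simpa using hz
  refine measure_mono_null h6 (measure_iUnion_null fun n => ?_)
  rw [measure_preimage_add_right]
  exact h3

/-! ### Fourier coefficients, Parseval and Riesz–Fischer on the torus of the lattice. -/

/-- The frequencies `2 π E₀⁻ᵀ n`, the elements of `2 π 𝓡₀*`. -/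
def freq (E : Mat) (n : Fin 2 → ℤ) : Plane :=
  (2 * Real.pi) • act ((refBasis E)⁻¹)ᵀ (WithLp.toLp 2 fun i => (n i : ℝ))

/-- The characters `x ↦ exp (i ξ_n · x)` of the torus. -/
def expo (E : Mat) (n : Fin 2 → ℤ) (x : Plane) : ℂ :=
  Complex.exp (I * (inner ℝ (freq E n) x : ℝ))

/-- The Fourier coefficients of a function on the torus. -/
def coef (E : Mat) (f : Plane → ℂ) (n : Fin 2 → ℤ) : ℂ :=
  ∫ x, conj (expo E n x) * f x ∂cellMeasure E

lemma inner_plane (x y : Plane) : inner ℝ x y = x 0 * y 0 + x 1 * y 1 := by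
  simp [PiLp.inner_apply, Fin.sum_univ_two, mul_comm]

lemma norm_sq_plane (x : Plane) : ‖x‖ ^ 2 = x 0 ^ 2 + x 1 ^ 2 := by
  rw [EuclideanSpace.norm_sq_eq]; simp [Fin.sum_univ_two]

lemma inner_act_transpose (M : Mat) (x y : Plane) :
    inner ℝ (act Mᵀ x) y = inner ℝ x (act M y) := by
  simp only [inner_plane, act_apply, Matrix.transpose_apply]; ring

/-- The characters are those of the unit torus pulled back along the covering map; through this
identity Parseval and completeness are inherited. -/
lemma expo_eq (E : Mat) (n : Fin 2 → ℤ) (x : Plane) :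
    expo E n x = UnitAddTorus.mFourier n (toTorus E x) := by
  simp only [expo, UnitAddTorus.mFourier, ContinuousMap.coe_mk, toTorus, Fin.prod_univ_two,
    fourier_coe_apply, ← Complex.exp_add, freq, inner_smul_left, inner_act_transpose]
  congr 1
  rw [inner_plane]
  simp
  ring

lemma norm_expo (E : Mat) (n : Fin 2 → ℤ) (x : Plane) : ‖expo E n x‖ = 1 := by
  rw [expo, mul_comm, Complex.norm_exp_ofReal_mul_I]

lemma contDiff_expo (E : Mat) (n : Fin 2 → ℤ) : ContDiff ℝ ∞ (expo E n) := by
  have h : ContDiff ℝ ∞ fun x : Plane => (inner ℝ (freq E n) x : ℝ) :=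
    contDiff_const.inner ℝ contDiff_id
  exact (contDiff_const.mul (Complex.ofRealCLM.contDiff.comp h)).cexp

lemma isPeriodic_expo {E : Mat} (hE : E.det ≠ 0) (n : Fin 2 → ℤ) : IsPeriodic E (expo E n) := by
  intro m x
  rw [expo_eq, expo_eq]
  exact isPeriodic_comp_toTorus hE (UnitAddTorus.mFourier n) m x

lemma conj_expo (E : Mat) (n : Fin 2 → ℤ) (x : Plane) : conj (expo E n x) = expo E (-n) x := by
  rw [expo_eq, expo_eq, UnitAddTorus.mFourier_neg]

section Torus
local instance : MeasureSpace UnitAddCircle := ⟨AddCircle.haarAddCircle⟩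

lemma parseval_torus {f g : UnitAddTorus (Fin 2) → ℂ} (hf : MemLp f 2 torusMeasure)
    (hg : MemLp g 2 torusMeasure) :
    HasSum (fun n => conj (UnitAddTorus.mFourierCoeff f n) * UnitAddTorus.mFourierCoeff g n)
      (∫ t, conj (f t) * g t ∂torusMeasure) := by
  have h := UnitAddTorus.hasSum_prod_mFourierCoeff (d := Fin 2) (hf.toLp f) (hg.toLp g)
  have h1 : ∀ {f : UnitAddTorus (Fin 2) → ℂ} (hf : MemLp f 2 torusMeasure) n,
      UnitAddTorus.mFourierCoeff (hf.toLp f : UnitAddTorus (Fin 2) → ℂ) n =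
        UnitAddTorus.mFourierCoeff f n := by
    intro f hf n
    refine integral_congr_ae ?_
    filter_upwards [hf.coeFn_toLp] with t ht
    rw [ht]
  convert h using 1
  · funext n
    rw [← h1 hf, ← h1 hg]
    rfl
  refine integral_congr_ae ?_
  filter_upwards [hf.coeFn_toLp, hg.coeFn_toLp] with t ht ht'
  exact (congrArg₂ (fun a b => conj a * b) ht ht').symm

lemma exists_of_coef_torus {c : (Fin 2 → ℤ) → ℂ} (hc : Summable fun n => ‖c n‖ ^ 2) :
    ∃ f : UnitAddTorus (Fin 2) → ℂ, MemLp f 2 torusMeasure ∧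
      ∀ n, UnitAddTorus.mFourierCoeff f n = c n := by
  have hc' : Memℓp c 2 := by
    rw [memℓp_gen_iff (by norm_num)]
    simpa using hc
  let v : lp (fun _ : Fin 2 → ℤ => ℂ) 2 := ⟨c, hc'⟩
  let f := (UnitAddTorus.mFourierBasis (d := Fin 2)).repr.symm v
  refine ⟨f, Lp.memLp f, fun n => ?_⟩
  rw [← UnitAddTorus.mFourierBasis_repr]
  simp [f, v]

end Torus

lemma coef_eq {E : Mat} (hE : E.det ≠ 0) {f : Plane → ℂ}
    (hf : AEStronglyMeasurable f (cellMeasure E)) (n : Fin 2 → ℤ) :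
    coef E f n = UnitAddTorus.mFourierCoeff (f ∘ ofTorus E) n := by
  have h1 : coef E f n = ∫ y, conj (expo E n (ofTorus E y)) * f (ofTorus E y) ∂torusMeasure := by
    rw [coef, ← map_ofTorus hE, integral_map (measurable_ofTorus E).aemeasurable]
    rw [map_ofTorus hE]
    refine AEStronglyMeasurable.mul ?_ hf
    exact (Complex.continuous_conj.comp (contDiff_expo E n).continuous).aestronglyMeasurable
  rw [h1]
  refine integral_congr_ae (Filter.Eventually.of_forall fun y => ?_)
  simp only [expo_eq, toTorus_ofTorus hE, smul_eq_mul, Function.comp, UnitAddTorus.mFourier_neg]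

lemma parseval {E : Mat} (hE : E.det ≠ 0) {f g : Plane → ℂ} (hf : MemLp f 2 (cellMeasure E))
    (hg : MemLp g 2 (cellMeasure E)) :
    HasSum (fun n => conj (coef E f n) * coef E g n) (∫ x, conj (f x) * g x ∂cellMeasure E) := by
  have h := parseval_torus (hf.comp_measurePreserving (measurePreserving_ofTorus hE))
    (hg.comp_measurePreserving (measurePreserving_ofTorus hE))
  simp only [← coef_eq hE hf.1, ← coef_eq hE hg.1] at h
  convert h using 1
  rw [← map_ofTorus hE, integral_map (measurable_ofTorus E).aemeasurable]
  · rfl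
  · rw [map_ofTorus hE]
    exact (Complex.continuous_conj.comp_aestronglyMeasurable hf.1).mul hg.1

lemma parseval_sq {E : Mat} (hE : E.det ≠ 0) {f : Plane → ℂ} (hf : MemLp f 2 (cellMeasure E)) :
    HasSum (fun n => ‖coef E f n‖ ^ 2) (∫ x, ‖f x‖ ^ 2 ∂cellMeasure E) := by
  have h := parseval hE hf hf
  simp only [← Complex.normSq_eq_conj_mul_self, Complex.normSq_eq_norm_sq] at h
  rw [integral_complex_ofReal] at h
  exact_mod_cast h

lemma coef_sub {E : Mat} {f g : Plane → ℂ} (hE : E.det ≠ 0)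
    (hf : MemLp f 2 (cellMeasure E)) (hg : MemLp g 2 (cellMeasure E)) (n : Fin 2 → ℤ) :
    coef E (fun x => f x - g x) n = coef E f n - coef E g n := by
  have := isProbabilityMeasure_cellMeasure hE
  have h : ∀ {f : Plane → ℂ}, MemLp f 2 (cellMeasure E) →
      Integrable (fun x => conj (expo E n x) * f x) (cellMeasure E) := by
    intro f hf
    refine (hf.integrable (by norm_num)).bdd_mul (c := 1)
      (Complex.continuous_conj.comp (contDiff_expo E n).continuous).aestronglyMeasurable ?_
    refine Filter.Eventually.of_forall fun x => ?_
    simp [norm_expo]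
  simp only [coef, mul_sub]
  exact integral_sub (h hf) (h hg)

lemma ae_eq_of_coef_eq {E : Mat} (hE : E.det ≠ 0) {f g : Plane → ℂ}
    (hf : MemLp f 2 (cellMeasure E)) (hg : MemLp g 2 (cellMeasure E))
    (h : ∀ n, coef E f n = coef E g n) : f =ᵐ[cellMeasure E] g := by
  have h1 := parseval_sq hE (hf.sub hg)
  have h2 : ∀ n, coef E (f - g) n = 0 := fun n => by
    have := coef_sub hE hf hg n
    rw [h, sub_self] at this
    exact this
  simp only [h2, norm_zero, ne_eq, OfNat.ofNat_ne_zero, not_false_eq_true, zero_pow] at h1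
  have h3 := h1.unique hasSum_zero
  have h4 := (integral_eq_zero_iff_of_nonneg (fun x => by positivity)
    ((hf.sub hg).integrable_norm_pow (by norm_num))).1 h3
  filter_upwards [h4] with x hx
  simpa [sub_eq_zero] using hx

/-- Riesz-Fischer for the torus. -/
lemma exists_of_coef {E : Mat} (hE : E.det ≠ 0) {c : (Fin 2 → ℤ) → ℂ}
    (hc : Summable fun n => ‖c n‖ ^ 2) :
    ∃ f : Plane → ℂ, IsPeriodic E f ∧ MemLp f 2 (cellMeasure E) ∧ ∀ n, coef E f n = c n := by
  obtain ⟨g, hg, hgc⟩ := exists_of_coef_torus hc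
  have hm := hg.comp_measurePreserving (measurePreserving_toTorus hE)
  refine ⟨g ∘ toTorus E, isPeriodic_comp_toTorus hE g, hm, fun n => ?_⟩
  rw [coef_eq hE hm.1, ← hgc]
  congr 1
  funext y
  simp [toTorus_ofTorus hE]

/-! ### Translation invariance, periodic functions and Fourier coefficients of derivatives. -/

/-- Integrals of periodic functions over the cell are invariant under translation. -/
lemma integral_translate {E : Mat} (hE : E.det ≠ 0) {F : Type*} [NormedAddCommGroup F]
    [NormedSpace ℝ F] {f : Plane → F} (hf : IsPeriodic E f) (hc : Continuous f) (h : Plane) :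
    ∫ x, f (x + h) ∂cellMeasure E = ∫ x, f x ∂cellMeasure E := by
  have h1 : ∀ {g : Plane → F}, Continuous g →
      ∫ x, g x ∂cellMeasure E = ∫ y, g (ofTorus E y) ∂torusMeasure := fun hg => by
    rw [← map_ofTorus hE, integral_map (measurable_ofTorus E).aemeasurable
      hg.aestronglyMeasurable]
  rw [h1 hc, h1 (g := fun x => f (x + h)) (by fun_prop),
      ← integral_add_right_eq_self (fun y => f (ofTorus E y)) (toTorus E h)]
  refine integral_congr_ae (Filter.Eventually.of_forall fun y => ?_)
  refine hf.eq_of_toTorus hE ?_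
  rw [toTorus_add, toTorus_ofTorus hE, toTorus_ofTorus hE]

lemma IsPeriodic.comp {E : Mat} {β γ : Type*} {f : Plane → β} (hf : IsPeriodic E f)
    (L : β → γ) : IsPeriodic E fun x => L (f x) :=
  fun n x => congrArg L (hf n x)

lemma IsPeriodic.exists_bound {E : Mat} (hE : E.det ≠ 0) {F : Type*} [NormedAddCommGroup F]
    {f : Plane → F} (hf : IsPeriodic E f) (hc : Continuous f) : ∃ C, ∀ x, ‖f x‖ ≤ C := by
  have hb : cell E ⊆ Metric.closedBall 0 ‖actL (refBasis E)‖ := by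
    rintro _ ⟨t, ht, rfl⟩
    rw [mem_closedBall_zero_iff, ← actL_apply]
    refine (ContinuousLinearMap.le_opNorm _ _).trans (mul_le_of_le_one_right (norm_nonneg _) ?_)
    have h0 := ht 0
    have h1 := ht 1
    simp only [Set.mem_Ico] at h0 h1
    rw [← abs_norm, ← sq_le_one_iff_abs_le_one, norm_sq_plane]
    nlinarith
  obtain ⟨C, hC⟩ :=
    (isCompact_closedBall (0 : Plane) ‖actL (refBasis E)‖).exists_bound_of_continuousOn
    hc.continuousOn
  refine ⟨C, fun x => ?_⟩
  obtain ⟨z, hz, n, rfl⟩ := exists_mem_cell hE x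
  rw [hf]
  exact hC z (hb hz)

lemma IsPeriodic.memLp {E : Mat} (hE : E.det ≠ 0) {F : Type*} [NormedAddCommGroup F]
    [SecondCountableTopology F] {f : Plane → F} (hf : IsPeriodic E f) (hc : Continuous f)
    (p : ENNReal) : MemLp f p (cellMeasure E) := by
  have := isProbabilityMeasure_cellMeasure hE
  obtain ⟨C, hC⟩ := hf.exists_bound hE hc
  exact MemLp.of_bound hc.aestronglyMeasurable C (Filter.Eventually.of_forall hC)

lemma IsPeriodic.fderiv {E : Mat} {F : Type*} [NormedAddCommGroup F] [NormedSpace ℝ F]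
    {f : Plane → F} (hf : IsPeriodic E f) : IsPeriodic E (fderiv ℝ f) := by
  intro n x
  rw [← fderiv_comp_add_right]
  congr 1
  funext y
  exact hf n y

lemma IsPeriodic.iteratedFDeriv {E : Mat} {F : Type*} [NormedAddCommGroup F] [NormedSpace ℝ F]
    {f : Plane → F} (hf : IsPeriodic E f) (k : ℕ) : IsPeriodic E (iteratedFDeriv ℝ k f) := by
  intro n x
  rw [← iteratedFDeriv_comp_add_right]
  congr 1
  funext y
  exact hf n y

/-- The integral of `g (x + t v)` does not depend on `t`; differentiating under the integral sign at
`t = 0` gives the claim. This replaces a divergence theorem on the cell. -/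
lemma integral_fderiv_eq_zero {E : Mat} (hE : E.det ≠ 0) {g : Plane → ℂ} (hg : ContDiff ℝ 1 g)
    (hp : IsPeriodic E g) (v : Plane) : ∫ x, fderiv ℝ g x v ∂cellMeasure E = 0 := by
  have := isProbabilityMeasure_cellMeasure hE
  have hcd : Continuous (fderiv ℝ g) := hg.continuous_fderiv (by norm_num)
  obtain ⟨C, hC⟩ := hp.fderiv.exists_bound hE hcd
  have key := hasDerivAt_integral_of_dominated_loc_of_deriv_le (μ := cellMeasure E)
    (F := fun (t : ℝ) x => g (x + t • v)) (F' := fun t x => fderiv ℝ g (x + t • v) v) (x₀ := 0)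
    (s := Set.univ) (bound := fun _ => C * ‖v‖) Filter.univ_mem
    (Filter.Eventually.of_forall fun t => by
      have := hg.continuous
      exact Continuous.aestronglyMeasurable (by fun_prop))
    (by simpa using (hp.memLp hE hg.continuous 1).integrable le_rfl)
    (Continuous.aestronglyMeasurable (by fun_prop))
    (Filter.Eventually.of_forall fun x t _ =>
      ((fderiv ℝ g (x + t • v)).le_opNorm v).trans (by gcongr; exact hC _))
    (integrable_const _)
    (Filter.Eventually.of_forall fun x t _ => by
      have h1 : HasFDerivAt g (fderiv ℝ g (x + t • v)) (x + t • v) :=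
        (hg.differentiable (by norm_num) _).hasFDerivAt
      have h2 : HasDerivAt (fun t : ℝ => x + t • v) v t := by
        simpa using ((hasDerivAt_id t).smul_const v).const_add x
      exact h1.comp_hasDerivAt t h2)
  have h3 := key.2
  simp only [integral_translate hE hp hg.continuous, zero_smul, add_zero] at h3
  exact h3.unique (hasDerivAt_const _ _)

lemma hasFDerivAt_expo (E : Mat) (n : Fin 2 → ℤ) (x : Plane) :
    HasFDerivAt (expo E n)
      ((expo E n x * I) • (Complex.ofRealCLM.comp (innerSL ℝ (freq E n)))) x := by
  have h1 : HasFDerivAt (fun x : Plane => I * ((inner ℝ (freq E n) x : ℝ) : ℂ))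
      (I • (Complex.ofRealCLM.comp (innerSL ℝ (freq E n)))) x :=
    ((Complex.ofRealCLM.comp (innerSL ℝ (freq E n))).hasFDerivAt).const_mul I
  have h2 := h1.cexp
  rw [smul_smul] at h2
  exact h2

lemma fderiv_expo (E : Mat) (n : Fin 2 → ℤ) (x v : Plane) :
    fderiv ℝ (expo E n) x v = I * (inner ℝ (freq E n) v : ℝ) * expo E n x := by
  rw [(hasFDerivAt_expo E n x).fderiv]
  simp
  ring

lemma freq_neg (E : Mat) (n : Fin 2 → ℤ) : freq E (-n) = -freq E n := by
  have : (WithLp.toLp 2 fun i => (((-n) i : ℤ) : ℝ) : Plane) =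
      -WithLp.toLp 2 fun i => (n i : ℝ) := by
    ext i; simp
  rw [freq, this, ← actL_apply, map_neg, smul_neg]
  rfl

lemma integrable_conj_expo_mul {E : Mat} {n : Fin 2 → ℤ} {f : Plane → ℂ}
    (hf : Integrable f (cellMeasure E)) :
    Integrable (fun x => conj (expo E n x) * f x) (cellMeasure E) := by
  refine hf.bdd_mul (c := 1)
    (Complex.continuous_conj.comp (contDiff_expo E n).continuous).aestronglyMeasurable ?_
  exact Filter.Eventually.of_forall fun x => by simp [norm_expo]

lemma coef_fderiv {E : Mat} (hE : E.det ≠ 0) {g : Plane → ℂ} (hg : ContDiff ℝ 1 g)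
    (hp : IsPeriodic E g) (v : Plane) (n : Fin 2 → ℤ) :
    coef E (fun x => fderiv ℝ g x v) n = I * (inner ℝ (freq E n) v : ℝ) * coef E g n := by
  have := isProbabilityMeasure_cellMeasure hE
  have hcd : Continuous (fderiv ℝ g) := hg.continuous_fderiv (by norm_num)
  have he1 : ContDiff ℝ 1 (expo E (-n)) := (contDiff_expo E (-n)).of_le (by simp)
  -- Integration by parts against the conjugate character, via the product rule.
  have h0 := integral_fderiv_eq_zero hE (he1.mul hg)
    (fun m x => congrArg₂ (· * ·) (isPeriodic_expo hE (-n) m x) (hp m x)) v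
  have h1 : ∀ x, fderiv ℝ (fun x => expo E (-n) x * g x) x v =
      conj (expo E n x) * fderiv ℝ g x v -
        I * (inner ℝ (freq E n) v : ℝ) * (conj (expo E n x) * g x) := by
    intro x
    rw [fderiv_fun_mul (he1.differentiable (by norm_num) x) (hg.differentiable (by norm_num) x)]
    simp only [FunLike.coe_add, FunLike.coe_smul, Pi.add_apply, Pi.smul_apply, fderiv_expo,
      smul_eq_mul, conj_expo, freq_neg,
      inner_neg_left]
    push_cast
    ring
  simp only [h1] at h0
  have i1 : Integrable (fun x => conj (expo E n x) * fderiv ℝ g x v) (cellMeasure E) := by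
    refine integrable_conj_expo_mul
      (IsPeriodic.memLp hE (hp.fderiv.comp fun L => L v) (by fun_prop) 1
      |>.integrable le_rfl)
  have i2 : Integrable (fun x => conj (expo E n x) * g x) (cellMeasure E) :=
    integrable_conj_expo_mul ((hp.memLp hE hg.continuous 1).integrable le_rfl)
  rw [integral_sub i1 (i2.const_mul _), integral_const_mul, sub_eq_zero] at h0
  exact h0

/-! ### Real functions, and the Sobolev space in terms of coefficients. -/

/-- The Fourier coefficients of a real function. -/
def rcoef (E : Mat) (f : Plane → ℝ) (n : Fin 2 → ℤ) : ℂ := coef E (fun x => (f x : ℂ)) n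

lemma expo_zero (E : Mat) (x : Plane) : expo E 0 x = 1 := by
  rw [expo_eq, UnitAddTorus.mFourier_zero]; rfl

lemma rcoef_zero (E : Mat) (f : Plane → ℝ) : rcoef E f 0 = (∫ x, f x ∂cellMeasure E : ℝ) := by
  simp only [rcoef, coef, expo_zero, map_one, one_mul]
  exact integral_complex_ofReal

lemma rcoef_neg (E : Mat) (f : Plane → ℝ) (n : Fin 2 → ℤ) :
    rcoef E f (-n) = conj (rcoef E f n) := by
  rw [rcoef, rcoef, coef, coef, ← integral_conj]
  simp [← conj_expo]

lemma integral_proj {E : Mat} {u : Plane → Plane} (hu : Integrable u (cellMeasure E))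
    (i : Fin 2) : (∫ x, u x ∂cellMeasure E) i = ∫ x, u x i ∂cellMeasure E :=
  ((EuclideanSpace.proj (𝕜 := ℝ) i : Plane →L[ℝ] ℝ).integral_comp_comm hu).symm

lemma memLp_proj {E : Mat} {u : Plane → Plane} {p : ENNReal} (hu : MemLp u p (cellMeasure E))
    (i : Fin 2) : MemLp (fun x => u x i) p (cellMeasure E) :=
  (EuclideanSpace.proj (𝕜 := ℝ) i : Plane →L[ℝ] ℝ).comp_memLp' hu

lemma memLp_of_proj {E : Mat} {u : Plane → Plane} {p : ENNReal}
    (hu : ∀ i, MemLp (fun x => u x i) p (cellMeasure E)) : MemLp u p (cellMeasure E) := by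
  have h : u = fun x => ∑ i, u x i • (EuclideanSpace.single i (1 : ℝ) : Plane) := by
    funext x; ext j; simp [Fin.sum_univ_two]; fin_cases j <;> simp
  rw [h]
  exact memLp_finsetSum _ fun i _ => (ContinuousLinearMap.toSpanSingleton ℝ
    (EuclideanSpace.single i (1 : ℝ) : Plane)).comp_memLp' (hu i)

lemma parseval_real {E : Mat} (hE : E.det ≠ 0) {f g : Plane → ℝ}
    (hf : MemLp f 2 (cellMeasure E)) (hg : MemLp g 2 (cellMeasure E)) :
    HasSum (fun n => conj (rcoef E f n) * rcoef E g n)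
      ((∫ x, f x * g x ∂cellMeasure E : ℝ) : ℂ) := by
  have h := parseval hE (hf.ofReal (K := ℂ)) (hg.ofReal (K := ℂ))
  convert h using 1
  · rfl
  · rw [← integral_complex_ofReal]
    simp

lemma parseval_real_sq {E : Mat} (hE : E.det ≠ 0) {f : Plane → ℝ}
    (hf : MemLp f 2 (cellMeasure E)) :
    HasSum (fun n => ‖rcoef E f n‖ ^ 2) (∫ x, f x ^ 2 ∂cellMeasure E) := by
  have h := parseval_sq hE (hf.ofReal (K := ℂ))
  convert h using 1
  · rfl
  · simp

lemma MemSobolev.memLp_cell {E : Mat} (hE : E.det ≠ 0) {u : Plane → Plane} {G : Plane → Mat}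
    (h : MemSobolev E u G) : MemLp u 2 (cellMeasure E) :=
  (memLp_cellMeasure_iff hE).2 h.memLp

lemma MemSobolev.memLp_grad_cell {E : Mat} (hE : E.det ≠ 0) {u : Plane → Plane}
    {G : Plane → Mat} (h : MemSobolev E u G) (i j : Fin 2) :
    MemLp (fun x => G x i j) 2 (cellMeasure E) :=
  (memLp_cellMeasure_iff hE).2 (h.memLp_grad i j)

lemma MemSobolev.rcoef_zero {E : Mat} (hE : E.det ≠ 0) {u : Plane → Plane} {G : Plane → Mat}
    (h : MemSobolev E u G) (i : Fin 2) : rcoef E (fun x => u x i) 0 = 0 := by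
  have := isProbabilityMeasure_cellMeasure hE
  rw [Bilayer.rcoef_zero, ← integral_proj ((h.memLp_cell hE).integrable (by norm_num)),
    ← average_cell, h.mean_zero]
  simp

lemma weak_grad_iff {E : Mat} (hE : E.det ≠ 0) (f g h k : Plane → ℝ) :
    (∫ x in cell E, f x * g x = -∫ x in cell E, h x * k x) ↔
      ∫ x, f x * g x ∂cellMeasure E = -∫ x, h x * k x ∂cellMeasure E := by
  obtain ⟨h1, h2⟩ := volume_cell_ne hE
  have h3 : volume.real (cell E) ≠ 0 := by
    simp only [Measure.restrict_apply_univ] at h1 h2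
    exact ENNReal.toReal_ne_zero.2 ⟨h1, h2⟩
  rw [setIntegral_cell hE, setIntegral_cell hE, ← smul_neg]
  exact smul_right_inj h3

lemma MemSobolev.rcoef_grad {E : Mat} (hE : E.det ≠ 0) {u : Plane → Plane} {G : Plane → Mat}
    (h : MemSobolev E u G) (i j : Fin 2) (n : Fin 2 → ℤ) :
    rcoef E (fun x => G x i j) n = I * (freq E n j : ℝ) * rcoef E (fun x => u x i) n := by
  have := isProbabilityMeasure_cellMeasure hE
  have hu := memLp_proj (h.memLp_cell hE) i
  have hG := h.memLp_grad_cell hE i j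
  -- The weak gradient is tested against real functions only, so the character enters through real
  -- linear functionals, afterwards the real and the imaginary part.
  have test : ∀ L : ℂ →L[ℝ] ℝ,
      ∫ x, L (u x i * (I * (freq E (-n) j : ℝ) * expo E (-n) x)) ∂cellMeasure E =
        -∫ x, L (G x i j * expo E (-n) x) ∂cellMeasure E := by
    intro L
    have h1 := (weak_grad_iff hE _ _ _ _).1 (h.weak_grad (fun x => L (expo E (-n) x))
      (L.contDiff.comp (contDiff_expo E (-n)))
      ((isPeriodic_expo hE (-n)).comp L) i j)
    have h2 : ∀ x, fderiv ℝ (fun x => L (expo E (-n) x)) x (EuclideanSpace.single j 1) =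
        L (I * (freq E (-n) j : ℝ) * expo E (-n) x) := by
      intro x
      have h3 := L.hasFDerivAt.comp x (hasFDerivAt_expo E (-n) x).differentiableAt.hasFDerivAt
      rw [show (fun x => L (expo E (-n) x)) = L ∘ expo E (-n) from rfl, h3.fderiv]
      simp only [ContinuousLinearMap.comp_apply, fderiv_expo]
      congr 4
      simp [EuclideanSpace.inner_single_right]
    simp only [h2] at h1
    have h4 : ∀ (r : ℝ) (z : ℂ), L (r * z) = r * L z := fun r z => by
      rw [← Complex.real_smul, map_smul, smul_eq_mul]
    simpa only [h4] using h1
  have i1 : Integrable (fun x => (u x i : ℂ) * (I * (freq E (-n) j : ℝ) * expo E (-n) x))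
      (cellMeasure E) := by
    have := (integrable_conj_expo_mul (n := n) ((hu.integrable (by norm_num)).ofReal
      (𝕜 := ℂ))).const_mul (I * (freq E (-n) j : ℝ))
    refine this.congr (Filter.Eventually.of_forall fun x => ?_)
    simp only [conj_expo, Complex.coe_algebraMap]
    ring_nf
  have i2 : Integrable (fun x => (G x i j : ℂ) * expo E (-n) x) (cellMeasure E) := by
    have := (integrable_conj_expo_mul (n := n) ((hG.integrable (by norm_num)).ofReal
      (𝕜 := ℂ)))
    refine this.congr (Filter.Eventually.of_forall fun x => ?_)
    simp only [conj_expo]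
    exact mul_comm _ _
  have key : ∫ x, (u x i : ℂ) * (I * (freq E (-n) j : ℝ) * expo E (-n) x) ∂cellMeasure E =
      -∫ x, (G x i j : ℂ) * expo E (-n) x ∂cellMeasure E := by
    apply Complex.ext
    · have h1 := test Complex.reCLM
      rw [Complex.reCLM.integral_comp_comm i1, Complex.reCLM.integral_comp_comm i2] at h1
      exact h1
    · have h1 := test Complex.imCLM
      rw [Complex.imCLM.integral_comp_comm i1, Complex.imCLM.integral_comp_comm i2] at h1
      exact h1
  rw [rcoef, rcoef, coef, coef, ← integral_const_mul]
  have e1 : ∫ x, (G x i j : ℂ) * expo E (-n) x ∂cellMeasure E =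
      ∫ x, conj (expo E n x) * (G x i j : ℂ) ∂cellMeasure E := by
    simp only [conj_expo, mul_comm]
  rw [← e1, ← neg_eq_iff_eq_neg.2 key, ← integral_neg]
  congr 1
  funext x
  rw [freq_neg, conj_expo]
  simp
  ring

/-- Converse of `MemSobolev.rcoef_grad`. Parseval turns the weak identity into a sum over
frequencies in which every term vanishes, because conjugation changes the sign of the symbol `i
ξ_j`. -/
lemma memSobolev_of_rcoef {E : Mat} (hE : E.det ≠ 0) {u : Plane → Plane} {G : Plane → Mat}
    (hu : IsPeriodic E u) (hG : IsPeriodic E G) (hu2 : MemLp u 2 (cellMeasure E))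
    (hG2 : ∀ i j, MemLp (fun x => G x i j) 2 (cellMeasure E))
    (h0 : ∀ i, rcoef E (fun x => u x i) 0 = 0)
    (h : ∀ i j n, rcoef E (fun x => G x i j) n =
      I * (freq E n j : ℝ) * rcoef E (fun x => u x i) n) : MemSobolev E u G := by
  have := isProbabilityMeasure_cellMeasure hE
  refine ⟨hu, hG, (memLp_cellMeasure_iff hE).1 hu2,
    fun i j => (memLp_cellMeasure_iff hE).1 (hG2 i j), ?_, ?_⟩
  · rw [average_cell]
    ext i
    have h1 := h0 i
    rw [rcoef_zero] at h1
    rw [integral_proj (hu2.integrable (by norm_num))]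
    exact_mod_cast h1
  · intro φ hφ hp i j
    rw [weak_grad_iff hE]
    have hd : Continuous (fderiv ℝ φ) := hφ.continuous_fderiv (by simp)
    have hφ2 := hp.memLp hE hφ.continuous 2
    have hφd : MemLp (fun x => fderiv ℝ φ x (EuclideanSpace.single j 1)) 2 (cellMeasure E) :=
      IsPeriodic.memLp hE (fun m x => by rw [hp.fderiv m x]) (by fun_prop) 2
    have p1 := parseval_real hE (memLp_proj hu2 i) hφd
    have p2 := parseval_real hE (hG2 i j) hφ2
    have hc : ∀ n, rcoef E (fun x => fderiv ℝ φ x (EuclideanSpace.single j 1)) n =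
        I * (freq E n j : ℝ) * rcoef E φ n := by
      intro n
      have h1 := coef_fderiv hE (g := fun x => (φ x : ℂ))
        (Complex.ofRealCLM.contDiff.comp (hφ.of_le (by simp)))
        (hp.comp _) (EuclideanSpace.single j 1) n
      have h2 : (inner ℝ (freq E n) (EuclideanSpace.single j (1 : ℝ)) : ℝ) = freq E n j := by
        simp [EuclideanSpace.inner_single_right]
      rw [h2] at h1
      rw [rcoef, rcoef, ← h1]
      congr 1
      funext x
      have h3 := Complex.ofRealCLM.hasFDerivAt.comp x
        (hφ.differentiable (by simp) x).hasFDerivAt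
      rw [show (fun x => (φ x : ℂ)) = Complex.ofRealCLM ∘ φ from rfl, h3.fderiv]
      rfl
    have p3 := p1.add p2
    have h3 : ∀ n, conj (rcoef E (fun x => u x i) n) *
        rcoef E (fun x => fderiv ℝ φ x (EuclideanSpace.single j 1)) n +
        conj (rcoef E (fun x => G x i j) n) * rcoef E φ n = 0 := by
      intro n
      rw [hc, h]
      simp
      ring
    simp only [h3] at p3
    have p4 := p3.unique hasSum_zero
    rw [eq_neg_iff_add_eq_zero]
    exact_mod_cast p4

/-! ### The dual lattice and the spectral gap. -/

lemma inner_freq_latticePoint {E : Mat} (hE : E.det ≠ 0) (n m : Fin 2 → ℤ) :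
    inner ℝ (freq E n) (latticePoint E m) = 2 * Real.pi * (n 0 * m 0 + n 1 * m 1) := by
  rw [freq, inner_smul_left, inner_act_transpose, latticePoint, act_inv_refBasis hE, inner_plane]
  simp

lemma freq_mem_dualLattice {E : Mat} (hE : E.det ≠ 0) (n : Fin 2 → ℤ) :
    (2 * Real.pi)⁻¹ • freq E n ∈ dualLattice E := by
  intro m
  refine ⟨n 0 * m 0 + n 1 * m 1, ?_⟩
  rw [inner_smul_left, inner_freq_latticePoint hE]
  have := Real.pi_ne_zero
  simp
  field_simp

lemma freq_eq_zero_iff {E : Mat} (hE : E.det ≠ 0) {n : Fin 2 → ℤ} : freq E n = 0 ↔ n = 0 := by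
  constructor
  · intro h
    have h1 : ∀ m : Fin 2 → ℤ, (n 0 * m 0 + n 1 * m 1 : ℝ) = 0 := fun m => by
      have h2 := inner_freq_latticePoint hE n m
      rw [h, inner_zero_left] at h2
      have := Real.pi_ne_zero
      have h3 := h2.symm
      simpa [this] using h3
    have h0 := h1 (Pi.single 0 1)
    have h2 := h1 (Pi.single 1 1)
    simp at h0 h2
    ext i
    fin_cases i
    · exact h0
    · exact h2
  · rintro rfl
    ext i
    simp [freq, act_apply]

/-- Nonzero elements of the dual lattice are bounded away from zero. -/
lemma exists_le_of_inner_latticePoint (E : Mat) : ∃ B > 0, ∀ (i : Fin 2) (k : Plane) (r : ℝ),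
    inner ℝ k (latticePoint E (Pi.single i 1)) = r → |r| ≤ B * ‖k‖ := by
  refine ⟨∑ i, ‖latticePoint E (Pi.single i 1)‖ + 1, by positivity, ?_⟩
  rintro i k r rfl
  refine (abs_real_inner_le_norm _ _).trans ?_
  rw [mul_comm]
  gcongr
  have := Finset.single_le_sum (f := fun i : Fin 2 => ‖latticePoint E (Pi.single i 1)‖)
    (fun i _ => norm_nonneg _) (Finset.mem_univ i)
  linarith

lemma exists_norm_le_freq {E : Mat} (hE : E.det ≠ 0) :
    ∃ b > 0, ∀ n : Fin 2 → ℤ, b * ‖n‖ ≤ ‖freq E n‖ := by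
  obtain ⟨B, hB, h⟩ := exists_le_of_inner_latticePoint E
  have hpi := Real.pi_pos
  refine ⟨2 * Real.pi / B, by positivity, fun n => ?_⟩
  have h1 : ‖n‖ ≤ B / (2 * Real.pi) * ‖freq E n‖ := by
    refine (pi_norm_le_iff_of_nonneg (by positivity)).2 fun i => ?_
    have h2 := h i (freq E n) _ (inner_freq_latticePoint hE n _)
    have h3 : (n 0 * (Pi.single i 1 : Fin 2 → ℤ) 0 + n 1 * (Pi.single i 1 : Fin 2 → ℤ) 1 : ℝ) =
        n i := by fin_cases i <;> simp
    rw [h3, abs_mul, abs_of_pos (by positivity : 0 < 2 * Real.pi)] at h2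
    rw [Int.norm_eq_abs, div_mul_eq_mul_div, le_div_iff₀ (by positivity)]
    linarith
  calc 2 * Real.pi / B * ‖n‖ ≤ 2 * Real.pi / B * (B / (2 * Real.pi) * ‖freq E n‖) := by gcongr
    _ = ‖freq E n‖ := by field_simp

lemma gap_bddBelow (E : Mat) :
    BddBelow {r : ℝ | ∃ k ∈ dualLattice E, k ≠ 0 ∧ r = ‖(2 * Real.pi) • k‖ ^ 2} := by
  refine ⟨0, ?_⟩
  rintro r ⟨k, -, -, rfl⟩
  positivity

lemma gap_le {E : Mat} (hE : E.det ≠ 0) {n : Fin 2 → ℤ} (hn : n ≠ 0) :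
    gap E ≤ ‖freq E n‖ ^ 2 := by
  have hpi := Real.pi_ne_zero
  refine csInf_le (gap_bddBelow E) ⟨_, freq_mem_dualLattice hE n, ?_, ?_⟩
  · simp [hpi, (freq_eq_zero_iff hE).not.2 hn]
  · rw [smul_smul, mul_inv_cancel₀ (by simp), one_smul]

lemma gap_pos {E : Mat} (hE : E.det ≠ 0) : 0 < gap E := by
  obtain ⟨B, hB, h⟩ := exists_le_of_inner_latticePoint E
  have hpi := Real.pi_pos
  have hlt : (0 : ℝ) < (2 * Real.pi / B) ^ 2 := by positivity
  refine hlt.trans_le (le_csInf ⟨_, _, freq_mem_dualLattice hE (Pi.single 0 1), ?_, rfl⟩ ?_)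
  · have : (Pi.single 0 1 : Fin 2 → ℤ) ≠ 0 := by simp
    simp [hpi.ne', (freq_eq_zero_iff hE).not.2 this]
  · rintro r ⟨k, hk, hk0, rfl⟩
    rw [norm_smul, Real.norm_of_nonneg (by positivity), div_eq_mul_inv]
    gcongr
    -- A nonzero dual vector pairs with some basis vector of the lattice to a nonzero integer, of
    -- modulus at least one; this bounds its length from below.
    have h1 : ∃ i : Fin 2, inner ℝ k (latticePoint E (Pi.single i 1)) ≠ 0 := by
      by_contra! h2
      apply hk0
      have h3 : ∀ t : Plane, inner ℝ k (act (refBasis E) t) = 0 := by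
        intro t
        have h4 : act (refBasis E) t = t 0 • latticePoint E (Pi.single 0 1) +
            t 1 • latticePoint E (Pi.single 1 1) := by
          ext i
          simp [latticePoint, act_apply]
          ring
        rw [h4, inner_add_right, inner_smul_right, inner_smul_right, h2, h2]
        simp
      have h5 := h3 (act (refBasis E)⁻¹ k)
      rwa [act_refBasis_inv hE, inner_self_eq_zero] at h5
    obtain ⟨i, hi⟩ := h1
    obtain ⟨m, hm⟩ := hk (Pi.single i 1)
    have h6 := h i k m hm
    have h7 : (1 : ℝ) ≤ |(m : ℝ)| := by
      rw [hm] at hi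
      exact_mod_cast Int.one_le_abs (by exact_mod_cast hi)
    rw [inv_le_iff_one_le_mul₀ hB]
    linarith

/-! ### Poincaré and Korn inequalities. -/

/-- The squared modulus of the `n`-th Fourier coefficient of a vector field. -/
def ampSq (E : Mat) (u : Plane → Plane) (n : Fin 2 → ℤ) : ℝ :=
  ∑ i, ‖rcoef E (fun x => u x i) n‖ ^ 2

lemma ampSq_nonneg (E : Mat) (u : Plane → Plane) (n : Fin 2 → ℤ) : 0 ≤ ampSq E u n := by
  unfold ampSq; positivity

lemma hasSum_ampSq {E : Mat} (hE : E.det ≠ 0) {u : Plane → Plane}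
    (hu : MemLp u 2 (cellMeasure E)) :
    HasSum (ampSq E u) (∫ x, ‖u x‖ ^ 2 ∂cellMeasure E) := by
  have h1 : ∫ x, ‖u x‖ ^ 2 ∂cellMeasure E = ∑ i, ∫ x, u x i ^ 2 ∂cellMeasure E := by
    rw [← integral_finsetSum _ fun i _ => (memLp_proj hu i).integrable_sq]
    simp [norm_sq_plane]
  rw [h1]
  exact hasSum_sum fun i _ => parseval_real_sq hE (memLp_proj hu i)

lemma MemSobolev.hasSum_grad {E : Mat} (hE : E.det ≠ 0) {u : Plane → Plane} {G : Plane → Mat}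
    (h : MemSobolev E u G) :
    HasSum (fun n => ‖freq E n‖ ^ 2 * ampSq E u n)
      (∫ x, ∑ i, ∑ j, G x i j ^ 2 ∂cellMeasure E) := by
  have hi : ∀ i j, Integrable (fun x => G x i j ^ 2) (cellMeasure E) := fun i j =>
    (h.memLp_grad_cell hE i j).integrable_sq
  rw [integral_finsetSum _ fun i _ => integrable_finsetSum _ fun j _ => hi i j]
  simp_rw [fun i => integral_finsetSum (μ := cellMeasure E) _ fun j (_ : j ∈ Finset.univ) => hi i j]
  have h1 := hasSum_sum (s := Finset.univ) fun i _ => hasSum_sum (s := Finset.univ) fun j _ =>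
    parseval_real_sq hE (h.memLp_grad_cell hE i j)
  refine h1.congr_fun fun n => ?_
  simp only [h.rcoef_grad hE, norm_mul, Complex.norm_I, Complex.norm_real, mul_pow, ampSq,
    norm_sq_plane, Fin.sum_univ_two, Real.norm_eq_abs, sq_abs]
  ring

lemma MemSobolev.poincare {E : Mat} (hE : E.det ≠ 0) {u : Plane → Plane} {G : Plane → Mat}
    (h : MemSobolev E u G) :
    gap E * ∫ x, ‖u x‖ ^ 2 ∂cellMeasure E ≤ ∫ x, ∑ i, ∑ j, G x i j ^ 2 ∂cellMeasure E := by
  refine hasSum_le (fun n => ?_) ((hasSum_ampSq hE (h.memLp_cell hE)).mul_left _)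
    (h.hasSum_grad hE)
  rcases eq_or_ne n 0 with rfl | hn
  · have : ampSq E u 0 = 0 := by simp [ampSq, h.rcoef_zero hE]
    simp [this]
  · exact mul_le_mul_of_nonneg_right (gap_le hE hn) (ampSq_nonneg _ _ _)

/-- The last bracket is minus the polarized determinant (it equals `-2 det A` when `A = B`), a null
Lagrangian: it integrates to zero over the torus for gradients. -/
lemma elasticPairing_eq (lam mu : ℝ) (A B : Mat) :
    elasticPairing lam mu A B = (lam + mu) * (A.trace * B.trace) + mu * ∑ i, ∑ j, A i j * B i j +
      mu * ((A 0 1 * B 1 0 - A 0 0 * B 1 1) + (A 1 0 * B 0 1 - A 1 1 * B 0 0)) := by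
  simp [elasticPairing, strain, Fin.sum_univ_two, Matrix.trace]
  ring

/-- Two integrations by parts exchange the derivatives; on coefficients, both sides carry the same
product `ξ_j ξ_l`. -/
lemma MemSobolev.integral_swap {E : Mat} (hE : E.det ≠ 0) {u v : Plane → Plane}
    {G H : Plane → Mat} (hu : MemSobolev E u G) (hv : MemSobolev E v H) (i j k l : Fin 2) :
    ∫ x, G x i j * H x k l ∂cellMeasure E = ∫ x, G x i l * H x k j ∂cellMeasure E := by
  have h1 := parseval_real hE (hu.memLp_grad_cell hE i j) (hv.memLp_grad_cell hE k l)
  have h2 := parseval_real hE (hu.memLp_grad_cell hE i l) (hv.memLp_grad_cell hE k j)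
  have h3 := h1.unique (h2.congr_fun fun n => ?_)
  · exact_mod_cast h3
  · simp only [hu.rcoef_grad hE, hv.rcoef_grad hE, map_mul, Complex.conj_ofReal]
    ring

lemma MemSobolev.integrable_mul {E : Mat} (hE : E.det ≠ 0) {u v : Plane → Plane}
    {G H : Plane → Mat} (hu : MemSobolev E u G) (hv : MemSobolev E v H) (i j k l : Fin 2) :
    Integrable (fun x => G x i j * H x k l) (cellMeasure E) :=
  (hu.memLp_grad_cell hE i j).integrable_mul (hv.memLp_grad_cell hE k l)

lemma MemSobolev.integrable_elastic {E : Mat} (hE : E.det ≠ 0) {u v : Plane → Plane}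
    {G H : Plane → Mat} (hu : MemSobolev E u G) (hv : MemSobolev E v H) (lam mu : ℝ) :
    Integrable (fun x => elasticPairing lam mu (G x) (H x)) (cellMeasure E) := by
  have h := fun i j k l => hu.integrable_mul hE hv i j k l
  simp only [elasticPairing_eq, Matrix.trace_fin_two, Fin.sum_univ_two, add_mul, mul_add]
  have := h 0 0 0 0
  have := h 0 0 1 1
  have := h 1 1 0 0
  have := h 1 1 1 1
  have := h 0 1 0 1
  have := h 1 0 1 0
  have := h 0 1 1 0
  have := h 1 0 0 1
  fun_prop

/-- Korn's identity on the torus. -/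
lemma MemSobolev.integral_elastic {E : Mat} (hE : E.det ≠ 0) {u v : Plane → Plane}
    {G H : Plane → Mat} (hu : MemSobolev E u G) (hv : MemSobolev E v H) (lam mu : ℝ) :
    ∫ x, elasticPairing lam mu (G x) (H x) ∂cellMeasure E =
      ∫ x, ((lam + mu) * ((G x).trace * (H x).trace) + mu * ∑ i, ∑ j, G x i j * H x i j)
        ∂cellMeasure E := by
  have h := fun i j k l => hu.integrable_mul hE hv i j k l
  have h1 : ∫ x, (mu * ((G x 0 1 * H x 1 0 - G x 0 0 * H x 1 1) +
      (G x 1 0 * H x 0 1 - G x 1 1 * H x 0 0))) ∂cellMeasure E = 0 := by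
    have k1 : ∫ x, (G x 0 1 * H x 1 0 - G x 0 0 * H x 1 1) ∂cellMeasure E = 0 := by
      rw [integral_sub (h 0 1 1 0) (h 0 0 1 1), hu.integral_swap hE hv 0 1 1 0, sub_self]
    have k2 : ∫ x, (G x 1 0 * H x 0 1 - G x 1 1 * H x 0 0) ∂cellMeasure E = 0 := by
      rw [integral_sub (h 1 0 0 1) (h 1 1 0 0), hu.integral_swap hE hv 1 0 0 1, sub_self]
    have k3 := integral_add ((h 0 1 1 0).sub (h 0 0 1 1)) ((h 1 0 0 1).sub (h 1 1 0 0))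
    simp only [Pi.sub_apply] at k3
    rw [integral_const_mul, k3, k1, k2]
    simp
  simp only [elasticPairing_eq]
  rw [integral_add, h1, add_zero]
  · simp only [Matrix.trace_fin_two, Fin.sum_univ_two, add_mul, mul_add]
    have := h 0 0 0 0
    have := h 0 0 1 1
    have := h 1 1 0 0
    have := h 1 1 1 1
    have := h 0 1 0 1
    have := h 1 0 1 0
    fun_prop
  · exact (((h 0 1 1 0).sub (h 0 0 1 1)).add ((h 1 0 0 1).sub (h 1 1 0 0))).const_mul mu

lemma MemSobolev.korn {E : Mat} (hE : E.det ≠ 0) {u : Plane → Plane} {G : Plane → Mat}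
    (hu : MemSobolev E u G) {lam mu : ℝ} (hl : 0 ≤ lam) (hm : 0 ≤ mu) :
    mu * ∫ x, ∑ i, ∑ j, G x i j ^ 2 ∂cellMeasure E ≤
      ∫ x, elasticPairing lam mu (G x) (G x) ∂cellMeasure E := by
  have h := fun i j k l => hu.integrable_mul hE hu i j k l
  rw [hu.integral_elastic hE hu, ← integral_const_mul]
  have := h 0 0 0 0
  have := h 0 0 1 1
  have := h 1 1 0 0
  have := h 1 1 1 1
  have := h 0 1 0 1
  have := h 1 0 1 0
  refine integral_mono ?_ ?_ fun x => ?_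
  · simp only [Fin.sum_univ_two, mul_add, pow_two]
    fun_prop
  · simp only [Matrix.trace_fin_two, Fin.sum_univ_two, add_mul, mul_add]
    fun_prop
  · simp only [← pow_two]
    -- The divergence term is simply dropped, which is why no estimate depends on `lam`.
    have : 0 ≤ (lam + mu) * (G x).trace ^ 2 := by positivity
    linarith

lemma rcoef_add_smul {E : Mat} (hE : E.det ≠ 0) {f g : Plane → ℝ}
    (hf : MemLp f 2 (cellMeasure E)) (hg : MemLp g 2 (cellMeasure E)) (t : ℝ) (n : Fin 2 → ℤ) :
    rcoef E (fun x => f x + t * g x) n = rcoef E f n + t * rcoef E g n := by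
  have := isProbabilityMeasure_cellMeasure hE
  have h1 : Integrable (fun x => conj (expo E n x) * (f x : ℂ)) (cellMeasure E) :=
    integrable_conj_expo_mul ((hf.integrable (by norm_num)).ofReal (𝕜 := ℂ))
  have h2 : Integrable (fun x => (t : ℂ) * (conj (expo E n x) * (g x : ℂ))) (cellMeasure E) :=
    (integrable_conj_expo_mul ((hg.integrable (by norm_num)).ofReal (𝕜 := ℂ))).const_mul _
  simp only [rcoef, coef]
  rw [← integral_const_mul, ← integral_add h1 h2]
  congr 1
  funext x
  push_cast
  ring

lemma MemSobolev.add_smul {E : Mat} (hE : E.det ≠ 0) {u v : Plane → Plane}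
    {G H : Plane → Mat} (hu : MemSobolev E u G) (hv : MemSobolev E v H) (t : ℝ) :
    MemSobolev E (fun x => u x + t • v x) (fun x => G x + t • H x) := by
  have hu2 := hu.memLp_cell hE
  have hv2 := hv.memLp_cell hE
  refine memSobolev_of_rcoef hE (fun n x => ?_) (fun n x => ?_) (hu2.add (hv2.const_smul t))
    (fun i j => ((hu.memLp_grad_cell hE i j).add ((hv.memLp_grad_cell hE i j).const_mul t)))
    (fun i => ?_) (fun i j n => ?_)
  · rw [hu.periodic n x, hv.periodic n x]
  · rw [hu.periodic_grad n x, hv.periodic_grad n x]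
  · have := rcoef_add_smul hE (memLp_proj hu2 i) (memLp_proj hv2 i) t 0
    simp only [PiLp.add_apply, PiLp.smul_apply, smul_eq_mul]
    rw [this, hu.rcoef_zero hE, hv.rcoef_zero hE]
    simp
  · have h1 := rcoef_add_smul hE (memLp_proj hu2 i) (memLp_proj hv2 i) t n
    have h2 := rcoef_add_smul hE (hu.memLp_grad_cell hE i j) (hv.memLp_grad_cell hE i j) t n
    simp only [PiLp.add_apply, PiLp.smul_apply, smul_eq_mul, Matrix.add_apply, Matrix.smul_apply]
    rw [h1, h2, hu.rcoef_grad hE, hv.rcoef_grad hE]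
    ring

/-! ### Bounds and Lipschitz estimate for the misfit force. -/

lemma act_sub (M : Mat) (x y : Plane) : act M x - act M y = act M (x - y) :=
  ((actL M).map_sub x y).symm

lemma norm_act_rot (t : ℝ) (x : Plane) : ‖act (rot t) x‖ = ‖x‖ := by
  rw [← sq_eq_sq₀ (norm_nonneg _) (norm_nonneg _), norm_sq_plane, norm_sq_plane]
  simp only [act_apply, rot, Matrix.of_apply, Matrix.cons_val', Matrix.cons_val_zero,
    Matrix.cons_val_one, Matrix.cons_val_fin_one]
  linear_combination (x 0 ^ 2 + x 1 ^ 2) * Real.cos_sq_add_sin_sq t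

lemma rot_transpose (t : ℝ) : (rot t)ᵀ = rot (-t) := by
  ext i j
  fin_cases i <;> fin_cases j <;> simp [rot]

lemma norm_act_rot_transpose (t : ℝ) (x : Plane) : ‖act (rot t)ᵀ x‖ = ‖x‖ := by
  rw [rot_transpose, norm_act_rot]

lemma gradient_eq (Φ : Plane → ℝ) (x : Plane) :
    gradient Φ x = (InnerProductSpace.toDual ℝ Plane).symm (fderiv ℝ Φ x) := rfl

lemma continuous_gradient {Φ : Plane → ℝ} (h : ContDiff ℝ 1 Φ) : Continuous (gradient Φ) :=
  (InnerProductSpace.toDual ℝ Plane).symm.continuous.comp (h.continuous_fderiv (by norm_num))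

lemma IsPeriodic.gradient {E : Mat} {Φ : Plane → ℝ} (h : IsPeriodic E Φ) :
    IsPeriodic E (gradient Φ) :=
  h.fderiv.comp _

lemma norm_gradient_le {E : Mat} (hE : E.det ≠ 0) {Φ : Plane → ℝ} (h : ContDiff ℝ 1 Φ)
    (hp : IsPeriodic E Φ) (x : Plane) : ‖gradient Φ x‖ ≤ supGrad Φ := by
  obtain ⟨C, hC⟩ := hp.gradient.exists_bound hE (continuous_gradient h)
  exact le_ciSup (f := fun x => ‖gradient Φ x‖) ⟨C, by rintro _ ⟨y, rfl⟩; exact hC y⟩ x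

lemma norm_iteratedFDeriv_le_supDeriv {E : Mat} (hE : E.det ≠ 0) {Φ : Plane → ℝ} {m : ℕ}
    (h : ContDiff ℝ m Φ) (hp : IsPeriodic E Φ) (x : Plane) :
    ‖iteratedFDeriv ℝ m Φ x‖ ≤ supDeriv m Φ := by
  obtain ⟨C, hC⟩ := (hp.iteratedFDeriv m).exists_bound hE
    (h.continuous_iteratedFDeriv le_rfl)
  exact le_ciSup (f := fun x => ‖iteratedFDeriv ℝ m Φ x‖)
    ⟨C, by rintro _ ⟨y, rfl⟩; exact hC y⟩ x

lemma supGrad_nonneg (Φ : Plane → ℝ) : 0 ≤ supGrad Φ := Real.iSup_nonneg fun _ => norm_nonneg _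

lemma supDeriv_nonneg (m : ℕ) (Φ : Plane → ℝ) : 0 ≤ supDeriv m Φ :=
  Real.iSup_nonneg fun _ => norm_nonneg _

lemma norm_gradient_sub_le {E : Mat} (hE : E.det ≠ 0) {Φ : Plane → ℝ} (h : ContDiff ℝ 2 Φ)
    (hp : IsPeriodic E Φ) (x y : Plane) :
    ‖gradient Φ x - gradient Φ y‖ ≤ supDeriv 2 Φ * ‖x - y‖ := by
  rw [gradient_eq, gradient_eq, ← map_sub, LinearIsometryEquiv.norm_map]
  have hd : ContDiff ℝ 1 (fderiv ℝ Φ) := h.fderiv_right (by norm_num)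
  refine Convex.norm_image_sub_le_of_norm_fderiv_le (𝕜 := ℝ) (s := Set.univ)
    (fun z _ => hd.differentiable (by norm_num) z) (fun z _ => ?_) convex_univ
    (Set.mem_univ _) (Set.mem_univ _)
  rw [← norm_iteratedFDeriv_one, norm_iteratedFDeriv_fderiv]
  exact norm_iteratedFDeriv_le_supDeriv hE h hp z

lemma continuous_act (M : Mat) : Continuous (act M) := (actL M).continuous

lemma continuous_misfitForce {Φ : Plane → ℝ} (h : ContDiff ℝ 1 Φ) (θ : ℝ) :
    Continuous fun p : Plane × Plane => misfitForce Φ θ p.1 p.2 := by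
  have h1 := continuous_gradient h
  have h2 := continuous_act
  unfold misfitForce
  have h3 : ∀ t, Continuous fun p : Plane × Plane => act (rot t) p.2 := fun t =>
    (h2 _).comp continuous_snd
  have h4 : ∀ t, Continuous fun p : Plane × Plane =>
      act (rot t)ᵀ (gradient Φ (p.1 - act (rot t) p.2)) := fun t =>
    (h2 _).comp (h1.comp (continuous_fst.sub (h3 t)))
  exact ((h4 _).const_smul (1 / 2 : ℝ)).add ((h4 _).const_smul (1 / 2 : ℝ))

lemma norm_misfitForce_le {E : Mat} (hE : E.det ≠ 0) {Φ : Plane → ℝ} (h : ContDiff ℝ 1 Φ)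
    (hp : IsPeriodic E Φ) (θ : ℝ) (x v : Plane) : ‖misfitForce Φ θ x v‖ ≤ supGrad Φ := by
  have h1 := norm_gradient_le hE h hp
  refine (norm_add_le _ _).trans ?_
  rw [norm_smul, norm_smul, norm_act_rot_transpose, norm_act_rot_transpose]
  have h2 := h1 (x - act (rot ((Real.pi - θ) / 2)) v)
  have h3 := h1 (x - act (rot ((Real.pi + θ) / 2)) v)
  norm_num
  linarith

lemma norm_misfitForce_sub_le {E : Mat} (hE : E.det ≠ 0) {Φ : Plane → ℝ} (h : ContDiff ℝ 2 Φ)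
    (hp : IsPeriodic E Φ) (θ : ℝ) (x v w : Plane) :
    ‖misfitForce Φ θ x v - misfitForce Φ θ x w‖ ≤ supDeriv 2 Φ * ‖v - w‖ := by
  have h1 : ∀ t, ‖act (rot t)ᵀ (gradient Φ (x - act (rot t) v)) -
      act (rot t)ᵀ (gradient Φ (x - act (rot t) w))‖ ≤ supDeriv 2 Φ * ‖v - w‖ := by
    intro t
    rw [act_sub, norm_act_rot_transpose]
    refine (norm_gradient_sub_le hE h hp _ _).trans_eq ?_
    rw [sub_sub_sub_cancel_left, act_sub, norm_act_rot, norm_sub_rev]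
  unfold misfitForce
  rw [add_sub_add_comm, ← smul_sub, ← smul_sub]
  refine (norm_add_le _ _).trans ?_
  rw [norm_smul, norm_smul]
  have h2 := h1 ((Real.pi - θ) / 2)
  have h3 := h1 ((Real.pi + θ) / 2)
  norm_num
  linarith

lemma aestronglyMeasurable_misfitForce {E : Mat} {Φ : Plane → ℝ} (h : ContDiff ℝ 1 Φ) (θ : ℝ)
    {u : Plane → Plane} (hu : AEStronglyMeasurable u (cellMeasure E)) :
    AEStronglyMeasurable (fun x => misfitForce Φ θ x ((2 : ℝ) • u x)) (cellMeasure E) := by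
  have h1 : AEStronglyMeasurable (fun x : Plane => x) (cellMeasure E) :=
    continuous_id.aestronglyMeasurable
  have h2 := hu.const_smul (2 : ℝ)
  have h3 : AEStronglyMeasurable (fun x => (x, (2 : ℝ) • u x)) (cellMeasure E) := h1.prodMk h2
  have h4 := (continuous_misfitForce h θ).comp_aestronglyMeasurable h3
  exact h4

lemma memLp_misfitForce {E : Mat} (hE : E.det ≠ 0) {Φ : Plane → ℝ} (h : ContDiff ℝ 1 Φ)
    (hp : IsPeriodic E Φ) (θ : ℝ) {u : Plane → Plane}
    (hu : AEStronglyMeasurable u (cellMeasure E)) (p : ENNReal) :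
    MemLp (fun x => misfitForce Φ θ x ((2 : ℝ) • u x)) p (cellMeasure E) := by
  have := isProbabilityMeasure_cellMeasure hE
  exact MemLp.of_bound (aestronglyMeasurable_misfitForce h θ hu) _
    (Filter.Eventually.of_forall fun x => norm_misfitForce_le hE h hp θ x _)

lemma integrable_inner_misfitForce {E : Mat} (hE : E.det ≠ 0) {Φ : Plane → ℝ}
    (h : ContDiff ℝ 1 Φ) (hp : IsPeriodic E Φ) (θ : ℝ) {u v : Plane → Plane}
    (hu : AEStronglyMeasurable u (cellMeasure E)) (hv : MemLp v 2 (cellMeasure E)) :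
    Integrable (fun x => (inner ℝ (misfitForce Φ θ x ((2 : ℝ) • u x)) (v x) : ℝ))
      (cellMeasure E) := by
  have h1 := memLp_misfitForce hE h hp θ hu 2
  have h2 := fun i => (memLp_proj h1 i).integrable_mul (memLp_proj hv i)
  have h3 := (h2 0).add (h2 1)
  refine h3.congr (Filter.Eventually.of_forall fun x => ?_)
  simp [inner_plane]

lemma integral_norm_le_sqrt {E : Mat} (hE : E.det ≠ 0) {u : Plane → Plane}
    (hu : MemLp u 2 (cellMeasure E)) :
    ∫ x, ‖u x‖ ∂cellMeasure E ≤ Real.sqrt (∫ x, ‖u x‖ ^ 2 ∂cellMeasure E) := by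
  have := isProbabilityMeasure_cellMeasure hE
  refine Real.le_sqrt_of_sq_le ?_
  set t := ∫ x, ‖u x‖ ∂cellMeasure E
  have h1 : Integrable (fun x => ‖u x‖) (cellMeasure E) := (hu.integrable (by norm_num)).norm
  have h2 : Integrable (fun x => ‖u x‖ ^ 2) (cellMeasure E) := hu.integrable_norm_pow (by norm_num)
  -- Nonnegativity of the variance of `‖u‖` under the probability measure on the cell.
  have h3 : 0 ≤ ∫ x, (‖u x‖ - t) ^ 2 ∂cellMeasure E := integral_nonneg fun x => sq_nonneg _
  have h4 : ∀ x, (‖u x‖ - t) ^ 2 = (‖u x‖ ^ 2 + (-2 * t) * ‖u x‖) + t ^ 2 := fun x => by ring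
  simp only [h4] at h3
  have h5 : Integrable (fun x => -2 * t * ‖u x‖) (cellMeasure E) := h1.const_mul _
  have h6 : Integrable (fun x => ‖u x‖ ^ 2 + -2 * t * ‖u x‖) (cellMeasure E) := h2.add h5
  rw [integral_add h6 (integrable_const _), integral_add h2 h5, integral_const_mul,
    integral_const] at h3
  simp only [probReal_univ, one_smul] at h3
  change 0 ≤ _ + -2 * t * t + t ^ 2 at h3
  linarith

lemma average_inner_misfitForce_le {E : Mat} (hE : E.det ≠ 0) {Φ : Plane → ℝ}
    (h : ContDiff ℝ 1 Φ) (hp : IsPeriodic E Φ) (θ : ℝ) {u v : Plane → Plane}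
    (hu : AEStronglyMeasurable u (cellMeasure E)) (hv : MemLp v 2 (cellMeasure E)) :
    ∫ x, (inner ℝ (misfitForce Φ θ x ((2 : ℝ) • u x)) (v x) : ℝ) ∂cellMeasure E ≤
      supGrad Φ * Real.sqrt (∫ x, ‖v x‖ ^ 2 ∂cellMeasure E) := by
  have := isProbabilityMeasure_cellMeasure hE
  refine le_trans ?_ (mul_le_mul_of_nonneg_left (integral_norm_le_sqrt hE hv) (supGrad_nonneg Φ))
  rw [← integral_const_mul]
  refine integral_mono (integrable_inner_misfitForce hE h hp θ hu hv)
    ((hv.integrable (by norm_num)).norm.const_mul _) fun x => ?_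
  exact (real_inner_le_norm _ _).trans
    (mul_le_mul_of_nonneg_right (norm_misfitForce_le hE h hp θ x _) (norm_nonneg _))

/-! ### The a priori bound and uniqueness. -/

lemma IsSolution.grad_le {E : Mat} (hE : E.det ≠ 0) {lam mu : ℝ} (hl : 0 ≤ lam) (hm : 0 < mu)
    {Φ : Plane → ℝ} (hΦ : ContDiff ℝ 1 Φ) (hp : IsPeriodic E Φ) {θ : ℝ} {u : Plane → Plane}
    {G : Plane → Mat} (h : IsSolution E lam mu Φ θ u G) :
    mu * ∫ x, ∑ i, ∑ j, G x i j ^ 2 ∂cellMeasure E ≤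
      supGrad Φ / (4 * Real.sin (θ / 2) ^ 2) *
        Real.sqrt (∫ x, ‖u x‖ ^ 2 ∂cellMeasure E) := by
  refine (h.1.korn hE hl hm.le).trans ?_
  -- The solution is its own test function.
  have h1 := h.2 u G h.1
  rw [average_cell, average_cell] at h1
  rw [h1, one_div, ← div_eq_inv_mul, div_mul_eq_mul_div]
  gcongr
  exact average_inner_misfitForce_le hE hΦ hp θ (h.1.memLp_cell hE).1 (h.1.memLp_cell hE)

lemma IsSolution.sobolevNorm_le {E : Mat} (hE : E.det ≠ 0) {lam mu : ℝ} (hl : 0 ≤ lam)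
    (hm : 0 < mu) {Φ : Plane → ℝ} (hΦ : ContDiff ℝ 1 Φ) (hp : IsPeriodic E Φ) {θ : ℝ}
    {u : Plane → Plane} {G : Plane → Mat} (h : IsSolution E lam mu Φ θ u G) :
    sobolevNorm E u G ≤ 1 / (mu * (gap E / (1 + gap E))) *
      (supGrad Φ / (4 * Real.sin (θ / 2) ^ 2)) := by
  have h1 := h.grad_le hE hl hm hΦ hp
  have h2 := h.1.poincare hE
  have hg := gap_pos hE
  rw [sobolevNorm, average_cell, average_cell]
  set X := ∫ x, ‖u x‖ ^ 2 ∂cellMeasure E with hX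
  set Y := ∫ x, ∑ i, ∑ j, G x i j ^ 2 ∂cellMeasure E with hY
  have hX0 : 0 ≤ X := integral_nonneg fun x => by positivity
  have hY0 : 0 ≤ Y := integral_nonneg fun x => by positivity
  set S := supGrad Φ / (4 * Real.sin (θ / 2) ^ 2)
  have hS : 0 ≤ S := div_nonneg (supGrad_nonneg Φ) (by positivity)
  have h3 : Real.sqrt X ≤ Real.sqrt (X + Y) := Real.sqrt_le_sqrt (by linarith)
  have h4 : mu * (gap E / (1 + gap E)) * (X + Y) ≤ S * Real.sqrt (X + Y) := by
    refine le_trans ?_ (h1.trans (mul_le_mul_of_nonneg_left h3 hS))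
    rw [mul_assoc]
    gcongr
    -- Poincaré in the form `Λ / (1 + Λ) * (X + Y) ≤ Y`, with `Λ` the gap.
    rw [div_mul_eq_mul_div, div_le_iff₀ (by positivity)]
    nlinarith
  rw [one_div, ← div_eq_inv_mul, le_div_iff₀ (by positivity)]
  rcases (Real.sqrt_nonneg (X + Y)).eq_or_lt with h0 | h0
  · rw [← h0]; simpa using hS
  · refine le_of_mul_le_mul_right ?_ h0
    calc _ = mu * (gap E / (1 + gap E)) * (Real.sqrt (X + Y) * Real.sqrt (X + Y)) := by ring
      _ = mu * (gap E / (1 + gap E)) * (X + Y) := by rw [Real.mul_self_sqrt (by positivity)]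
      _ ≤ _ := h4

lemma elasticPairing_add_smul_left (lam mu : ℝ) (A B C : Mat) (t : ℝ) :
    elasticPairing lam mu (A + t • B) C =
      elasticPairing lam mu A C + t * elasticPairing lam mu B C := by
  simp [elasticPairing_eq, Matrix.trace_fin_two, Fin.sum_univ_two]
  ring

lemma elasticPairing_comm (lam mu : ℝ) (A B : Mat) :
    elasticPairing lam mu A B = elasticPairing lam mu B A := by
  simp only [elasticPairing, mul_comm, mul_left_comm, mul_assoc]

theorem IsSolution.unique {E : Mat} (hE : E.det ≠ 0) {lam mu : ℝ} (hl : 0 ≤ lam)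
    (hm : 0 < mu) {Φ : Plane → ℝ} (hΦ : ContDiff ℝ 2 Φ) (hp : IsPeriodic E Φ) {θ : ℝ}
    (hθ : supDeriv 2 Φ / (4 * Real.sin (θ / 2) ^ 2) < mu * gap E / 2)
    {u u' : Plane → Plane} {G G' : Plane → Mat} (h : IsSolution E lam mu Φ θ u G)
    (h' : IsSolution E lam mu Φ θ u' G') : u =ᵐ[volume] u' := by
  have hΦ1 : ContDiff ℝ 1 Φ := hΦ.of_le (by norm_num)
  refine h.1.periodic.ae_eq_of_cellMeasure hE h'.1.periodic ?_
  have hw := h.1.add_smul hE h'.1 (-1)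
  set w : Plane → Plane := fun x => u x + (-1 : ℝ) • u' x with hwd
  set H : Plane → Mat := fun x => G x + (-1 : ℝ) • G' x
  have e1 := h.2 w H hw
  have e2 := h'.2 w H hw
  rw [average_cell, average_cell] at e1 e2
  have e3 : ∫ x, elasticPairing lam mu (H x) (H x) ∂cellMeasure E =
      ∫ x, elasticPairing lam mu (G x) (H x) ∂cellMeasure E +
      (-1) * ∫ x, elasticPairing lam mu (G' x) (H x) ∂cellMeasure E := by
    rw [← integral_const_mul, ← integral_add (h.1.integrable_elastic hE hw lam mu)
      ((h'.1.integrable_elastic hE hw lam mu).const_mul _)]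
    exact integral_congr_ae (Filter.Eventually.of_forall fun x =>
      elasticPairing_add_smul_left lam mu (G x) (G' x) (H x) (-1))
  have hu2 := h.1.memLp_cell hE
  have hu2' := h'.1.memLp_cell hE
  have hw2 := hw.memLp_cell hE
  have i1 := integrable_inner_misfitForce hE hΦ1 hp θ hu2.1 hw2
  have i2 := integrable_inner_misfitForce hE hΦ1 hp θ hu2'.1 hw2
  have e4 : ∫ x, (inner ℝ (misfitForce Φ θ x ((2 : ℝ) • u x)) (w x) : ℝ) ∂cellMeasure E -
      ∫ x, (inner ℝ (misfitForce Φ θ x ((2 : ℝ) • u' x)) (w x) : ℝ) ∂cellMeasure E ≤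
      2 * supDeriv 2 Φ * ∫ x, ‖w x‖ ^ 2 ∂cellMeasure E := by
    rw [← integral_sub i1 i2, ← integral_const_mul]
    refine integral_mono (i1.sub i2) ((hw2.integrable_norm_pow (by norm_num)).const_mul _)
      fun x => ?_
    simp only [← inner_sub_left]
    refine (real_inner_le_norm _ _).trans ?_
    have h1 := norm_misfitForce_sub_le hE hΦ hp θ x ((2 : ℝ) • u x) ((2 : ℝ) • u' x)
    rw [← smul_sub, norm_smul, Real.norm_ofNat] at h1
    have h2 : u x - u' x = w x := by simp [hwd, sub_eq_add_neg]
    rw [h2] at h1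
    calc _ ≤ supDeriv 2 Φ * (2 * ‖w x‖) * ‖w x‖ := by gcongr
      _ = _ := by ring
  have e5 := hw.poincare hE
  have e6 := hw.korn hE hl hm.le
  set X := ∫ x, ‖w x‖ ^ 2 ∂cellMeasure E with hX
  have hX0 : 0 ≤ X := integral_nonneg fun x => by positivity
  set c := 1 / (4 * Real.sin (θ / 2) ^ 2) with hc
  have hc0 : 0 ≤ c := by positivity
  have hθ' : c * supDeriv 2 Φ < mu * gap E / 2 := by
    rw [hc, one_div, ← div_eq_inv_mul]; exact hθ
  -- The force is evaluated at `2 u`, whence the factor 2 on the right and the threshold `mu * gap E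
  -- / 2`.
  have e7 : mu * gap E * X ≤ 2 * (c * supDeriv 2 Φ) * X := by
    calc mu * gap E * X = mu * (gap E * X) := by ring
      _ ≤ _ := mul_le_mul_of_nonneg_left e5 hm.le
      _ ≤ _ := e6
      _ = c * (∫ x, (inner ℝ (misfitForce Φ θ x ((2 : ℝ) • u x)) (w x) : ℝ) ∂cellMeasure E -
      ∫ x, (inner ℝ (misfitForce Φ θ x ((2 : ℝ) • u' x)) (w x) : ℝ) ∂cellMeasure E) := by
        rw [e3, e1, e2]; ring
      _ ≤ c * (2 * supDeriv 2 Φ * X) := mul_le_mul_of_nonneg_left e4 hc0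
      _ = _ := by ring
  have hX1 : X = 0 := by
    by_contra h0
    have : 0 < X := lt_of_le_of_ne hX0 (Ne.symm h0)
    nlinarith
  have h4 := (integral_eq_zero_iff_of_nonneg (fun x => by positivity)
    (hw2.integrable_norm_pow (by norm_num))).1 hX1
  filter_upwards [h4] with x hx
  have h5 : w x = 0 := by simpa using hx
  rw [hwd] at h5
  simpa [← sub_eq_add_neg, sub_eq_zero] using h5

/-! ### Higher derivatives and trigonometric polynomials. -/

section IteratedDerivatives

variable {V F : Type*} [NormedAddCommGroup V] [NormedSpace ℝ V] [NormedAddCommGroup F]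
  [NormedSpace ℝ F]

lemma iteratedFDeriv_succ_eval {g : V → F} (hg : ContDiff ℝ ∞ g) (k : ℕ) (x : V)
    (m : Fin (k + 1) → V) :
    iteratedFDeriv ℝ (k + 1) g x m =
      fderiv ℝ (fun y => iteratedFDeriv ℝ k g y (Fin.tail m)) x (m 0) :=
  ((hg.differentiable_iteratedFDeriv
    (by exact_mod_cast WithTop.coe_lt_top _)) x).iteratedFDeriv_succ_apply_left'

lemma contDiff_iteratedFDeriv_eval {g : V → F} (hg : ContDiff ℝ ∞ g) (k : ℕ) (m : Fin k → V) :
    ContDiff ℝ ∞ fun y => iteratedFDeriv ℝ k g y m :=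
  (ContinuousMultilinearMap.apply ℝ (fun _ : Fin k => V) F m).contDiff.comp
    (hg.iteratedFDeriv_right (m := ∞) (by exact_mod_cast le_top))

lemma iteratedFDeriv_clm_comp {F' : Type*} [NormedAddCommGroup F'] [NormedSpace ℝ F']
    {g : V → F} (hg : ContDiff ℝ ∞ g) (L : F →L[ℝ] F') (k : ℕ) (x : V) (m : Fin k → V) :
    iteratedFDeriv ℝ k (fun y => L (g y)) x m = L (iteratedFDeriv ℝ k g x m) := by
  have h := L.iteratedFDeriv_comp_left (hg.contDiffAt (x := x)) (i := k)
    (by exact_mod_cast le_top)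
  rw [show (fun y => L (g y)) = L ∘ g from rfl, h]
  rfl

end IteratedDerivatives

lemma coef_iteratedFDeriv {E : Mat} (hE : E.det ≠ 0) {g : Plane → ℂ} (hg : ContDiff ℝ ∞ g)
    (hp : IsPeriodic E g) (k : ℕ) (m : Fin k → Plane) (n : Fin 2 → ℤ) :
    coef E (fun x => iteratedFDeriv ℝ k g x m) n =
      (∏ j, I * (inner ℝ (freq E n) (m j) : ℝ)) * coef E g n := by
  induction k with
  | zero => simp
  | succ k ih =>
    simp only [iteratedFDeriv_succ_eval hg]
    rw [coef_fderiv hE ((contDiff_iteratedFDeriv_eval hg k _).of_le (by simp))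
      ((hp.iteratedFDeriv k).comp fun T => T (Fin.tail m)), ih, Fin.prod_univ_succ]
    simp only [Fin.tail]
    ring

/-- The `k`-tuple of standard basis vectors with indices `s`. -/
def basisTuple {k : ℕ} (s : Fin k → Fin 2) : Fin k → Plane :=
  fun i => EuclideanSpace.single (s i) 1

lemma hasSum_iteratedFDeriv {E : Mat} (hE : E.det ≠ 0) {w : Plane → Plane}
    (hw : ContDiff ℝ ∞ w) (hp : IsPeriodic E w) (k : ℕ) :
    HasSum (fun n => ‖freq E n‖ ^ (2 * k) * ampSq E w n)
      (∫ x, ∑ s : Fin k → Fin 2, ‖iteratedFDeriv ℝ k w x (basisTuple s)‖ ^ 2 ∂cellMeasure E) := by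
  have hcont : ∀ s : Fin k → Fin 2, Continuous fun x => iteratedFDeriv ℝ k w x (basisTuple s) :=
    fun s => (contDiff_iteratedFDeriv_eval hw k _).continuous
  have hmem : ∀ s : Fin k → Fin 2,
      MemLp (fun x => iteratedFDeriv ℝ k w x (basisTuple s)) 2 (cellMeasure E) := fun s =>
    ((hp.iteratedFDeriv k).comp fun T => T (basisTuple s)).memLp hE (hcont s) 2
  rw [integral_finsetSum _ fun s _ => (hmem s).integrable_norm_pow (by norm_num)]
  refine (hasSum_sum fun s _ => hasSum_ampSq hE (hmem s)).congr_fun fun n => ?_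
  have h1 : ∀ (i : Fin 2) (s : Fin k → Fin 2),
      rcoef E (fun x => iteratedFDeriv ℝ k w x (basisTuple s) i) n =
        (∏ j, I * (freq E n (s j) : ℝ)) * rcoef E (fun x => w x i) n := by
    intro i s
    have h2 := coef_iteratedFDeriv hE (g := fun x => (w x i : ℂ))
      ((Complex.ofRealCLM.comp (EuclideanSpace.proj (𝕜 := ℝ) i : Plane →L[ℝ] ℝ)).contDiff.comp hw)
      (hp.comp fun v : Plane => (v i : ℂ)) k (basisTuple s) n
    have h3 : ∀ x, iteratedFDeriv ℝ k (fun x => (w x i : ℂ)) x (basisTuple s) =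
        (iteratedFDeriv ℝ k w x (basisTuple s) i : ℝ) := fun x =>
      iteratedFDeriv_clm_comp hw
        (Complex.ofRealCLM.comp (EuclideanSpace.proj (𝕜 := ℝ) i : Plane →L[ℝ] ℝ)) k x _
    simp only [h3] at h2
    rw [rcoef, h2, rcoef]
    congr 2
    funext j
    simp [basisTuple, EuclideanSpace.inner_single_right]
  simp only [ampSq, h1, norm_mul, mul_pow, norm_prod, Complex.norm_I, one_mul, Complex.norm_real,
    ← Finset.prod_pow, Real.norm_eq_abs, sq_abs, ← Finset.mul_sum]
  -- Summing the products of the `ξ_(s j)²` over all index tuples `s` gives `(ξ_0² + ξ_1²)^k`; this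
  -- is why the derivative norm counts ordered partial derivatives.
  rw [← Finset.sum_mul, ← Fintype.sum_pow (fun i => freq E n i ^ 2), pow_mul, norm_sq_plane]
  simp only [Fin.sum_univ_two]

lemma opNorm_le_sum_basisTuple {F : Type*} [NormedAddCommGroup F] [NormedSpace ℝ F] {k : ℕ}
    (T : ContinuousMultilinearMap ℝ (fun _ : Fin k => Plane) F) :
    ‖T‖ ≤ ∑ s : Fin k → Fin 2, ‖T (basisTuple s)‖ := by
  refine T.opNorm_le_bound (by positivity) fun m => ?_
  have h1 : m = fun j => ∑ i, m j i • (EuclideanSpace.single i (1 : ℝ) : Plane) := by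
    funext j; ext l; fin_cases l <;> simp [Fin.sum_univ_two]
  have h2 : T m = ∑ s : Fin k → Fin 2, (∏ j, m j (s j)) • T (basisTuple s) := by
    conv_lhs => rw [h1]
    rw [ContinuousMultilinearMap.map_sum]
    refine Finset.sum_congr rfl fun s _ => ?_
    exact T.map_smul_univ (fun j => m j (s j)) (basisTuple s)
  rw [h2, Finset.sum_mul]
  refine norm_sum_le_of_le _ fun s _ => ?_
  rw [norm_smul, mul_comm, norm_prod]
  gcongr with j
  exact PiLp.norm_apply_le (m j) (s j)

lemma opNorm_sq_le_sum_basisTuple {F : Type*} [NormedAddCommGroup F] [NormedSpace ℝ F] {k : ℕ}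
    (T : ContinuousMultilinearMap ℝ (fun _ : Fin k => Plane) F) :
    ‖T‖ ^ 2 ≤ 2 ^ k * ∑ s : Fin k → Fin 2, ‖T (basisTuple s)‖ ^ 2 := by
  refine (pow_le_pow_left₀ (norm_nonneg _) (opNorm_le_sum_basisTuple T) 2).trans ?_
  refine (sq_sum_le_card_mul_sum_sq).trans_eq ?_
  simp

lemma norm_basisTuple_le {F : Type*} [NormedAddCommGroup F] [NormedSpace ℝ F] {k : ℕ}
    (T : ContinuousMultilinearMap ℝ (fun _ : Fin k => Plane) F) (s : Fin k → Fin 2) :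
    ‖T (basisTuple s)‖ ≤ ‖T‖ := by
  refine (T.le_opNorm _).trans_eq ?_
  simp [basisTuple]

/-- A finite Fourier sum. -/
def fourierSum (E : Mat) (c : (Fin 2 → ℤ) → ℂ) (T : Finset (Fin 2 → ℤ)) (x : Plane) : ℂ :=
  ∑ n ∈ T, c n * expo E n x

lemma contDiff_fourierSum (E : Mat) (c : (Fin 2 → ℤ) → ℂ) (T : Finset (Fin 2 → ℤ)) :
    ContDiff ℝ ∞ (fourierSum E c T) :=
  ContDiff.sum fun n _ => contDiff_const.mul (contDiff_expo E n)

lemma isPeriodic_fourierSum {E : Mat} (hE : E.det ≠ 0) (c : (Fin 2 → ℤ) → ℂ)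
    (T : Finset (Fin 2 → ℤ)) : IsPeriodic E (fourierSum E c T) := fun m x =>
  Finset.sum_congr rfl fun n _ => by rw [isPeriodic_expo hE n m x]

lemma iteratedFDeriv_fourierSum (E : Mat) (c : (Fin 2 → ℤ) → ℂ) (T : Finset (Fin 2 → ℤ)) (k : ℕ)
    (x : Plane) (m : Fin k → Plane) :
    iteratedFDeriv ℝ k (fourierSum E c T) x m =
      fourierSum E (fun n => (∏ j, I * (inner ℝ (freq E n) (m j) : ℝ)) * c n) T x := by
  induction k generalizing x with
  | zero => simp
  | succ k ih =>
    rw [iteratedFDeriv_succ_eval (contDiff_fourierSum E c T)]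
    simp only [ih]
    have h1 := HasFDerivAt.fun_sum (u := T) (A := fun n x =>
      (∏ j, I * (inner ℝ (freq E n) (Fin.tail m j) : ℝ)) * c n * expo E n x) fun n _ =>
      (hasFDerivAt_expo E n x).const_mul ((∏ j, I * (inner ℝ (freq E n) (Fin.tail m j) : ℝ)) * c n)
    rw [show (fun y => fourierSum E (fun n => (∏ j, I * (inner ℝ (freq E n) (Fin.tail m j) : ℝ)) *
      c n) T y) = fun x => ∑ n ∈ T, (∏ j, I * (inner ℝ (freq E n) (Fin.tail m j) : ℝ)) * c n *
        expo E n x from rfl, h1.fderiv]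
    simp only [FunLike.coe_sum, Finset.sum_apply, fourierSum]
    refine Finset.sum_congr rfl fun n _ => ?_
    rw [Fin.prod_univ_succ]
    simp [Fin.tail]
    ring

lemma norm_iteratedFDeriv_fourierSum_le (E : Mat) (c : (Fin 2 → ℤ) → ℂ)
    (T : Finset (Fin 2 → ℤ)) (k : ℕ) (x : Plane) :
    ‖iteratedFDeriv ℝ k (fourierSum E c T) x‖ ≤ ∑ n ∈ T, ‖freq E n‖ ^ k * ‖c n‖ := by
  refine ContinuousMultilinearMap.opNorm_le_bound (by positivity) fun m => ?_
  rw [iteratedFDeriv_fourierSum, Finset.sum_mul]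
  refine norm_sum_le_of_le _ fun n _ => ?_
  rw [norm_mul, norm_mul, norm_expo, norm_prod, mul_one, mul_right_comm]
  gcongr
  calc ∏ j, ‖I * ((inner ℝ (freq E n) (m j) : ℝ) : ℂ)‖ ≤ ∏ j, ‖freq E n‖ * ‖m j‖ := by
        gcongr with j
        rw [norm_mul, Complex.norm_I, one_mul, Complex.norm_real]
        exact norm_inner_le_norm _ _
    _ = _ := by simp [Finset.prod_mul_distrib]

lemma integral_expo {E : Mat} (hE : E.det ≠ 0) {n : Fin 2 → ℤ} (hn : n ≠ 0) :
    ∫ x, expo E n x ∂cellMeasure E = 0 := by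
  have h := integral_fderiv_eq_zero hE ((contDiff_expo E n).of_le (by simp))
    (isPeriodic_expo hE n) (freq E n)
  simp only [fderiv_expo] at h
  rw [integral_const_mul] at h
  have h1 := (freq_eq_zero_iff hE).not.2 hn
  simpa [h1] using h

lemma coef_expo {E : Mat} (hE : E.det ≠ 0) (n m : Fin 2 → ℤ) :
    coef E (expo E n) m = if n = m then 1 else 0 := by
  have := isProbabilityMeasure_cellMeasure hE
  have h1 : ∀ x, conj (expo E m x) * expo E n x = expo E (n - m) x := by
    intro x
    rw [conj_expo, expo_eq, expo_eq, expo_eq, sub_eq_add_neg, UnitAddTorus.mFourier_add, mul_comm]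
  simp only [coef, h1]
  split_ifs with h
  · subst h; simp [expo_zero]
  · exact integral_expo hE (sub_ne_zero.2 h)

lemma coef_fourierSum {E : Mat} (hE : E.det ≠ 0) (c : (Fin 2 → ℤ) → ℂ) (T : Finset (Fin 2 → ℤ))
    (m : Fin 2 → ℤ) : coef E (fourierSum E c T) m = if m ∈ T then c m else 0 := by
  have := isProbabilityMeasure_cellMeasure hE
  have h1 : ∀ n, Integrable (fun x => conj (expo E m x) * expo E n x) (cellMeasure E) := fun n =>
    integrable_conj_expo_mul (((isPeriodic_expo hE n).memLp hE
      (contDiff_expo E n).continuous 1).integrable le_rfl)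
  have h2 : coef E (fourierSum E c T) m = ∑ n ∈ T, c n * coef E (expo E n) m := by
    simp only [coef, fourierSum, Finset.mul_sum, ← integral_const_mul, mul_left_comm (conj _)]
    exact integral_finsetSum _ fun n _ => (h1 n).const_mul _
  rw [h2]
  simp [coef_expo hE]

/-- The real part of a finite Fourier sum of vector fields. -/
def trigPoly (E : Mat) (c : Fin 2 → (Fin 2 → ℤ) → ℂ) (T : Finset (Fin 2 → ℤ)) (x : Plane) :
    Plane := WithLp.toLp 2 fun i => (fourierSum E (c i) T x).re

lemma trigPoly_apply (E : Mat) (c : Fin 2 → (Fin 2 → ℤ) → ℂ) (T : Finset (Fin 2 → ℤ))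
    (x : Plane) (i : Fin 2) : trigPoly E c T x i = (fourierSum E (c i) T x).re := rfl

lemma contDiff_trigPoly (E : Mat) (c : Fin 2 → (Fin 2 → ℤ) → ℂ) (T : Finset (Fin 2 → ℤ)) :
    ContDiff ℝ ∞ (trigPoly E c T) :=
  contDiff_euclidean.2 fun i => Complex.reCLM.contDiff.comp (contDiff_fourierSum E (c i) T)

lemma isPeriodic_trigPoly {E : Mat} (hE : E.det ≠ 0) (c : Fin 2 → (Fin 2 → ℤ) → ℂ)
    (T : Finset (Fin 2 → ℤ)) : IsPeriodic E (trigPoly E c T) := fun m x => by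
  simp only [trigPoly, isPeriodic_fourierSum hE _ T m x]

/-- Sup bounds of truncations follow from an absolute sum of coefficients, hence uniformly in the
set of frequencies. Sharp truncation does not preserve sup norms, so the bootstrap carries these
weighted `ℓ¹` sums instead. -/
lemma norm_iteratedFDeriv_trigPoly_le (E : Mat) (c : Fin 2 → (Fin 2 → ℤ) → ℂ)
    (T : Finset (Fin 2 → ℤ)) (k : ℕ) (x : Plane) :
    ‖iteratedFDeriv ℝ k (trigPoly E c T) x‖ ≤ ∑ n ∈ T, ‖freq E n‖ ^ k * ∑ i, ‖c i n‖ := by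
  have h1 : ∀ (m : Fin k → Plane) i, iteratedFDeriv ℝ k (trigPoly E c T) x m i =
      (iteratedFDeriv ℝ k (fourierSum E (c i) T) x m).re := by
    intro m i
    rw [← Complex.reCLM_apply, ← iteratedFDeriv_clm_comp (contDiff_fourierSum E (c i) T)
      Complex.reCLM]
    exact (iteratedFDeriv_clm_comp (contDiff_trigPoly E c T)
      (EuclideanSpace.proj (𝕜 := ℝ) i : Plane →L[ℝ] ℝ) k x m).symm
  refine ContinuousMultilinearMap.opNorm_le_bound (by positivity) fun m => ?_
  have h2 : ∀ v : Plane, ‖v‖ ≤ ∑ i, |v i| := by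
    intro v
    rw [← sq_le_sq₀ (norm_nonneg _) (by positivity), norm_sq_plane, Fin.sum_univ_two]
    nlinarith [abs_nonneg (v 0), abs_nonneg (v 1), sq_abs (v 0), sq_abs (v 1),
      mul_nonneg (abs_nonneg (v 0)) (abs_nonneg (v 1))]
  refine (h2 _).trans ?_
  simp only [h1, Finset.mul_sum]
  rw [Finset.sum_comm, Finset.sum_mul]
  gcongr with i
  refine (Complex.abs_re_le_norm _).trans ((ContinuousMultilinearMap.le_opNorm _ _).trans ?_)
  gcongr
  exact norm_iteratedFDeriv_fourierSum_le E (c i) T k x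

/-- Coefficients of real functions, on frequency sets that are invariant under `n ↦ -n`. -/
lemma ofReal_fourierSum {E : Mat} {c : (Fin 2 → ℤ) → ℂ} {T : Finset (Fin 2 → ℤ)}
    (hc : ∀ n, c (-n) = conj (c n)) (hT : ∀ n ∈ T, -n ∈ T) (x : Plane) :
    ((fourierSum E c T x).re : ℂ) = fourierSum E c T x := by
  refine Complex.conj_eq_iff_re.1 ?_
  simp only [fourierSum, map_sum, map_mul, conj_expo, ← hc]
  exact Finset.sum_nbij' (fun n => -n) (fun n => -n) hT hT (by simp) (by simp) (by simp)

lemma rcoef_trigPoly {E : Mat} (hE : E.det ≠ 0) {c : Fin 2 → (Fin 2 → ℤ) → ℂ}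
    {T : Finset (Fin 2 → ℤ)} (hc : ∀ i n, c i (-n) = conj (c i n)) (hT : ∀ n ∈ T, -n ∈ T)
    (i : Fin 2) (m : Fin 2 → ℤ) :
    rcoef E (fun x => trigPoly E c T x i) m = if m ∈ T then c i m else 0 := by
  simp only [rcoef, trigPoly_apply, ofReal_fourierSum (hc i) hT]
  exact coef_fourierSum hE (c i) T m

/-! ### Derivatives of the misfit force along a smooth displacement. -/

/-- The Riesz isomorphism as a continuous linear map. -/
def rieszL : (Plane →L[ℝ] ℝ) →L[ℝ] Plane :=
  LinearMap.mkContinuous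
    { toFun := (InnerProductSpace.toDual ℝ Plane).symm
      map_add' := map_add _
      map_smul' := fun r f => by simp } 1 fun f => by simp

lemma gradient_eq_rieszL (Φ : Plane → ℝ) : gradient Φ = rieszL ∘ fderiv ℝ Φ := rfl

lemma norm_rieszL_le : ‖rieszL‖ ≤ 1 := LinearMap.mkContinuous_norm_le _ zero_le_one _

lemma contDiff_gradient {Φ : Plane → ℝ} (h : ContDiff ℝ ∞ Φ) : ContDiff ℝ ∞ (gradient Φ) := by
  rw [gradient_eq_rieszL]
  exact rieszL.contDiff.comp (h.fderiv_right (by exact_mod_cast le_top))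

lemma norm_iteratedFDeriv_gradient_le {Φ : Plane → ℝ} (h : ContDiff ℝ ∞ Φ) (k : ℕ) (x : Plane) :
    ‖iteratedFDeriv ℝ k (gradient Φ) x‖ ≤ ‖iteratedFDeriv ℝ (k + 1) Φ x‖ := by
  have hd : ContDiff ℝ ∞ (fderiv ℝ Φ) := h.fderiv_right (by exact_mod_cast le_top)
  rw [gradient_eq_rieszL, ← norm_iteratedFDeriv_fderiv]
  refine (rieszL.norm_iteratedFDeriv_comp_left hd.contDiffAt (by exact_mod_cast le_top)).trans ?_
  exact mul_le_of_le_one_left (norm_nonneg _) norm_rieszL_le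

lemma norm_actL_rot_le (t : ℝ) : ‖actL (rot t)‖ ≤ 1 :=
  ContinuousLinearMap.opNorm_le_bound _ zero_le_one fun x => by
    rw [actL_apply, norm_act_rot, one_mul]

lemma norm_actL_rot_transpose_le (t : ℝ) : ‖actL (rot t)ᵀ‖ ≤ 1 := by
  rw [rot_transpose]; exact norm_actL_rot_le _

lemma norm_iteratedFDeriv_id_le {V : Type*} [NormedAddCommGroup V] [NormedSpace ℝ V] {k : ℕ}
    (hk : 1 ≤ k) (x : V) : ‖iteratedFDeriv ℝ k (fun y : V => y) x‖ ≤ 1 := by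
  obtain ⟨k, rfl⟩ := Nat.exists_eq_add_of_le' hk
  have hid : fderiv ℝ (fun y : V => y) = fun _ => ContinuousLinearMap.id ℝ V :=
    funext fun _ => fderiv_fun_id
  rw [← norm_iteratedFDeriv_fderiv, hid]
  rcases Nat.eq_zero_or_pos k with rfl | h
  · rw [norm_iteratedFDeriv_zero]
    exact ContinuousLinearMap.norm_id_le
  · rw [iteratedFDeriv_const_of_ne h.ne']
    simp

/-- The displaced point `x - R_t (2 p(x))`. -/
def displaced (t : ℝ) (p : Plane → Plane) (x : Plane) : Plane :=
  x - act (rot t) ((2 : ℝ) • p x)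

lemma contDiff_displaced (t : ℝ) {p : Plane → Plane} (hp : ContDiff ℝ ∞ p) :
    ContDiff ℝ ∞ (displaced t p) :=
  contDiff_id.sub ((actL (rot t)).contDiff.comp (hp.const_smul (2 : ℝ)))

lemma norm_iteratedFDeriv_displaced_le (t : ℝ) {p : Plane → Plane} (hp : ContDiff ℝ ∞ p) {k : ℕ}
    (hk : 1 ≤ k) (x : Plane) :
    ‖iteratedFDeriv ℝ k (displaced t p) x‖ ≤ 1 + 2 * ‖iteratedFDeriv ℝ k p x‖ := by
  have hk' : (k : WithTop ℕ∞) ≤ ∞ := by exact_mod_cast le_top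
  have h1 : displaced t p = (fun y : Plane => y) - ((2 : ℝ) • actL (rot t)) ∘ p := by
    funext y
    simp [displaced, ← actL_apply]
  have h2 : ContDiff ℝ ∞ (((2 : ℝ) • actL (rot t)) ∘ p) :=
    ((2 : ℝ) • actL (rot t)).contDiff.comp hp
  have hid : ContDiff ℝ ∞ fun y : Plane => y := contDiff_id
  rw [h1, iteratedFDeriv_sub_apply (hid.contDiffAt.of_le hk') (h2.contDiffAt.of_le hk')]
  refine (norm_sub_le _ _).trans (add_le_add (norm_iteratedFDeriv_id_le hk x) ?_)
  refine (((2 : ℝ) • actL (rot t)).norm_iteratedFDeriv_comp_left hp.contDiffAt hk').trans ?_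
  gcongr
  rw [norm_smul, Real.norm_ofNat]
  linarith [norm_actL_rot_le t]

lemma misfitForce_eq (Φ : Plane → ℝ) (θ : ℝ) (p : Plane → Plane) :
    (fun x => misfitForce Φ θ x ((2 : ℝ) • p x)) =
      ((1 / 2 : ℝ) • actL (rot ((Real.pi - θ) / 2))ᵀ) ∘ gradient Φ ∘
          displaced ((Real.pi - θ) / 2) p +
        ((1 / 2 : ℝ) • actL (rot ((Real.pi + θ) / 2))ᵀ) ∘ gradient Φ ∘
          displaced ((Real.pi + θ) / 2) p := rfl

lemma contDiff_misfitForce {Φ : Plane → ℝ} (h : ContDiff ℝ ∞ Φ) (θ : ℝ) {p : Plane → Plane}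
    (hp : ContDiff ℝ ∞ p) : ContDiff ℝ ∞ fun x => misfitForce Φ θ x ((2 : ℝ) • p x) := by
  rw [misfitForce_eq]
  exact (ContinuousLinearMap.contDiff _ |>.comp
    ((contDiff_gradient h).comp (contDiff_displaced _ hp))).add
    (ContinuousLinearMap.contDiff _ |>.comp
    ((contDiff_gradient h).comp (contDiff_displaced _ hp)))

lemma isPeriodic_misfitForce {E : Mat} {Φ : Plane → ℝ} (h : IsPeriodic E Φ) (θ : ℝ)
    {p : Plane → Plane} (hp : IsPeriodic E p) :
    IsPeriodic E fun x => misfitForce Φ θ x ((2 : ℝ) • p x) := by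
  intro n x
  simp only [misfitForce, hp n x]
  rw [add_sub_right_comm, h.gradient, add_sub_right_comm, h.gradient]

/-- The point of the bound is that the top derivative of `p` enters only linearly, since it will be
known in `L²` and not in sup norm. -/
lemma norm_iteratedFDeriv_misfitForce_le {Φ : Plane → ℝ} (h : ContDiff ℝ ∞ Φ) (θ : ℝ)
    {p : Plane → Plane} (hp : ContDiff ℝ ∞ p) {m : ℕ} {M B : ℝ}
    (hM : ∀ j ≤ m + 2, ∀ x, ‖iteratedFDeriv ℝ j Φ x‖ ≤ M) (hB : 1 ≤ B) (x : Plane)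
    (hpB : ∀ i, 1 ≤ i → i ≤ m → ‖iteratedFDeriv ℝ i p x‖ ≤ B ^ i) :
    ‖iteratedFDeriv ℝ (m + 1) (fun x => misfitForce Φ θ x ((2 : ℝ) • p x)) x‖ ≤
      (m + 1).factorial * M * (2 * (3 * B) ^ (m + 1) + 2 * ‖iteratedFDeriv ℝ (m + 1) p x‖) := by
  have hm' : ((m + 1 : ℕ) : WithTop ℕ∞) ≤ ∞ := by exact_mod_cast le_top
  have hM0 : 0 ≤ M := (norm_nonneg _).trans (hM 0 (by omega) x)
  set d := ‖iteratedFDeriv ℝ (m + 1) p x‖ with hd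
  have hd0 : 0 ≤ d := norm_nonneg _
  set W := 2 * (3 * B) ^ (m + 1) + 2 * d with hW
  have h3B : 1 ≤ 3 * B := by linarith
  have h3Bp : (1 : ℝ) ≤ (3 * B) ^ (m + 1) := one_le_pow₀ h3B
  have hW0 : 0 ≤ W := by positivity
  -- `norm_iteratedFDeriv_comp_le` wants derivatives of order `i` of the inner map below `Δ ^ i` for
  -- one number `Δ`. Taking the root of order `m + 1` of `W` makes the case `i = m + 1` exactly `W`,
  -- linear in `d`, while `3 * B ≤ Δ` serves the lower orders.
  set Δ := W ^ (((m + 1 : ℕ) : ℝ)⁻¹) with hΔ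
  have hΔ0 : 0 ≤ Δ := by positivity
  have hΔW : Δ ^ (m + 1) = W := Real.rpow_inv_natCast_pow hW0 (by omega)
  have hΔB : 3 * B ≤ Δ := by
    refine le_of_pow_le_pow_left₀ (n := m + 1) (by omega) hΔ0 ?_
    rw [hΔW]; linarith
  have key : ∀ t, ‖iteratedFDeriv ℝ (m + 1) (((1 / 2 : ℝ) • actL (rot t)ᵀ) ∘ gradient Φ ∘
      displaced t p) x‖ ≤ 1 / 2 * ((m + 1).factorial * M * W) := by
    intro t
    have hdis := contDiff_displaced t hp
    refine (((1 / 2 : ℝ) • actL (rot t)ᵀ).norm_iteratedFDeriv_comp_left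
      ((contDiff_gradient h).comp hdis).contDiffAt hm').trans ?_
    have h1 : ‖(1 / 2 : ℝ) • actL (rot t)ᵀ‖ ≤ 1 / 2 := by
      rw [norm_smul]
      have := norm_actL_rot_transpose_le t
      norm_num
      linarith
    have h2 : ‖iteratedFDeriv ℝ (m + 1) (gradient Φ ∘ displaced t p) x‖ ≤
        (m + 1).factorial * M * Δ ^ (m + 1) := by
      refine norm_iteratedFDeriv_comp_le (contDiff_gradient h) hdis hm' x (fun i hi => ?_)
        fun i hi1 hi => ?_
      · exact (norm_iteratedFDeriv_gradient_le h i _).trans (hM (i + 1) (by omega) _)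
      · refine (norm_iteratedFDeriv_displaced_le t hp hi1 x).trans ?_
        rcases Nat.lt_or_ge i (m + 1) with hlt | hge
        · have h4 := hpB i hi1 (by omega)
          have h5 : (1 : ℝ) ≤ B ^ i := one_le_pow₀ hB
          have h6 : (3 : ℝ) ≤ 3 ^ i := by
            calc (3 : ℝ) = 3 ^ 1 := by norm_num
              _ ≤ 3 ^ i := pow_le_pow_right₀ (by norm_num) hi1
          calc 1 + 2 * ‖iteratedFDeriv ℝ i p x‖ ≤ 3 * B ^ i := by linarith
            _ ≤ 3 ^ i * B ^ i := by gcongr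
            _ = (3 * B) ^ i := (mul_pow _ _ _).symm
            _ ≤ Δ ^ i := by gcongr
        · obtain rfl : i = m + 1 := by omega
          rw [hΔW, hW]
          linarith
    rw [hΔW] at h2
    gcongr
  rw [misfitForce_eq, iteratedFDeriv_add_apply]
  · refine (norm_add_le _ _).trans ?_
    have h1 := key ((Real.pi - θ) / 2)
    have h2 := key ((Real.pi + θ) / 2)
    linarith
  · exact ((ContinuousLinearMap.contDiff _ |>.comp
      ((contDiff_gradient h).comp (contDiff_displaced _ hp))).of_le hm').contDiffAt
  · exact ((ContinuousLinearMap.contDiff _ |>.comp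
      ((contDiff_gradient h).comp (contDiff_displaced _ hp))).of_le hm').contDiffAt

/-- The constant in the `L²` estimate for the derivatives of the misfit force. -/
def forceConst (m : ℕ) (M : ℝ) : ℝ := 8 * ((m + 1).factorial * M) ^ 2 * 36 ^ (m + 1)

lemma misfitForce_smooth_bound {E : Mat} (hE : E.det ≠ 0) {Φ : Plane → ℝ} (h : ContDiff ℝ ∞ Φ)
    (hΦ : IsPeriodic E Φ) (θ : ℝ) {p : Plane → Plane} (hp : ContDiff ℝ ∞ p)
    (hpp : IsPeriodic E p) {m : ℕ} {M B : ℝ}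
    (hM : ∀ j ≤ m + 2, ∀ x, ‖iteratedFDeriv ℝ j Φ x‖ ≤ M) (hB : 1 ≤ B)
    (hpB : ∀ i, 1 ≤ i → i ≤ m → ∀ x, ‖iteratedFDeriv ℝ i p x‖ ≤ B ^ i) :
    ∑' n, ‖freq E n‖ ^ (2 * (m + 1)) *
        ampSq E (fun x => misfitForce Φ θ x ((2 : ℝ) • p x)) n ≤
      forceConst m M * (B ^ (2 * (m + 1)) + ∑' n, ‖freq E n‖ ^ (2 * (m + 1)) * ampSq E p n) := by
  have := isProbabilityMeasure_cellMeasure hE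
  have hM0 : 0 ≤ M := (norm_nonneg _).trans (hM 0 (by omega) 0)
  have hB0 : 0 ≤ B := zero_le_one.trans hB
  set g := fun x => misfitForce Φ θ x ((2 : ℝ) • p x)
  have hg : ContDiff ℝ ∞ g := contDiff_misfitForce h θ hp
  have hgp : IsPeriodic E g := isPeriodic_misfitForce hΦ θ hpp
  rw [(hasSum_iteratedFDeriv hE hg hgp (m + 1)).tsum_eq,
    (hasSum_iteratedFDeriv hE hp hpp (m + 1)).tsum_eq]
  have hint : ∀ {w : Plane → Plane}, ContDiff ℝ ∞ w → IsPeriodic E w → Integrable (fun x =>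
      ∑ s : Fin (m + 1) → Fin 2, ‖iteratedFDeriv ℝ (m + 1) w x (basisTuple s)‖ ^ 2)
      (cellMeasure E) := fun hw hwp =>
    integrable_finsetSum _ fun s _ => (((hwp.iteratedFDeriv (m + 1)).comp fun T =>
      T (basisTuple s)).memLp hE (contDiff_iteratedFDeriv_eval hw _ _).continuous 2
      |>.integrable_norm_pow (by norm_num))
  have e1 : ∀ c : ℝ, c = ∫ _, c ∂cellMeasure E := fun c => by simp
  rw [e1 (B ^ (2 * (m + 1))), ← integral_add (integrable_const _) (hint hp hpp),
    ← integral_const_mul]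
  refine integral_mono (hint hg hgp) (((integrable_const _).add (hint hp hpp)).const_mul _)
    fun x => ?_
  have h1 := norm_iteratedFDeriv_misfitForce_le h θ hp hM hB x fun i h1 h2 => hpB i h1 h2 x
  set d := ‖iteratedFDeriv ℝ (m + 1) p x‖
  have hd := opNorm_sq_le_sum_basisTuple (iteratedFDeriv ℝ (m + 1) p x)
  set S := ∑ s : Fin (m + 1) → Fin 2, ‖iteratedFDeriv ℝ (m + 1) p x (basisTuple s)‖ ^ 2
  have hS : 0 ≤ S := by positivity
  change d ^ 2 ≤ _ at hd
  -- Here `2 ^ (m + 1)` counts the index tuples. A second such factor, from the operator norm in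
  -- `hd`, and the `9 ^ (m + 1)` from `(3 * B) ^ 2` make up the `36 ^ (m + 1)` of `forceConst`.
  have h2 : ∑ s : Fin (m + 1) → Fin 2, ‖iteratedFDeriv ℝ (m + 1) g x (basisTuple s)‖ ^ 2 ≤
      2 ^ (m + 1) * ((m + 1).factorial * M * (2 * (3 * B) ^ (m + 1) + 2 * d)) ^ 2 := by
    calc _ ≤ ∑ s : Fin (m + 1) → Fin 2,
          ((m + 1).factorial * M * (2 * (3 * B) ^ (m + 1) + 2 * d)) ^ 2 := by
          gcongr with s
          exact (norm_basisTuple_le _ s).trans h1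
      _ = _ := by simp
  refine h2.trans ?_
  have h3 : (2 * (3 * B) ^ (m + 1) + 2 * d) ^ 2 ≤
      8 * (9 ^ (m + 1) * B ^ (2 * (m + 1)) + d ^ 2) := by
    have h4 : ((3 * B) ^ (m + 1)) ^ 2 = 9 ^ (m + 1) * B ^ (2 * (m + 1)) := by
      rw [← pow_mul, mul_comm (m + 1) 2, mul_pow, pow_mul (3 : ℝ)]; norm_num
    rw [← h4]
    nlinarith [sq_nonneg ((3 * B) ^ (m + 1) - d)]
  have h5 : 9 ^ (m + 1) * B ^ (2 * (m + 1)) + d ^ 2 ≤ 18 ^ (m + 1) * (B ^ (2 * (m + 1)) + S) := by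
    have h6 : (9 : ℝ) ^ (m + 1) ≤ 18 ^ (m + 1) := by gcongr; norm_num
    have h7 : (2 : ℝ) ^ (m + 1) ≤ 18 ^ (m + 1) := by gcongr; norm_num
    rw [mul_add ((18 : ℝ) ^ (m + 1))]
    exact add_le_add (mul_le_mul_of_nonneg_right h6 (pow_nonneg hB0 _))
      (hd.trans (mul_le_mul_of_nonneg_right h7 hS))
  calc _ = 2 ^ (m + 1) * ((m + 1).factorial * M) ^ 2 * (2 * (3 * B) ^ (m + 1) + 2 * d) ^ 2 := by
        ring
    _ ≤ 2 ^ (m + 1) * ((m + 1).factorial * M) ^ 2 *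
        (8 * (18 ^ (m + 1) * (B ^ (2 * (m + 1)) + S))) := by
      gcongr
      exact h3.trans (by gcongr)
    _ = forceConst m M * (B ^ (2 * (m + 1)) + S) := by
      have h8 : (36 : ℝ) ^ (m + 1) = 2 ^ (m + 1) * 18 ^ (m + 1) := by rw [← mul_pow]; norm_num
      rw [forceConst, h8]; ring

/-! ### Fourier truncation, and the force of a displacement in `L²`. -/

/-- The frequencies in a box. -/
def freqBox (N : ℕ) : Finset (Fin 2 → ℤ) := Finset.Icc (fun _ => -(N : ℤ)) fun _ => (N : ℤ)

lemma neg_mem_freqBox {N : ℕ} : ∀ n ∈ freqBox N, -n ∈ freqBox N := by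
  intro n hn
  simp only [freqBox, Finset.mem_Icc, Pi.le_def, Pi.neg_apply] at hn ⊢
  exact ⟨fun i => by linarith [hn.2 i], fun i => by linarith [hn.1 i]⟩

lemma tendsto_freqBox : Filter.Tendsto freqBox Filter.atTop Filter.atTop := by
  refine Filter.tendsto_atTop_finset_of_monotone (fun a b hab => ?_) fun n => ?_
  · intro n hn
    simp only [freqBox, Finset.mem_Icc, Pi.le_def] at hn ⊢
    have : (a : ℤ) ≤ b := by exact_mod_cast hab
    exact ⟨fun i => by linarith [hn.1 i], fun i => by linarith [hn.2 i]⟩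
  · refine ⟨∑ i, (n i).natAbs, ?_⟩
    simp only [freqBox, Finset.mem_Icc, Pi.le_def, Fin.forall_fin_two, Fin.sum_univ_two]
    omega

/-- The Fourier coefficients of a vector field. -/
def vcoef (E : Mat) (u : Plane → Plane) (i : Fin 2) (n : Fin 2 → ℤ) : ℂ :=
  rcoef E (fun x => u x i) n

lemma vcoef_neg (E : Mat) (u : Plane → Plane) (i : Fin 2) (n : Fin 2 → ℤ) :
    vcoef E u i (-n) = conj (vcoef E u i n) := rcoef_neg _ _ _

lemma ampSq_trigPoly {E : Mat} (hE : E.det ≠ 0) (u : Plane → Plane) {T : Finset (Fin 2 → ℤ)}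
    (hT : ∀ n ∈ T, -n ∈ T) (n : Fin 2 → ℤ) :
    ampSq E (trigPoly E (vcoef E u) T) n = if n ∈ T then ampSq E u n else 0 := by
  simp only [ampSq, rcoef_trigPoly hE (vcoef_neg E u) hT]
  split_ifs <;> simp [vcoef]

lemma tendsto_trigPoly {E : Mat} (hE : E.det ≠ 0) {u : Plane → Plane}
    (hu : MemLp u 2 (cellMeasure E)) :
    Filter.Tendsto (fun N => ∫ x, ‖trigPoly E (vcoef E u) (freqBox N) x - u x‖ ^ 2 ∂cellMeasure E)
      Filter.atTop (nhds 0) := by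
  have hs := hasSum_ampSq hE hu
  have h1 : ∀ N, ∫ x, ‖trigPoly E (vcoef E u) (freqBox N) x - u x‖ ^ 2 ∂cellMeasure E =
      ∫ x, ‖u x‖ ^ 2 ∂cellMeasure E - ∑ n ∈ freqBox N, ampSq E u n := by
    intro N
    have hp2 : MemLp (trigPoly E (vcoef E u) (freqBox N)) 2 (cellMeasure E) :=
      (isPeriodic_trigPoly hE _ _).memLp hE (contDiff_trigPoly E _ _).continuous 2
    have h2 := hasSum_ampSq hE (hp2.sub hu)
    have h3 : HasSum (fun n => if n ∈ freqBox N then ampSq E u n else 0)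
        (∑ n ∈ freqBox N, ampSq E u n) := by
      have := hasSum_sum_of_ne_finset_zero (f := fun n => if n ∈ freqBox N then ampSq E u n else 0)
        (s := freqBox N) (L := .unconditional _) fun n hn => if_neg hn
      rwa [Finset.sum_congr rfl fun n hn => if_pos hn] at this
    refine h2.unique ((hs.sub h3).congr_fun fun n => ?_)
    have h4 : ∀ i, rcoef E (fun x => (trigPoly E (vcoef E u) (freqBox N) - u) x i) n =
        (if n ∈ freqBox N then vcoef E u i n else 0) - vcoef E u i n := by
      intro i
      rw [← rcoef_trigPoly hE (vcoef_neg E u) neg_mem_freqBox]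
      have := rcoef_add_smul hE (memLp_proj hp2 i) (memLp_proj hu i) (-1) n
      refine Eq.trans ?_ (this.trans ?_)
      · congr 1
        funext x
        simp [sub_eq_add_neg]
      · simp [vcoef, sub_eq_add_neg]
    simp only [ampSq, h4]
    split_ifs <;> simp [vcoef]
  simp only [h1]
  have h5 := (hs.comp tendsto_freqBox).const_sub (∫ x, ‖u x‖ ^ 2 ∂cellMeasure E)
  rw [sub_self] at h5
  exact h5

/-- Sobolev regularity of the misfit force of a displacement in `L²`. -/
lemma misfitForce_bound {E : Mat} (hE : E.det ≠ 0) {Φ : Plane → ℝ} (h : ContDiff ℝ ∞ Φ)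
    (hΦ : IsPeriodic E Φ) (θ : ℝ) {u : Plane → Plane} (hu : MemLp u 2 (cellMeasure E))
    {m : ℕ} {M B : ℝ} (hM : ∀ j ≤ m + 2, ∀ x, ‖iteratedFDeriv ℝ j Φ x‖ ≤ M) (hB : 1 ≤ B)
    (hA : ∀ i, 1 ≤ i → i ≤ m → ∀ T : Finset (Fin 2 → ℤ),
      ∑ n ∈ T, ‖freq E n‖ ^ i * ∑ l, ‖vcoef E u l n‖ ≤ B ^ i)
    (hH : Summable fun n => ‖freq E n‖ ^ (2 * (m + 1)) * ampSq E u n) :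
    (Summable fun n => ‖freq E n‖ ^ (2 * (m + 1)) *
        ampSq E (fun x => misfitForce Φ θ x ((2 : ℝ) • u x)) n) ∧
    ∑' n, ‖freq E n‖ ^ (2 * (m + 1)) *
        ampSq E (fun x => misfitForce Φ θ x ((2 : ℝ) • u x)) n ≤
      forceConst m M * (B ^ (2 * (m + 1)) + ∑' n, ‖freq E n‖ ^ (2 * (m + 1)) * ampSq E u n) := by
  have := isProbabilityMeasure_cellMeasure hE
  have h1 : ContDiff ℝ 1 Φ := h.of_le (by simp)
  have h2 : ContDiff ℝ 2 Φ := by exact_mod_cast contDiff_infty.1 h 2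
  set K := forceConst m M * (B ^ (2 * (m + 1)) + ∑' n, ‖freq E n‖ ^ (2 * (m + 1)) * ampSq E u n)
    with hK
  have hK0 : 0 ≤ forceConst m M := by unfold forceConst; positivity
  -- The estimate for smooth displacements is applied to the truncations `p N`, with a bound
  -- independent of `N`. Each coefficient of the force converges because the force is Lipschitz in
  -- the displacement, so the bound passes to finite sums of the limit and then to the series, as in
  -- Fatou's lemma.
  set p := fun N => trigPoly E (vcoef E u) (freqBox N)
  set F := fun x => misfitForce Φ θ x ((2 : ℝ) • u x)
  set g := fun N x => misfitForce Φ θ x ((2 : ℝ) • p N x)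
  have hpc : ∀ N, ContDiff ℝ ∞ (p N) := fun N => contDiff_trigPoly E _ _
  have hpp : ∀ N, IsPeriodic E (p N) := fun N => isPeriodic_trigPoly hE _ _
  have hp2 : ∀ N, MemLp (p N) 2 (cellMeasure E) := fun N => (hpp N).memLp hE (hpc N).continuous 2
  have hF2 : MemLp F 2 (cellMeasure E) := memLp_misfitForce hE h1 hΦ θ hu.1 2
  have hg2 : ∀ N, MemLp (g N) 2 (cellMeasure E) := fun N =>
    memLp_misfitForce hE h1 hΦ θ (hp2 N).1 2
  -- uniform bounds
  have bound : ∀ N (S : Finset (Fin 2 → ℤ)),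
      ∑ n ∈ S, ‖freq E n‖ ^ (2 * (m + 1)) * ampSq E (g N) n ≤ K := by
    intro N S
    have h3 := misfitForce_smooth_bound hE h hΦ θ (hpc N) (hpp N) hM hB fun i h1 h2 x =>
      (norm_iteratedFDeriv_trigPoly_le E _ _ i x).trans (hA i h1 h2 _)
    have h4 := hasSum_iteratedFDeriv hE (contDiff_misfitForce h θ (hpc N))
      (isPeriodic_misfitForce hΦ θ (hpp N)) (m + 1)
    refine (h4.summable.sum_le_tsum S fun n _ =>
      mul_nonneg (by positivity) (ampSq_nonneg _ _ _)).trans (h3.trans ?_)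
    refine mul_le_mul_of_nonneg_left (add_le_add le_rfl ?_) hK0
    refine (hasSum_iteratedFDeriv hE (hpc N) (hpp N) (m + 1)).summable.tsum_le_tsum (fun n => ?_) hH
    rw [ampSq_trigPoly hE u neg_mem_freqBox]
    have := ampSq_nonneg E u n
    split_ifs
    · rfl
    · rw [mul_zero]
      exact mul_nonneg (by positivity) this
  -- convergence of the coefficients
  have conv : ∀ i n, Filter.Tendsto (fun N => rcoef E (fun x => g N x i) n) Filter.atTop
      (nhds (rcoef E (fun x => F x i) n)) := by
    intro i n
    rw [tendsto_iff_norm_sub_tendsto_zero]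
    have h3 := ((tendsto_trigPoly hE hu).sqrt.const_mul (2 * supDeriv 2 Φ))
    rw [Real.sqrt_zero, mul_zero] at h3
    refine squeeze_zero (fun _ => norm_nonneg _) (fun N => ?_) h3
    have h4 : rcoef E (fun x => g N x i) n - rcoef E (fun x => F x i) n =
        rcoef E (fun x => g N x i + (-1) * F x i) n := by
      rw [rcoef_add_smul hE (memLp_proj (hg2 N) i) (memLp_proj hF2 i)]
      push_cast; ring
    rw [h4, rcoef, coef]
    have h5 : MemLp (fun x => p N x - u x) 2 (cellMeasure E) := (hp2 N).sub hu
    refine (norm_integral_le_of_norm_le (g := fun x => 2 * supDeriv 2 Φ * ‖p N x - u x‖)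
      ((h5.integrable (by norm_num)).norm.const_mul _)
      (Filter.Eventually.of_forall fun x => ?_)).trans ?_
    · rw [norm_mul, RCLike.norm_conj, norm_expo, one_mul, Complex.norm_real, neg_one_mul,
        ← sub_eq_add_neg, ← PiLp.sub_apply]
      refine (PiLp.norm_apply_le _ i).trans ((norm_misfitForce_sub_le hE h2 hΦ θ x _ _).trans_eq ?_)
      rw [← smul_sub, norm_smul, Real.norm_ofNat]
      ring
    · rw [integral_const_mul]
      exact mul_le_mul_of_nonneg_left (integral_norm_le_sqrt hE h5)
        (mul_nonneg (by norm_num) (supDeriv_nonneg 2 Φ))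
  have fin : ∀ S : Finset (Fin 2 → ℤ),
      ∑ n ∈ S, ‖freq E n‖ ^ (2 * (m + 1)) * ampSq E F n ≤ K := by
    intro S
    refine le_of_tendsto (x := Filter.atTop)
      (f := fun N => ∑ n ∈ S, ‖freq E n‖ ^ (2 * (m + 1)) * ampSq E (g N) n)
      (tendsto_finsetSum S fun n _ => ?_) (Filter.Eventually.of_forall fun N => bound N S)
    exact (tendsto_finsetSum _ fun i _ => (conv i n).norm.pow 2).const_mul _
  have hnn : ∀ n, 0 ≤ ‖freq E n‖ ^ (2 * (m + 1)) * ampSq E F n := fun n =>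
    mul_nonneg (by positivity) (ampSq_nonneg _ _ _)
  have hsum := summable_of_sum_le hnn fin
  exact ⟨hsum, hsum.tsum_le_of_sum_le fin⟩

/-! ### Elliptic regularity, one frequency at a time. -/

/-- The elasticity tensor. -/
def elasticTensor (lam mu : ℝ) (i j k l : Fin 2) : ℝ :=
  lam * (if i = j ∧ k = l then 1 else 0) +
    mu * ((if i = k ∧ j = l then 1 else 0) + (if i = l ∧ j = k then 1 else 0))

lemma elasticPairing_eq_sum (lam mu : ℝ) (A B : Mat) : elasticPairing lam mu A B =
    ∑ i, ∑ j, ∑ k, ∑ l, elasticTensor lam mu i j k l * (A i j * B k l) := by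
  simp [elasticPairing, strain, Fin.sum_univ_two, Matrix.trace, elasticTensor]
  ring

lemma MemSobolev.integral_elastic_eq_sum {E : Mat} (hE : E.det ≠ 0) {u v : Plane → Plane}
    {G H : Plane → Mat} (hu : MemSobolev E u G) (hv : MemSobolev E v H) (lam mu : ℝ) :
    ∫ x, elasticPairing lam mu (G x) (H x) ∂cellMeasure E =
      ∑ i, ∑ j, ∑ k, ∑ l,
        elasticTensor lam mu i j k l * ∫ x, G x i j * H x k l ∂cellMeasure E := by
  have h := fun i j k l =>
    (hu.integrable_mul hE hv i j k l).const_mul (elasticTensor lam mu i j k l)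
  simp only [elasticPairing_eq_sum, ← integral_const_mul]
  rw [integral_finsetSum _ fun i _ => integrable_finsetSum _ fun j _ => integrable_finsetSum _
    fun k _ => integrable_finsetSum _ fun l _ => h i j k l]
  refine Finset.sum_congr rfl fun i _ => ?_
  rw [integral_finsetSum _ fun j _ => integrable_finsetSum _
    fun k _ => integrable_finsetSum _ fun l _ => h i j k l]
  refine Finset.sum_congr rfl fun j _ => ?_
  rw [integral_finsetSum _ fun k _ => integrable_finsetSum _ fun l _ => h i j k l]
  refine Finset.sum_congr rfl fun k _ => ?_
  rw [integral_finsetSum _ fun l _ => h i j k l]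

/-- The gradient of the Fourier truncation. -/
def trigGrad (E : Mat) (G : Plane → Mat) (T : Finset (Fin 2 → ℤ)) (x : Plane) : Mat :=
  fun i j => (fourierSum E (rcoef E fun y => G y i j) T x).re

lemma rcoef_trigGrad {E : Mat} (hE : E.det ≠ 0) (G : Plane → Mat) {T : Finset (Fin 2 → ℤ)}
    (hT : ∀ n ∈ T, -n ∈ T) (i j : Fin 2) (m : Fin 2 → ℤ) :
    rcoef E (fun x => trigGrad E G T x i j) m =
      if m ∈ T then rcoef E (fun x => G x i j) m else 0 := by
  simp only [rcoef, trigGrad]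
  rw [← coef_fourierSum hE]
  congr 1
  funext x
  exact ofReal_fourierSum (rcoef_neg E _) hT x

lemma MemSobolev.trigPoly {E : Mat} (hE : E.det ≠ 0) {u : Plane → Plane} {G : Plane → Mat}
    (h : MemSobolev E u G) {T : Finset (Fin 2 → ℤ)} (hT : ∀ n ∈ T, -n ∈ T) :
    MemSobolev E (trigPoly E (vcoef E u) T) (trigGrad E G T) := by
  refine memSobolev_of_rcoef hE (isPeriodic_trigPoly hE _ T) (fun m x => ?_)
    ((isPeriodic_trigPoly hE _ T).memLp hE (contDiff_trigPoly E _ T).continuous 2) (fun i j => ?_)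
    (fun i => ?_) (fun i j n => ?_)
  · ext i j
    simp only [trigGrad, isPeriodic_fourierSum hE _ T m x]
  · exact ((isPeriodic_fourierSum hE _ T).comp Complex.re).memLp hE
      (Complex.continuous_re.comp (contDiff_fourierSum E _ T).continuous) 2
  · rw [rcoef_trigPoly hE (vcoef_neg E u) hT, vcoef, h.rcoef_zero hE, ite_self]
  · rw [rcoef_trigPoly hE (vcoef_neg E u) hT, rcoef_trigGrad hE G hT, h.rcoef_grad hE]
    split_ifs <;> simp [vcoef]

/-- Truncation is an orthogonal projection acting equally on all components. As the elasticity
tensor is constant, the elastic form of `u` against its truncation is that of the truncation with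
itself, to which Korn applies; the symbol of the operator need not be inverted. -/
lemma MemSobolev.integral_mul_trigGrad {E : Mat} (hE : E.det ≠ 0) {u : Plane → Plane}
    {G : Plane → Mat} (h : MemSobolev E u G) {T : Finset (Fin 2 → ℤ)} (hT : ∀ n ∈ T, -n ∈ T)
    (i j k l : Fin 2) :
    ∫ x, G x i j * trigGrad E G T x k l ∂cellMeasure E =
      ∫ x, trigGrad E G T x i j * trigGrad E G T x k l ∂cellMeasure E := by
  have hp := h.trigPoly hE hT
  have h1 := parseval_real hE (h.memLp_grad_cell hE i j) (hp.memLp_grad_cell hE k l)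
  have h2 := parseval_real hE (hp.memLp_grad_cell hE i j) (hp.memLp_grad_cell hE k l)
  have h3 := h1.unique (h2.congr_fun fun n => ?_)
  · exact_mod_cast h3
  · simp only [rcoef_trigGrad hE G hT]
    split_ifs <;> simp

lemma integral_inner_trigPoly_le {E : Mat} (hE : E.det ≠ 0) {f u : Plane → Plane}
    (hf : MemLp f 2 (cellMeasure E)) {T : Finset (Fin 2 → ℤ)} (hT : ∀ n ∈ T, -n ∈ T) :
    ∫ x, (inner ℝ (f x) (trigPoly E (vcoef E u) T x) : ℝ) ∂cellMeasure E ≤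
      ∑ n ∈ T, Real.sqrt (ampSq E f n) * Real.sqrt (ampSq E u n) := by
  have hp2 : MemLp (trigPoly E (vcoef E u) T) 2 (cellMeasure E) :=
    (isPeriodic_trigPoly hE _ T).memLp hE (contDiff_trigPoly E _ T).continuous 2
  have h1 := (parseval_real hE (memLp_proj hf 0) (memLp_proj hp2 0)).add
    (parseval_real hE (memLp_proj hf 1) (memLp_proj hp2 1))
  have h2 : ∫ x, (inner ℝ (f x) (trigPoly E (vcoef E u) T x) : ℝ) ∂cellMeasure E =
      ∫ x, f x 0 * trigPoly E (vcoef E u) T x 0 ∂cellMeasure E +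
      ∫ x, f x 1 * trigPoly E (vcoef E u) T x 1 ∂cellMeasure E := by
    simp only [inner_plane]
    exact integral_add ((memLp_proj hf 0).integrable_mul (memLp_proj hp2 0))
      ((memLp_proj hf 1).integrable_mul (memLp_proj hp2 1))
  rw [← Complex.ofReal_add, ← h2] at h1
  simp only [rcoef_trigPoly hE (vcoef_neg E u) hT] at h1
  have h3 := hasSum_sum_of_ne_finset_zero (L := .unconditional _) (s := T) (f := fun n =>
    conj (rcoef E (fun x => f x 0) n) * (if n ∈ T then vcoef E u 0 n else 0) +
    conj (rcoef E (fun x => f x 1) n) * (if n ∈ T then vcoef E u 1 n else 0))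
    fun n hn => by simp [hn]
  have h4 := h1.unique h3
  have h5 := congrArg norm h4
  rw [Complex.norm_real] at h5
  refine (Real.le_norm_self _).trans (h5.le.trans (norm_sum_le_of_le _ fun n hn => ?_))
  simp only [hn, if_true]
  rw [← Real.sqrt_mul (ampSq_nonneg _ _ _)]
  refine (norm_add_le _ _).trans (Real.le_sqrt_of_sq_le ?_)
  simp only [norm_mul, RCLike.norm_conj, ampSq, Fin.sum_univ_two, vcoef]
  nlinarith [sq_nonneg (‖rcoef E (fun x => f x 0) n‖ * ‖rcoef E (fun x => u x 1) n‖ -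
    ‖rcoef E (fun x => f x 1) n‖ * ‖rcoef E (fun x => u x 0) n‖)]

lemma ampSq_neg (E : Mat) (u : Plane → Plane) (n : Fin 2 → ℤ) : ampSq E u (-n) = ampSq E u n := by
  simp [ampSq, rcoef_neg]

/-- Elliptic regularity, frequency by frequency. -/
lemma IsSolution.elliptic {E : Mat} (hE : E.det ≠ 0) {lam mu : ℝ} (hl : 0 ≤ lam)
    (hm : 0 < mu) {Φ : Plane → ℝ} (hΦ : ContDiff ℝ 1 Φ) (hp : IsPeriodic E Φ) {θ : ℝ}
    {u : Plane → Plane} {G : Plane → Mat} (h : IsSolution E lam mu Φ θ u G) (n : Fin 2 → ℤ) :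
    (mu * ‖freq E n‖ ^ 2) ^ 2 * ampSq E u n ≤
      (1 / (4 * Real.sin (θ / 2) ^ 2)) ^ 2 *
        ampSq E (fun x => misfitForce Φ θ x ((2 : ℝ) • u x)) n := by
  have ha := ampSq_nonneg E u n
  set F := fun x => misfitForce Φ θ x ((2 : ℝ) • u x) with hF
  have hf := ampSq_nonneg E F n
  set c := 1 / (4 * Real.sin (θ / 2) ^ 2)
  have hc : 0 ≤ c := by positivity
  rcases eq_or_ne n 0 with rfl | hn
  · rw [(freq_eq_zero_iff hE).2 rfl, norm_zero]
    simp only [ne_eq, OfNat.ofNat_ne_zero, not_false_eq_true, zero_pow, mul_zero, zero_mul]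
    positivity
  have hnn : n ≠ -n := fun h0 => hn (self_eq_neg.1 h0)
  -- The smallest set containing `n` whose truncation keeps the test field real. Both frequencies
  -- contribute equally, so the estimate for the pair is twice that for `n`.
  set T : Finset (Fin 2 → ℤ) := {n, -n}
  have hT : ∀ m ∈ T, -m ∈ T := by
    intro m hm
    simp only [T, Finset.mem_insert, Finset.mem_singleton] at hm ⊢
    rcases hm with rfl | rfl <;> simp
  have hS := h.1.trigPoly hE hT
  have hF2 := memLp_misfitForce hE hΦ hp θ (h.1.memLp_cell hE).1 2
  have h1 := h.2 _ _ hS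
  rw [average_cell, average_cell, h.1.integral_elastic_eq_sum hE hS] at h1
  simp only [h.1.integral_mul_trigGrad hE hT] at h1
  rw [← hS.integral_elastic_eq_sum hE hS] at h1
  have h2 := hS.korn hE hl hm.le
  rw [h1, ← (hS.hasSum_grad hE).tsum_eq] at h2
  have h3 := integral_inner_trigPoly_le hE (u := u) hF2 hT
  have h4 : ∑' m, ‖freq E m‖ ^ 2 * ampSq E (Bilayer.trigPoly E (vcoef E u) T) m =
      ∑ m ∈ T, ‖freq E m‖ ^ 2 * ampSq E u m := by
    simp only [ampSq_trigPoly hE u hT]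
    rw [tsum_eq_sum (s := T) fun m hm => by simp [hm]]
    exact Finset.sum_congr rfl fun m hm => by simp [hm]
  rw [h4, Finset.sum_pair hnn, freq_neg, norm_neg, ampSq_neg] at h2
  rw [Finset.sum_pair hnn, ampSq_neg, ampSq_neg, ← hF] at h3
  have h5 := h2.trans (mul_le_mul_of_nonneg_left h3 hc)
  set a := Real.sqrt (ampSq E u n) with hadef
  set f := Real.sqrt (ampSq E F n) with hfdef
  have ha2 : ampSq E u n = a ^ 2 := (Real.sq_sqrt ha).symm
  have hf2 : ampSq E F n = f ^ 2 := (Real.sq_sqrt hf).symm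
  have ha0 : 0 ≤ a := Real.sqrt_nonneg _
  have hf0 : 0 ≤ f := Real.sqrt_nonneg _
  rw [ha2] at h5
  rw [ha2, hf2, ← mul_pow, ← mul_pow]
  refine pow_le_pow_left₀ (by positivity) ?_ 2
  rcases ha0.eq_or_lt with h0 | h0
  · rw [← h0, mul_zero]; positivity
  · refine le_of_mul_le_mul_right ?_ h0
    linarith

/-! ### From `L²` to weighted `ℓ¹` norms of the coefficients, with a small loss. -/

lemma sq_sum_norm_vcoef_le (E : Mat) (u : Plane → Plane) (n : Fin 2 → ℤ) :
    (∑ l, ‖vcoef E u l n‖) ^ 2 ≤ 2 * ampSq E u n := by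
  simp only [ampSq, vcoef, Fin.sum_univ_two]
  nlinarith [sq_nonneg (‖rcoef E (fun x => u x 0) n‖ - ‖rcoef E (fun x => u x 1) n‖)]

lemma summable_freq_rpow {E : Mat} (hE : E.det ≠ 0) {s : ℝ} (hs : 2 < s) :
    Summable fun n : Fin 2 → ℤ => ‖freq E n‖ ^ (-s) := by
  obtain ⟨b, hb, h⟩ := exists_norm_le_freq hE
  refine Summable.of_nonneg_of_le (fun n => by positivity) (fun n => ?_)
    ((EisensteinSeries.summable_one_div_norm_rpow hs).mul_left (b ^ (-s)))
  rcases eq_or_ne n 0 with rfl | hn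
  · rw [(freq_eq_zero_iff hE).2 rfl, norm_zero, norm_zero, Real.zero_rpow (by linarith), mul_zero]
  · have hn' : 0 < ‖n‖ := norm_pos_iff.2 hn
    rw [← Real.mul_rpow hb.le hn'.le]
    exact Real.rpow_le_rpow_of_nonpos (by positivity) (h n) (by linarith)

/-- The summable weight of the Sobolev embedding with loss `1 / (q + 1)`. -/
def sobWeight (E : Mat) (q : ℕ) (n : Fin 2 → ℤ) : ℝ :=
  ‖freq E n‖ ^ (-(2 + 2 * ((q + 1 : ℕ) : ℝ)⁻¹))

lemma sobWeight_nonneg (E : Mat) (q : ℕ) (n : Fin 2 → ℤ) : 0 ≤ sobWeight E q n := by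
  unfold sobWeight; positivity

lemma summable_sobWeight {E : Mat} (hE : E.det ≠ 0) (q : ℕ) : Summable (sobWeight E q) :=
  summable_freq_rpow hE (by have : (0 : ℝ) < 2 * ((q + 1 : ℕ) : ℝ)⁻¹ := by positivity
                            linarith)

/-- The weight pays for summability in dimension two with the extra factor `y²`, where `y =
r^(1/(q+1))`. Below the frequency `τ^(q+1)` one has `y ≤ τ`, and the first term suffices; above it,
`(y / τ)² ≤ (r / τ^(q+1))²`, and the second term does. -/
lemma pow_le_sobWeight_mul {E : Mat} {q : ℕ} {τ : ℝ} (hτ : 1 ≤ τ) {n : Fin 2 → ℤ} (m : ℕ) :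
    (‖freq E n‖ ^ (m + 1)) ^ 2 ≤ sobWeight E q n * (τ ^ 2 * (‖freq E n‖ ^ (2 * (m + 2)) +
      ‖freq E n‖ ^ (2 * (m + 3)) / (τ ^ (q + 1)) ^ 2)) := by
  set r := ‖freq E n‖ with hr
  have hτ0 : 0 < τ := by linarith
  rcases (norm_nonneg (freq E n)).eq_or_lt with h0 | h0
  · have : r = 0 := h0.symm
    have h1 := sobWeight_nonneg E q n
    rw [this]
    simp only [ne_eq, Nat.add_eq_zero_iff, one_ne_zero, and_false, not_false_eq_true, zero_pow,
      OfNat.ofNat_ne_zero]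
    positivity
  · change 0 < r at h0
    set y := r ^ (((q + 1 : ℕ) : ℝ)⁻¹) with hy
    have hy0 : 0 < y := Real.rpow_pos_of_pos h0 _
    have hyr : y ^ (q + 1) = r := Real.rpow_inv_natCast_pow h0.le (by omega)
    have hz : sobWeight E q n = (r ^ 2 * y ^ 2)⁻¹ := by
      rw [sobWeight, ← hr, Real.rpow_neg h0.le, Real.rpow_add h0]
      congr 2
      · exact Real.rpow_two r
      · rw [mul_comm, Real.rpow_mul h0.le, Real.rpow_two]
    have key : y ^ 2 ≤ τ ^ 2 * (1 + r ^ 2 / (τ ^ (q + 1)) ^ 2) := by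
      rcases le_total y τ with h1 | h1
      · have h2 : y ^ 2 ≤ τ ^ 2 := by gcongr
        have h3 : 0 ≤ r ^ 2 / (τ ^ (q + 1)) ^ 2 := by positivity
        nlinarith [sq_nonneg τ]
      · have h2 : 1 ≤ y / τ := (one_le_div hτ0).2 h1
        have h3 : (y / τ) ^ 2 ≤ ((y / τ) ^ (q + 1)) ^ 2 :=
          pow_le_pow_left₀ (by positivity) (le_self_pow₀ h2 (by omega)) 2
        rw [div_pow, div_pow, div_pow, hyr, div_le_iff₀ (by positivity)] at h3
        nlinarith [sq_nonneg τ]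
    rw [hz, inv_mul_eq_div, le_div_iff₀ (by positivity)]
    calc (r ^ (m + 1)) ^ 2 * (r ^ 2 * y ^ 2) = r ^ (2 * (m + 2)) * y ^ 2 := by ring
      _ ≤ r ^ (2 * (m + 2)) * (τ ^ 2 * (1 + r ^ 2 / (τ ^ (q + 1)) ^ 2)) := by gcongr
      _ = _ := by ring

/-- Cauchy–Schwarz against the summable weight. If order `m + 3` is larger than order `m + 2` by a
factor `τ^(q+1)`, the two terms balance and the only loss is `τ`. -/
lemma wiener_bound {E : Mat} (hE : E.det ≠ 0) {q : ℕ} {τ : ℝ} (hτ : 1 ≤ τ) (m : ℕ)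
    {u : Plane → Plane} (h2 : Summable fun n => ‖freq E n‖ ^ (2 * (m + 2)) * ampSq E u n)
    (h3 : Summable fun n => ‖freq E n‖ ^ (2 * (m + 3)) * ampSq E u n) (T : Finset (Fin 2 → ℤ)) :
    (∑ n ∈ T, ‖freq E n‖ ^ (m + 1) * ∑ l, ‖vcoef E u l n‖) ^ 2 ≤
      (∑' n, sobWeight E q n) * (2 * τ ^ 2 *
        (∑' n, ‖freq E n‖ ^ (2 * (m + 2)) * ampSq E u n +
          (∑' n, ‖freq E n‖ ^ (2 * (m + 3)) * ampSq E u n) / (τ ^ (q + 1)) ^ 2)) := by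
  have hτ0 : 0 < τ := by linarith
  have hnn : ∀ k n, 0 ≤ ‖freq E n‖ ^ k * ampSq E u n := fun k n =>
    mul_nonneg (by positivity) (ampSq_nonneg _ _ _)
  set g : (Fin 2 → ℤ) → ℝ := fun n => 2 * τ ^ 2 * (‖freq E n‖ ^ (2 * (m + 2)) * ampSq E u n +
    ‖freq E n‖ ^ (2 * (m + 3)) * ampSq E u n / (τ ^ (q + 1)) ^ 2) with hg
  have hg0 : ∀ n, 0 ≤ g n := fun n => by
    have h1 := hnn (2 * (m + 2)) n
    have h2 := hnn (2 * (m + 3)) n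
    simp only [hg]
    positivity
  have hgs : HasSum g (2 * τ ^ 2 *
        (∑' n, ‖freq E n‖ ^ (2 * (m + 2)) * ampSq E u n +
          (∑' n, ‖freq E n‖ ^ (2 * (m + 3)) * ampSq E u n) / (τ ^ (q + 1)) ^ 2)) :=
    (h2.hasSum.add (h3.hasSum.div_const _)).mul_left _
  refine (Finset.sum_sq_le_sum_mul_sum_of_sq_le_mul T (fun n _ => sobWeight_nonneg E q n)
    (fun n _ => hg0 n) fun n _ => ?_).trans ?_
  · rw [mul_pow]
    calc _ ≤ sobWeight E q n * (τ ^ 2 * (‖freq E n‖ ^ (2 * (m + 2)) +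
      ‖freq E n‖ ^ (2 * (m + 3)) / (τ ^ (q + 1)) ^ 2)) * (2 * ampSq E u n) :=
          mul_le_mul (pow_le_sobWeight_mul hτ m) (sq_sum_norm_vcoef_le E u n) (sq_nonneg _)
            (mul_nonneg (sobWeight_nonneg E q n) (by positivity))
      _ = _ := by simp only [hg]; ring
  · refine mul_le_mul ((summable_sobWeight hE q).sum_le_tsum T fun n _ => sobWeight_nonneg E q n)
      ?_ (Finset.sum_nonneg fun n _ => hg0 n) (tsum_nonneg (sobWeight_nonneg E q))
    rw [← hgs.tsum_eq]
    exact hgs.summable.sum_le_tsum T fun n _ => hg0 n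

/-! ### The bootstrap with explicit powers of the load. -/

/-- The a priori bounds of order `m` for a displacement `u`, at the scale `τ ^ q` of the load. -/
structure RegularityBound (E : Mat) (q : ℕ) (τ K : ℝ) (m : ℕ) (u : Plane → Plane) : Prop where
  -- The load is at most `τ ^ q`. Each derivative costs one factor `τ ^ (q + 1)`, except that at
  -- order `m + 2` the last two derivatives, gained from the equation, together cost only `τ ^ q`.
  wiener : ∀ i, 1 ≤ i → i ≤ m → ∀ T : Finset (Fin 2 → ℤ),
    ∑ n ∈ T, ‖freq E n‖ ^ i * ∑ l, ‖vcoef E u l n‖ ≤ (K * τ ^ (q + 1)) ^ i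
  summable_one : Summable fun n => ‖freq E n‖ ^ (2 * (m + 1)) * ampSq E u n
  bound_one : ∑' n, ‖freq E n‖ ^ (2 * (m + 1)) * ampSq E u n ≤ (K * (τ ^ (q + 1)) ^ (m + 1)) ^ 2
  summable_two : Summable fun n => ‖freq E n‖ ^ (2 * (m + 2)) * ampSq E u n
  bound_two : ∑' n, ‖freq E n‖ ^ (2 * (m + 2)) * ampSq E u n ≤
    (K * (τ ^ q * (τ ^ (q + 1)) ^ m)) ^ 2

/-- Gain of two derivatives. -/
lemma IsSolution.gain {E : Mat} (hE : E.det ≠ 0) {lam mu : ℝ} (hl : 0 ≤ lam)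
    (hm : 0 < mu) {Φ : Plane → ℝ} (hΦ : ContDiff ℝ 1 Φ) (hp : IsPeriodic E Φ) {θ : ℝ}
    {u : Plane → Plane} {G : Plane → Mat} (h : IsSolution E lam mu Φ θ u G) (k : ℕ)
    (hs : Summable fun n => ‖freq E n‖ ^ (2 * k) *
        ampSq E (fun x => misfitForce Φ θ x ((2 : ℝ) • u x)) n) :
    (Summable fun n => ‖freq E n‖ ^ (2 * (k + 2)) * ampSq E u n) ∧
    ∑' n, ‖freq E n‖ ^ (2 * (k + 2)) * ampSq E u n ≤
      (1 / (4 * Real.sin (θ / 2) ^ 2) / mu) ^ 2 * ∑' n, ‖freq E n‖ ^ (2 * k) *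
        ampSq E (fun x => misfitForce Φ θ x ((2 : ℝ) • u x)) n := by
  set c := 1 / (4 * Real.sin (θ / 2) ^ 2)
  set F := fun x => misfitForce Φ θ x ((2 : ℝ) • u x)
  have h1 : ∀ n, ‖freq E n‖ ^ (2 * (k + 2)) * ampSq E u n ≤
      (c / mu) ^ 2 * (‖freq E n‖ ^ (2 * k) * ampSq E F n) := by
    intro n
    have h2 := h.elliptic hE hl hm hΦ hp n
    rw [div_pow, div_mul_eq_mul_div, le_div_iff₀ (by positivity)]
    calc _ = ‖freq E n‖ ^ (2 * k) * ((mu * ‖freq E n‖ ^ 2) ^ 2 * ampSq E u n) := by ring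
      _ ≤ ‖freq E n‖ ^ (2 * k) * (c ^ 2 * ampSq E F n) := by gcongr
      _ = _ := by ring
  have hs' := hs.mul_left ((c / mu) ^ 2)
  have h3 := Summable.of_nonneg_of_le (fun n => mul_nonneg (by positivity) (ampSq_nonneg _ _ _))
    h1 hs'
  refine ⟨h3, ?_⟩
  rw [← tsum_mul_left]
  exact h3.tsum_le_tsum h1 hs'

lemma ampSq_le_gap_inv {E : Mat} (hE : E.det ≠ 0) {u : Plane → Plane}
    {n : Fin 2 → ℤ} (h0 : n = 0 → ampSq E u n = 0) :
    ampSq E u n ≤ (gap E)⁻¹ * (‖freq E n‖ ^ 2 * ampSq E u n) := by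
  have hg := gap_pos hE
  rcases eq_or_ne n 0 with rfl | hn
  · rw [h0 rfl]; simp
  · rw [inv_mul_eq_div, le_div_iff₀ hg, mul_comm]
    exact mul_le_mul_of_nonneg_right (gap_le hE hn) (ampSq_nonneg _ _ _)

/-- Absorbs a constant that bounds a squared norm into the square of a single `K`. -/
lemma le_one_add_sq {x : ℝ} (hx : 0 ≤ x) : x ≤ (1 + x) ^ 2 := by nlinarith

/-- The force is bounded by `M` whatever `u` is, so the equation bounds two derivatives of `u` in
`L²`; the first derivative follows from the gap. No `ℓ¹` bound is asked at this order. -/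
lemma IsSolution.regularityBound_zero {E : Mat} (hE : E.det ≠ 0) {mu : ℝ} (hm : 0 < mu)
    {M : ℝ} (hM0 : 0 ≤ M) (q : ℕ) : ∃ K, 1 ≤ K ∧ ∀ (lam : ℝ) (Φ : Plane → ℝ) (θ τ : ℝ)
      (u : Plane → Plane) (G : Plane → Mat), 0 ≤ lam → ContDiff ℝ ∞ Φ → IsPeriodic E Φ →
      (∀ x, ‖iteratedFDeriv ℝ 1 Φ x‖ ≤ M) → 1 ≤ τ →
      1 / (4 * Real.sin (θ / 2) ^ 2) ≤ τ ^ q → IsSolution E lam mu Φ θ u G →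
      RegularityBound E q τ K 0 u := by
  have hg := gap_pos hE
  have := isProbabilityMeasure_cellMeasure hE
  set K := 1 + M / mu + (M / mu) ^ 2 / gap E with hK
  have hK1 : M / mu ≤ K := by
    have : 0 ≤ (M / mu) ^ 2 / gap E := by positivity
    linarith
  have hK2 : (M / mu) ^ 2 / gap E ≤ K ^ 2 := by
    have h1 : 0 ≤ (M / mu) ^ 2 / gap E := by positivity
    have h2 : 0 ≤ M / mu := by positivity
    exact (le_one_add_sq h1).trans (pow_le_pow_left₀ (by positivity) (by linarith) 2)
  refine ⟨K, ?_, ?_⟩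
  · have : 0 ≤ M / mu + (M / mu) ^ 2 / gap E := by positivity
    linarith
  intro lam Φ θ τ u G hl hΦ hp hM hτ hc h
  have hΦ1 : ContDiff ℝ 1 Φ := hΦ.of_le (by simp)
  set c := 1 / (4 * Real.sin (θ / 2) ^ 2)
  have hc0 : 0 ≤ c := by positivity
  have hF2 := memLp_misfitForce hE hΦ1 hp θ (h.1.memLp_cell hE).1 2
  set F := fun x => misfitForce Φ θ x ((2 : ℝ) • u x)
  have hSM : supGrad Φ ≤ M := ciSup_le fun x => by
    rw [gradient_eq, LinearIsometryEquiv.norm_map, ← norm_iteratedFDeriv_one]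
    exact hM x
  have hFs := hasSum_ampSq hE hF2
  have hFM : ∑' n, ampSq E F n ≤ M ^ 2 := by
    rw [hFs.tsum_eq]
    have h1 : M ^ 2 = ∫ _, M ^ 2 ∂cellMeasure E := by simp
    rw [h1]
    refine integral_mono (hF2.integrable_norm_pow (by norm_num)) (integrable_const _) fun x => ?_
    exact pow_le_pow_left₀ (norm_nonneg _)
      ((norm_misfitForce_le hE hΦ1 hp θ x _).trans hSM) 2
  have h2 := h.gain hE hl hm hΦ1 hp 0 (by simpa using hFs.summable)
  have h3 : ∑' n, ‖freq E n‖ ^ (2 * (0 + 2)) * ampSq E u n ≤ (τ ^ q) ^ 2 * (M / mu) ^ 2 := by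
    refine h2.2.trans ?_
    simp only [mul_zero, pow_zero, one_mul]
    calc (c / mu) ^ 2 * ∑' n, ampSq E F n ≤ (τ ^ q / mu) ^ 2 * M ^ 2 := by
          gcongr
          exact tsum_nonneg (ampSq_nonneg E F)
      _ = _ := by ring
  have h4 : ∀ n, ‖freq E n‖ ^ (2 * (0 + 1)) * ampSq E u n ≤
      (gap E)⁻¹ * (‖freq E n‖ ^ (2 * (0 + 2)) * ampSq E u n) := by
    intro n
    have h5 := ampSq_le_gap_inv hE (u := u) (n := n) fun hn => by
      subst hn; simp [ampSq, h.1.rcoef_zero hE]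
    calc _ = ‖freq E n‖ ^ 2 * ampSq E u n := by ring
      _ ≤ ‖freq E n‖ ^ 2 * ((gap E)⁻¹ * (‖freq E n‖ ^ 2 * ampSq E u n)) := by gcongr
      _ = _ := by ring
  have hs' := h2.1.mul_left (gap E)⁻¹
  have h6 := Summable.of_nonneg_of_le (fun n => mul_nonneg (by positivity) (ampSq_nonneg _ _ _))
    h4 hs'
  refine ⟨fun i h1 h2 => by omega, h6, ?_, h2.1, ?_⟩
  · refine (h6.tsum_le_tsum h4 hs').trans ?_
    rw [tsum_mul_left]
    have hτq : τ ^ q ≤ (τ ^ (q + 1)) ^ (0 + 1) := by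
      rw [zero_add, pow_one]
      exact pow_le_pow_right₀ hτ (by omega)
    calc _ ≤ (gap E)⁻¹ * ((τ ^ q) ^ 2 * (M / mu) ^ 2) := by gcongr
      _ = (M / mu) ^ 2 / gap E * (τ ^ q) ^ 2 := by ring
      _ ≤ K ^ 2 * ((τ ^ (q + 1)) ^ (0 + 1)) ^ 2 := by gcongr
      _ = _ := by ring
  · refine h3.trans ?_
    calc (τ ^ q) ^ 2 * (M / mu) ^ 2 ≤ (τ ^ q) ^ 2 * K ^ 2 := by gcongr
      _ = _ := by ring

/-- The bounds of order `m` control `m + 1` derivatives of the force, the equation then controls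
order `m + 3` of `u`, and interpolation between orders `m + 2` and `m + 3` supplies the new `ℓ¹`
bound. `K` is chosen before `lam`, `Φ`, `θ` and `τ`. -/
lemma IsSolution.regularityBound {E : Mat} (hE : E.det ≠ 0) {mu : ℝ} (hm : 0 < mu)
    {M : ℝ} (hM0 : 0 ≤ M) (q m : ℕ) : ∃ K, 1 ≤ K ∧ ∀ (lam : ℝ) (Φ : Plane → ℝ) (θ τ : ℝ)
      (u : Plane → Plane) (G : Plane → Mat), 0 ≤ lam → ContDiff ℝ ∞ Φ → IsPeriodic E Φ →
      (∀ j ≤ m + 1, ∀ x, ‖iteratedFDeriv ℝ j Φ x‖ ≤ M) → 1 ≤ τ →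
      1 / (4 * Real.sin (θ / 2) ^ 2) ≤ τ ^ q → IsSolution E lam mu Φ θ u G →
      RegularityBound E q τ K m u := by
  induction m with
  | zero =>
    obtain ⟨K, hK, h⟩ := IsSolution.regularityBound_zero hE hm hM0 q
    exact ⟨K, hK, fun lam Φ θ τ u G h1 h2 h3 h4 => h lam Φ θ τ u G h1 h2 h3 (h4 1 le_rfl)⟩
  | succ m ih =>
    obtain ⟨K, hK, ih⟩ := ih
    have hK0 : 0 ≤ K := by linarith
    have hfc : 0 ≤ forceConst m M := by unfold forceConst; positivity
    set Z := ∑' n, sobWeight E q n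
    have hZ : 0 ≤ Z := tsum_nonneg (sobWeight_nonneg E q)
    -- `a` is the constant for the square of the new `L²` norm of order `m + 3`, and `b` the one for
    -- the square of the new `ℓ¹` norm of order `m + 1`.
    set a := 2 * forceConst m M * K ^ (2 * (m + 1)) / mu ^ 2
    have ha : 0 ≤ a := by positivity
    set b := 2 * Z * (K ^ 2 + a)
    have hb : 0 ≤ b := by positivity
    have hK'1 : 1 ≤ K + a + b := by linarith
    refine ⟨K + a + b, hK'1, ?_⟩
    intro lam Φ θ τ u G hl hΦ hp hM hτ hc h
    have hr := ih lam Φ θ τ u G hl hΦ hp (fun j hj => hM j (by omega)) hτ hc h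
    have hΦ1 : ContDiff ℝ 1 Φ := hΦ.of_le (by simp)
    have hτ0 : 0 < τ := by linarith
    set c := 1 / (4 * Real.sin (θ / 2) ^ 2)
    have hc0 : 0 ≤ c := by positivity
    set D := τ ^ (q + 1) with hD
    set σ := τ ^ q with hσ
    have hD1 : 1 ≤ D := one_le_pow₀ hτ
    have hσ1 : 1 ≤ σ := one_le_pow₀ hτ
    have hτσ : τ * σ = D := by rw [hD, hσ]; ring
    have hKD : 1 ≤ K * D := one_le_mul_of_one_le_of_one_le hK hD1
    obtain ⟨f1, f2⟩ := misfitForce_bound hE hΦ hp θ (h.1.memLp_cell hE) hM hKD hr.wiener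
      hr.summable_one
    obtain ⟨g1, g2⟩ := h.gain hE hl hm hΦ1 hp (m + 1) f1
    have f3 : ∑' n, ‖freq E n‖ ^ (2 * (m + 1)) *
        ampSq E (fun x => misfitForce Φ θ x ((2 : ℝ) • u x)) n ≤
        2 * forceConst m M * K ^ (2 * (m + 1)) * (D ^ (m + 1)) ^ 2 := by
      refine f2.trans ?_
      have h1 := hr.bound_one
      have h2 : K ^ 2 ≤ K ^ (2 * (m + 1)) := pow_le_pow_right₀ hK (by omega)
      calc _ ≤ forceConst m M * ((K * D) ^ (2 * (m + 1)) + (K * D ^ (m + 1)) ^ 2) := by gcongr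
        _ = forceConst m M * (K ^ (2 * (m + 1)) + K ^ 2) * (D ^ (m + 1)) ^ 2 := by ring
        _ ≤ forceConst m M * (K ^ (2 * (m + 1)) + K ^ (2 * (m + 1))) * (D ^ (m + 1)) ^ 2 := by
          gcongr
        _ = _ := by ring
    have g3 : ∑' n, ‖freq E n‖ ^ (2 * (m + 1 + 2)) * ampSq E u n ≤
        a * (σ * D ^ (m + 1)) ^ 2 := by
      refine g2.trans ?_
      calc _ ≤ (σ / mu) ^ 2 * (2 * forceConst m M * K ^ (2 * (m + 1)) * (D ^ (m + 1)) ^ 2) := by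
            gcongr
            exact tsum_nonneg fun n => mul_nonneg (by positivity) (ampSq_nonneg _ _ _)
        _ = _ := by ring
    have hKa : a ≤ (K + a + b) ^ 2 :=
      (le_one_add_sq ha).trans (pow_le_pow_left₀ (by positivity) (by linarith) 2)
    have hKb : b ≤ (K + a + b) ^ 2 :=
      (le_one_add_sq hb).trans (pow_le_pow_left₀ (by positivity) (by linarith) 2)
    -- The lower of the two new `L²` bounds is the upper one of the previous stage, weakened.
    refine ⟨fun i hi1 hi T => ?_, hr.summable_two, ?_, g1, ?_⟩
    · rcases Nat.lt_or_ge i (m + 1) with hlt | hge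
      · refine (hr.wiener i hi1 (by omega) T).trans ?_
        gcongr
        linarith
      · obtain rfl : i = m + 1 := by omega
        have h1 := wiener_bound hE (q := q) hτ m hr.summable_two g1 T
        have h2 := hr.bound_two
        refine le_of_sq_le_sq ?_ (by positivity)
        refine h1.trans ?_
        calc _ ≤ Z * (2 * τ ^ 2 * ((K * (σ * D ^ m)) ^ 2 + a * (σ * D ^ (m + 1)) ^ 2 / D ^ 2)) := by
              gcongr
          -- The loss `τ` of the embedding joins the cheap factor `σ = τ ^ q` to make one full
          -- factor `D`, which closes the induction.
          _ = b * ((τ * σ) * D ^ m) ^ 2 := by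
            simp only [b]
            have : D ≠ 0 := by positivity
            field_simp
            ring
          _ = b * (D ^ (m + 1)) ^ 2 := by rw [hτσ]; ring
          _ ≤ (K + a + b) ^ 2 * (D ^ (m + 1)) ^ 2 := by gcongr
          _ = ((K + a + b) * D ^ (m + 1)) ^ 2 := by ring
          _ ≤ ((K + a + b) ^ (m + 1) * D ^ (m + 1)) ^ 2 := by
            gcongr
            exact le_self_pow₀ hK'1 (by omega)
          _ = _ := by rw [← mul_pow (K + a + b) D]
    · refine hr.bound_two.trans ?_
      have h1 : σ * D ^ m ≤ D ^ (m + 1 + 1) := by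
        have : σ ≤ D := pow_le_pow_right₀ hτ (by omega)
        calc σ * D ^ m ≤ D * D ^ m := by gcongr
          _ = D ^ (m + 1) := by ring
          _ ≤ D ^ (m + 1 + 1) := pow_le_pow_right₀ hD1 (by omega)
      gcongr
      linarith
    · refine g3.trans ?_
      rw [mul_pow (K + a + b)]
      gcongr

/-! ### Smooth representatives and the constants of part (c). -/

/-- The sum of a Fourier series. -/
def fourierSeries (E : Mat) (c : (Fin 2 → ℤ) → ℂ) (x : Plane) : ℂ := ∑' n, c n * expo E n x

lemma isPeriodic_fourierSeries {E : Mat} (hE : E.det ≠ 0) (c : (Fin 2 → ℤ) → ℂ) :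
    IsPeriodic E (fourierSeries E c) := fun m x =>
  tsum_congr fun n => by rw [isPeriodic_expo hE n m x]

lemma contDiff_fourierSeries {E : Mat} {c : (Fin 2 → ℤ) → ℂ}
    (hc : ∀ k : ℕ, Summable fun n => ‖freq E n‖ ^ k * ‖c n‖) :
    ContDiff ℝ ∞ (fourierSeries E c) := by
  refine contDiff_tsum (v := fun k n => ‖freq E n‖ ^ k * ‖c n‖)
    (fun n => contDiff_const.mul (contDiff_expo E n)) (fun k _ => hc k) fun k n x _ => ?_
  have h : fourierSum E c {n} = fun x => c n * expo E n x := by funext y; simp [fourierSum]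
  simpa [h] using norm_iteratedFDeriv_fourierSum_le E c {n} k x

lemma coef_fourierSeries {E : Mat} (hE : E.det ≠ 0) {c : (Fin 2 → ℤ) → ℂ}
    (hc : Summable fun n => ‖c n‖) (m : Fin 2 → ℤ) : coef E (fourierSeries E c) m = c m := by
  have := isProbabilityMeasure_cellMeasure hE
  have h1 : ∀ n, Integrable (fun x => c n * (conj (expo E m x) * expo E n x)) (cellMeasure E) :=
    fun n => (integrable_conj_expo_mul (((isPeriodic_expo hE n).memLp hE
      (contDiff_expo E n).continuous 1).integrable le_rfl)).const_mul _
  have h2 : ∀ n, ∫ x, c n * (conj (expo E m x) * expo E n x) ∂cellMeasure E =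
      if n = m then c n else 0 := by
    intro n
    rw [integral_const_mul]
    have := coef_expo hE n m
    rw [coef] at this
    rw [this]
    simp
  have h3 := integral_tsum_of_summable_integral_norm h1 (by
    simpa [norm_expo] using hc)
  simp only [h2, tsum_ite_eq] at h3
  rw [h3, coef]
  congr 1
  funext x
  rw [fourierSeries, ← tsum_mul_left]
  exact tsum_congr fun n => by ring

lemma coef_congr_ae {E : Mat} {f g : Plane → ℂ} (h : f =ᵐ[cellMeasure E] g) (n : Fin 2 → ℤ) :
    coef E f n = coef E g n :=
  integral_congr_ae (h.mono fun x hx => by simp only [hx])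

lemma ampSq_congr_ae {E : Mat} {u w : Plane → Plane} (h : u =ᵐ[cellMeasure E] w)
    (n : Fin 2 → ℤ) : ampSq E u n = ampSq E w n := by
  simp only [ampSq, rcoef]
  congr! 3 with i
  exact coef_congr_ae (h.mono fun x hx => by simp only [hx]) n

/-- Rapidly decreasing Fourier coefficients. -/
lemma exists_smooth_of_summable {E : Mat} (hE : E.det ≠ 0) {u : Plane → Plane}
    (hu : MemLp u 2 (cellMeasure E))
    (hs : ∀ k : ℕ, Summable fun n => ‖freq E n‖ ^ k * ∑ l, ‖vcoef E u l n‖) :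
    ∃ w : Plane → Plane, ContDiff ℝ ∞ w ∧ IsPeriodic E w ∧ u =ᵐ[cellMeasure E] w := by
  have hs' : ∀ l k, Summable fun n => ‖freq E n‖ ^ k * ‖vcoef E u l n‖ := fun l k =>
    Summable.of_nonneg_of_le (fun n => by positivity) (fun n => by
      gcongr
      exact Finset.single_le_sum (f := fun l => ‖vcoef E u l n‖) (fun _ _ => norm_nonneg _)
        (Finset.mem_univ l)) (hs k)
  have hg : ∀ l, ContDiff ℝ ∞ (fourierSeries E (vcoef E u l)) := fun l =>
    contDiff_fourierSeries (hs' l)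
  have hp : ∀ l, IsPeriodic E (fourierSeries E (vcoef E u l)) := fun l =>
    isPeriodic_fourierSeries hE _
  refine ⟨fun x => WithLp.toLp 2 fun l => (fourierSeries E (vcoef E u l) x).re,
    contDiff_euclidean.2 fun l => Complex.reCLM.contDiff.comp (hg l), fun m x => ?_, ?_⟩
  · simp only [hp _ m x]
  · have h1 : ∀ l, (fun x => (u x l : ℂ)) =ᵐ[cellMeasure E] fourierSeries E (vcoef E u l) :=
      fun l => ae_eq_of_coef_eq hE ((memLp_proj hu l).ofReal (K := ℂ))
        ((hp l).memLp hE (hg l).continuous 2) fun n => by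
          rw [coef_fourierSeries hE (by simpa using hs' l 0)]; rfl
    filter_upwards [ae_all_iff.2 h1] with x hx
    ext l
    simp [← hx l]

lemma derivL2Norm_sq {E : Mat} (hE : E.det ≠ 0) {w : Plane → Plane} (hw : ContDiff ℝ ∞ w)
    (hp : IsPeriodic E w) (k : ℕ) :
    derivL2Norm E k w = Real.sqrt (∑' n, ‖freq E n‖ ^ (2 * k) * ampSq E w n) := by
  rw [(hasSum_iteratedFDeriv hE hw hp k).tsum_eq, derivL2Norm, average_cell]
  rfl

lemma norm_iteratedFDeriv_le_cNorm {E : Mat} (hE : E.det ≠ 0) {Φ : Plane → ℝ}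
    (hΦ : ContDiff ℝ ∞ Φ) (hp : IsPeriodic E Φ) {j m : ℕ} (hj : j ≤ m) (x : Plane) :
    ‖iteratedFDeriv ℝ j Φ x‖ ≤ cNorm m Φ :=
  (norm_iteratedFDeriv_le_supDeriv hE (hΦ.of_le (by exact_mod_cast le_top)) hp x).trans
    (Finset.single_le_sum (f := fun j => supDeriv j Φ) (fun j _ => supDeriv_nonneg j Φ)
      (Finset.mem_range.2 (by omega)))

lemma cNorm_nonneg (m : ℕ) (Φ : Plane → ℝ) : 0 ≤ cNorm m Φ :=
  Finset.sum_nonneg fun j _ => supDeriv_nonneg j Φ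

lemma IsSolution.summable_vcoef {E : Mat} (hE : E.det ≠ 0) {lam mu : ℝ} (hl : 0 ≤ lam)
    (hm : 0 < mu) {Φ : Plane → ℝ} (hΦ : ContDiff ℝ ∞ Φ) (hp : IsPeriodic E Φ) {θ : ℝ}
    {u : Plane → Plane} {G : Plane → Mat} (h : IsSolution E lam mu Φ θ u G) (k : ℕ) :
    Summable fun n => ‖freq E n‖ ^ k * ∑ l, ‖vcoef E u l n‖ := by
  have h1 : ∀ k : ℕ, Summable fun n => ‖freq E n‖ ^ (k + 1) * ∑ l, ‖vcoef E u l n‖ := by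
    intro k
    -- Only finiteness matters here, so `q = 1` and any `τ` dominating both 1 and the load will do.
    obtain ⟨K, -, hK⟩ := IsSolution.regularityBound hE hm (cNorm_nonneg (k + 2) Φ) 1 (k + 1)
    have hr := hK lam Φ θ (max 1 (1 / (4 * Real.sin (θ / 2) ^ 2))) u G hl hΦ hp
      (fun j hj => norm_iteratedFDeriv_le_cNorm hE hΦ hp hj) (le_max_left _ _)
      (by rw [pow_one]; exact le_max_right _ _) h
    exact summable_of_sum_le (fun n => by positivity) (hr.wiener (k + 1) (by omega) le_rfl)
  rcases k with _ | k
  -- Order 0 follows from order 2: the zero mode vanishes and the other frequencies satisfy `gap E ≤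
  -- ‖ξ‖²`.
  · refine Summable.of_nonneg_of_le (fun n => by positivity) (fun n => ?_)
      ((h1 1).mul_left (gap E)⁻¹)
    rcases eq_or_ne n 0 with rfl | hn
    · have h0 : ∀ l, vcoef E u l 0 = 0 := fun l => h.1.rcoef_zero hE l
      simp [h0]
    · rw [pow_zero, ← mul_assoc]
      gcongr
      rw [inv_mul_eq_div, one_le_div (gap_pos hE)]
      exact gap_le hE hn
  · exact h1 k

/-- Solutions for a smooth potential are smooth. -/
lemma IsSolution.exists_smooth {E : Mat} (hE : E.det ≠ 0) {lam mu : ℝ} (hl : 0 ≤ lam)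
    (hm : 0 < mu) {Φ : Plane → ℝ} (hΦ : ContDiff ℝ ∞ Φ) (hp : IsPeriodic E Φ) {θ : ℝ}
    {u : Plane → Plane} {G : Plane → Mat} (h : IsSolution E lam mu Φ θ u G) :
    ∃ w : Plane → Plane, ContDiff ℝ ∞ w ∧ IsPeriodic E w ∧ u =ᵐ[volume] w ∧
      ∀ k, derivL2Norm E k w = Real.sqrt (∑' n, ‖freq E n‖ ^ (2 * k) * ampSq E u n) := by
  obtain ⟨w, hw, hwp, huw⟩ := exists_smooth_of_summable hE (h.1.memLp_cell hE)
    (h.summable_vcoef hE hl hm hΦ hp)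
  refine ⟨w, hw, hwp, h.1.periodic.ae_eq_of_cellMeasure hE hwp huw, fun k => ?_⟩
  simp only [derivL2Norm_sq hE hw hwp, ampSq_congr_ae huw]

lemma exists_regularity_constant {E : Mat} (hE : E.det ≠ 0) (k : ℕ) (hk : 2 ≤ k) {mu M : ℝ}
    (hm : 0 < mu) (hM : 0 ≤ M) : ∃ K, ∀ (lam : ℝ) (Φ : Plane → ℝ) (θ : ℝ) (u : Plane → Plane)
      (G : Plane → Mat), 0 ≤ lam → ContDiff ℝ ∞ Φ → IsPeriodic E Φ → Real.sin (θ / 2) ≠ 0 →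
      cNorm (k + 1) Φ = M → IsSolution E lam mu Φ θ u G →
      Real.sqrt (∑' n, ‖freq E n‖ ^ (2 * k) * ampSq E u n) ≤ K / Real.sin (θ / 2) ^ (2 * k) := by
  obtain ⟨j, rfl⟩ := Nat.exists_eq_add_of_le' hk
  -- For order `k = j + 2` the bound is a multiple of `τ^((j+1) + (j+2) j)`. With `q = j + 1` and
  -- `τ^q = 1 / sin²(θ/2)` the target is `τ^((j+1)(j+2))`, larger by one factor `τ`.
  obtain ⟨K, hK1, hK⟩ := IsSolution.regularityBound hE hm hM (j + 1) j
  refine ⟨K, fun lam Φ θ u G hl hΦ hp hs hc h => ?_⟩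
  set s := 1 / Real.sin (θ / 2) ^ 2 with hsd
  have hpos : 0 < Real.sin (θ / 2) ^ 2 := by positivity
  have hs1 : 1 ≤ s := (one_le_div hpos).2 (Real.sin_sq_le_one _)
  set τ := s ^ (((j + 1 : ℕ) : ℝ)⁻¹)
  have hτs : τ ^ (j + 1) = s := Real.rpow_inv_natCast_pow (by linarith) (by omega)
  have hτ1 : 1 ≤ τ := Real.one_le_rpow hs1 (by positivity)
  have hr := hK lam Φ θ τ u G hl hΦ hp (fun i hi x => (norm_iteratedFDeriv_le_cNorm hE hΦ hp
    (by omega) x).trans_eq hc) hτ1 (by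
      rw [hτs, hsd]
      exact one_div_le_one_div_of_le hpos (by linarith)) h
  refine Real.sqrt_le_iff.2 ⟨div_nonneg (by linarith) ((even_two_mul _).pow_nonneg _),
    hr.bound_two.trans ?_⟩
  have h1 : K / Real.sin (θ / 2) ^ (2 * (j + 2)) = K * s ^ (j + 2) := by
    rw [hsd, div_pow, one_pow, ← pow_mul]; ring
  rw [h1, ← hτs]
  gcongr
  rw [← pow_mul, ← pow_add, ← pow_mul]
  exact pow_le_pow_right₀ hτ1 (by nlinarith)

lemma exists_regularity_constants {E : Mat} (hE : E.det ≠ 0) : ∃ C : ℕ → ℝ → ℝ → ℝ,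
    ∀ (lam mu : ℝ) (Φ : Plane → ℝ) (θ : ℝ) (u : Plane → Plane) (G : Plane → Mat), 0 ≤ lam →
      0 < mu → ContDiff ℝ ∞ Φ → IsPeriodic E Φ → Real.sin (θ / 2) ≠ 0 →
      IsSolution E lam mu Φ θ u G → ∃ w : Plane → Plane, ContDiff ℝ ∞ w ∧ IsPeriodic E w ∧
        u =ᵐ[volume] w ∧ ∀ k, 2 ≤ k → derivL2Norm E k w ≤
          C k mu (cNorm (k + 1) Φ) / Real.sin (θ / 2) ^ (2 * k) := by
  choose C hC using @exists_regularity_constant E hE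
  classical
  -- The value 0 outside the admissible range only makes the constant a total function.
  refine ⟨fun k mu M => if h : 2 ≤ k ∧ 0 < mu ∧ 0 ≤ M then C k h.1 h.2.1 h.2.2 else 0, ?_⟩
  intro lam mu Φ θ u G hl hm hΦ hp hs h
  obtain ⟨w, hw, hwp, huw, hd⟩ := h.exists_smooth hE hl hm hΦ hp
  refine ⟨w, hw, hwp, huw, fun k hk => ?_⟩
  have hcond : 2 ≤ k ∧ 0 < mu ∧ 0 ≤ cNorm (k + 1) Φ := ⟨hk, hm, cNorm_nonneg _ _⟩
  simp only [hd, dif_pos hcond]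
  exact hC k hk hm hcond.2.2 lam Φ θ u G hl hΦ hp hs rfl h

/-! ### Existence of a minimizer and the Euler–Lagrange equation. -/

lemma coef_conj (E : Mat) (f : Plane → ℂ) (n : Fin 2 → ℤ) :
    coef E (fun x => conj (f x)) n = conj (coef E f (-n)) := by
  rw [coef, coef, ← integral_conj]
  simp [← conj_expo]

/-- The Riesz–Fischer theorem for real functions. -/
lemma exists_of_rcoef {E : Mat} (hE : E.det ≠ 0) {c : (Fin 2 → ℤ) → ℂ}
    (hc : Summable fun n => ‖c n‖ ^ 2) (hs : ∀ n, c (-n) = conj (c n)) :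
    ∃ g : Plane → ℝ, IsPeriodic E g ∧ MemLp g 2 (cellMeasure E) ∧ rcoef E g = c := by
  obtain ⟨f, hp, hf, hfc⟩ := exists_of_coef hE hc
  have hre : MemLp (fun x => (f x).re) 2 (cellMeasure E) := Complex.reCLM.comp_memLp' hf
  have hconj : MemLp (fun x => conj (f x)) 2 (cellMeasure E) :=
    (Complex.conjCLE : ℂ →L[ℝ] ℂ).comp_memLp' hf
  -- Hermitian symmetry of the coefficients forces `f` to be real almost everywhere.
  have h1 : f =ᵐ[cellMeasure E] fun x => conj (f x) :=
    ae_eq_of_coef_eq hE hf hconj fun n => by rw [coef_conj, hfc, hfc, hs, Complex.conj_conj]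
  refine ⟨fun x => (f x).re, hp.comp _, hre, funext fun n => ?_⟩
  rw [rcoef, ← hfc n]
  exact coef_congr_ae (h1.mono fun x hx => Complex.conj_eq_iff_re.1 hx.symm) n

/-- The coefficient fields of real mean-zero displacements with Dirichlet energy at most `M`. -/
def coefSet (E : Mat) (M : ℝ) : Set (Fin 2 → (Fin 2 → ℤ) → ℂ) :=
  {c | (∀ l n, c l (-n) = conj (c l n)) ∧ (∀ l, c l 0 = 0) ∧
    ∑' n, ENNReal.ofReal (‖freq E n‖ ^ 2 * ∑ l, ‖c l n‖ ^ 2) ≤ ENNReal.ofReal M}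

lemma coefSet_hasSum {E : Mat} {M : ℝ} (hM : 0 ≤ M) {c : Fin 2 → (Fin 2 → ℤ) → ℂ}
    (hc : c ∈ coefSet E M) :
    Summable (fun n => ‖freq E n‖ ^ 2 * ∑ l, ‖c l n‖ ^ 2) ∧
      ∑' n, ‖freq E n‖ ^ 2 * ∑ l, ‖c l n‖ ^ 2 ≤ M := by
  have h1 : ∀ n, 0 ≤ ‖freq E n‖ ^ 2 * ∑ l, ‖c l n‖ ^ 2 := fun n => by positivity
  have h2 : Summable fun n => ‖freq E n‖ ^ 2 * ∑ l, ‖c l n‖ ^ 2 := by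
    -- The energy in `coefSet` is a sum of extended nonnegative reals, so its finiteness includes
    -- summability.
    have h3 := ENNReal.summable_toReal (hc.2.2.trans_lt ENNReal.ofReal_lt_top).ne
    exact h3.congr fun n => ENNReal.toReal_ofReal (h1 n)
  refine ⟨h2, ?_⟩
  rw [← ENNReal.ofReal_le_ofReal_iff hM, ENNReal.ofReal_tsum_of_nonneg h1 h2]
  exact hc.2.2

lemma mem_coefSet {E : Mat} (hE : E.det ≠ 0) {u : Plane → Plane} {G : Plane → Mat}
    (h : MemSobolev E u G) {M : ℝ} (hM : ∫ x, ∑ i, ∑ j, G x i j ^ 2 ∂cellMeasure E ≤ M) :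
    vcoef E u ∈ coefSet E M := by
  refine ⟨fun l n => rcoef_neg E _ n, fun l => h.rcoef_zero hE l, ?_⟩
  have h1 := h.hasSum_grad hE
  have h2 : ∀ n, 0 ≤ ‖freq E n‖ ^ 2 * ampSq E u n := fun n =>
    mul_nonneg (by positivity) (ampSq_nonneg _ _ _)
  change ∑' n, ENNReal.ofReal (‖freq E n‖ ^ 2 * ampSq E u n) ≤ _
  rw [← ENNReal.ofReal_tsum_of_nonneg h2 h1.summable, h1.tsum_eq]
  exact ENNReal.ofReal_le_ofReal hM

lemma exists_memSobolev {E : Mat} (hE : E.det ≠ 0) {M : ℝ} (hM : 0 ≤ M)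
    {c : Fin 2 → (Fin 2 → ℤ) → ℂ} (hc : c ∈ coefSet E M) :
    ∃ u G, MemSobolev E u G ∧ vcoef E u = c := by
  have h1 := (coefSet_hasSum hM hc).1
  have h2 : ∀ l j, Summable fun n => ‖I * (freq E n j : ℝ) * c l n‖ ^ 2 := fun l j =>
    Summable.of_nonneg_of_le (fun n => by positivity) (fun n => by
      rw [norm_mul, norm_mul, Complex.norm_I, one_mul, Complex.norm_real, mul_pow]
      exact mul_le_mul (pow_le_pow_left₀ (norm_nonneg _) (PiLp.norm_apply_le _ j) 2)
        (Finset.single_le_sum (f := fun l => ‖c l n‖ ^ 2) (fun _ _ => by positivity)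
          (Finset.mem_univ l)) (by positivity) (by positivity)) h1
  have h3 : ∀ l, Summable fun n => ‖c l n‖ ^ 2 := fun l =>
    Summable.of_nonneg_of_le (fun n => by positivity) (fun n => by
      rcases eq_or_ne n 0 with rfl | hn
      · rw [hc.2.1 l]
        have : 0 ≤ (gap E)⁻¹ := (inv_pos.2 (gap_pos hE)).le
        simp only [norm_zero, ne_eq, OfNat.ofNat_ne_zero, not_false_eq_true, zero_pow]
        positivity
      · have h4 := gap_le hE hn
        rw [inv_mul_eq_div, le_div_iff₀ (gap_pos hE), mul_comm]
        exact mul_le_mul h4 (Finset.single_le_sum (f := fun l => ‖c l n‖ ^ 2)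
          (fun _ _ => by positivity) (Finset.mem_univ l)) (by positivity) (by positivity))
      (h1.mul_left (gap E)⁻¹)
  choose u hup hu huc using fun l => exists_of_rcoef hE (h3 l) (hc.1 l)
  choose G hGp hG hGc using fun l j => exists_of_rcoef hE (h2 l j) fun n => by
    rw [hc.1 l n, freq_neg]
    simp
  refine ⟨fun x => WithLp.toLp 2 fun l => u l x, fun x l j => G l j x,
    memSobolev_of_rcoef hE (fun m x => ?_) (fun m x => ?_) (memLp_of_proj hu) hG (fun l => ?_)
      fun l j n => ?_, ?_⟩
  · simp only [hup _ m x]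
  · ext l j
    exact hGp l j m x
  · exact (congrFun (huc l) 0).trans (hc.2.1 l)
  · rw [show rcoef E (fun x => G l j x) n = _ from congrFun (hGc l j) n]
    exact congrArg _ (congrFun (huc l) n).symm
  · exact funext huc

/-- Tychonoff: the energy bound confines each coefficient to a disc, and the set is closed since an
energy with continuous nonnegative terms is lower semicontinuous. This plays the role of weak
compactness. -/
lemma isCompact_coefSet {E : Mat} (hE : E.det ≠ 0) {M : ℝ} (hM : 0 ≤ M) :
    IsCompact (coefSet E M) := by
  have h1 : IsCompact {c : Fin 2 → (Fin 2 → ℤ) → ℂ |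
      ∀ l, c l ∈ {b : (Fin 2 → ℤ) → ℂ |
        ∀ n, b n ∈ Metric.closedBall 0 (Real.sqrt M / ‖freq E n‖)}} :=
    isCompact_pi_infinite fun _ => isCompact_pi_infinite fun _ => isCompact_closedBall _ _
  refine h1.of_isClosed_subset ?_ fun c hc l n => ?_
  · have h2 : LowerSemicontinuous fun c : Fin 2 → (Fin 2 → ℤ) → ℂ =>
        ∑' n, ENNReal.ofReal (‖freq E n‖ ^ 2 * ∑ l, ‖c l n‖ ^ 2) :=
      lowerSemicontinuous_tsum fun n =>
        (ENNReal.continuous_ofReal.comp (by fun_prop)).lowerSemicontinuous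
    have h3 : IsClosed {c : Fin 2 → (Fin 2 → ℤ) → ℂ | ∀ l n, c l (-n) = conj (c l n)} := by
      simp only [Set.ofPred_forall]
      exact isClosed_iInter fun l => isClosed_iInter fun n =>
        isClosed_eq (by fun_prop) (Complex.continuous_conj.comp (by fun_prop))
    have h4 : IsClosed {c : Fin 2 → (Fin 2 → ℤ) → ℂ | ∀ l, c l 0 = 0} := by
      simp only [Set.ofPred_forall]
      exact isClosed_iInter fun l => isClosed_eq (by fun_prop) (by fun_prop)
    exact h3.inter (h4.inter (h2.isClosed_preimage _))
  · rw [mem_closedBall_zero_iff]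
    rcases eq_or_ne (freq E n) 0 with h0 | h0
    -- At the zero frequency the radius is a division by zero, hence 0, which agrees with the
    -- mean-zero condition.
    · rw [(freq_eq_zero_iff hE).1 h0, hc.2.1 l, norm_zero]
      positivity
    · rw [le_div_iff₀ (norm_pos_iff.2 h0)]
      obtain ⟨h2, h3⟩ := coefSet_hasSum hM hc
      refine Real.le_sqrt_of_sq_le (le_trans ?_ ((h2.le_tsum n fun _ _ => by positivity).trans h3))
      rw [mul_pow, mul_comm]
      gcongr
      exact Finset.single_le_sum (f := fun l => ‖c l n‖ ^ 2) (fun _ _ => by positivity)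
          (Finset.mem_univ l)

/-- The misfit energy density, whose negative gradient in `v` is the misfit force. -/
def misfitEnergy (Φ : Plane → ℝ) (θ : ℝ) (x v : Plane) : ℝ :=
  1 / 2 * Φ (x - act (rot ((Real.pi - θ) / 2)) v) +
    1 / 2 * Φ (x - act (rot ((Real.pi + θ) / 2)) v)

lemma abs_sub_le_supGrad {E : Mat} (hE : E.det ≠ 0) {Φ : Plane → ℝ} (h : ContDiff ℝ 1 Φ)
    (hp : IsPeriodic E Φ) (x y : Plane) : |Φ x - Φ y| ≤ supGrad Φ * ‖x - y‖ := by
  refine Convex.norm_image_sub_le_of_norm_fderiv_le (𝕜 := ℝ) (s := Set.univ)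
    (fun z _ => h.differentiable (by norm_num) z) (fun z _ => ?_) convex_univ
    (Set.mem_univ _) (Set.mem_univ _)
  have h1 := norm_gradient_le hE h hp z
  rwa [gradient_eq, LinearIsometryEquiv.norm_map] at h1

lemma abs_misfitEnergy_sub_le {E : Mat} (hE : E.det ≠ 0) {Φ : Plane → ℝ} (h : ContDiff ℝ 1 Φ)
    (hp : IsPeriodic E Φ) (θ : ℝ) (x v w : Plane) :
    |misfitEnergy Φ θ x v - misfitEnergy Φ θ x w| ≤ supGrad Φ * ‖v - w‖ := by
  have h1 : ∀ t, |Φ (x - act (rot t) v) - Φ (x - act (rot t) w)| ≤ supGrad Φ * ‖v - w‖ := by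
    intro t
    refine (abs_sub_le_supGrad hE h hp _ _).trans_eq ?_
    rw [sub_sub_sub_cancel_left, act_sub, norm_act_rot, norm_sub_rev]
  have h2 := abs_le.1 (h1 ((Real.pi - θ) / 2))
  have h3 := abs_le.1 (h1 ((Real.pi + θ) / 2))
  simp only [misfitEnergy]
  rw [abs_le]
  constructor <;> linarith [h2.1, h2.2, h3.1, h3.2]

lemma abs_misfitEnergy_le {Φ : Plane → ℝ} {B : ℝ} (hB : ∀ x, ‖Φ x‖ ≤ B) (θ : ℝ) (x v : Plane) :
    |misfitEnergy Φ θ x v| ≤ B := by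
  have h1 := abs_le.1 (hB (x - act (rot ((Real.pi - θ) / 2)) v))
  have h2 := abs_le.1 (hB (x - act (rot ((Real.pi + θ) / 2)) v))
  simp only [misfitEnergy]
  rw [abs_le]
  constructor <;> linarith [h1.1, h1.2, h2.1, h2.2]

lemma continuous_misfitEnergy {Φ : Plane → ℝ} (h : Continuous Φ) (θ : ℝ) :
    Continuous fun p : Plane × Plane => misfitEnergy Φ θ p.1 p.2 := by
  have h3 : ∀ t, Continuous fun p : Plane × Plane => Φ (p.1 - act (rot t) p.2) := fun t =>
    h.comp (continuous_fst.sub ((continuous_act _).comp continuous_snd))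
  exact ((h3 _).const_mul _).add ((h3 _).const_mul _)

lemma integrable_misfitEnergy {E : Mat} (hE : E.det ≠ 0) {Φ : Plane → ℝ} (h : Continuous Φ)
    (hp : IsPeriodic E Φ) (θ : ℝ) {u : Plane → Plane}
    (hu : AEStronglyMeasurable u (cellMeasure E)) :
    Integrable (fun x => misfitEnergy Φ θ x ((2 : ℝ) • u x)) (cellMeasure E) := by
  have := isProbabilityMeasure_cellMeasure hE
  obtain ⟨B, hB⟩ := hp.exists_bound hE h
  have h1 : AEStronglyMeasurable (fun x : Plane => x) (cellMeasure E) :=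
    continuous_id.aestronglyMeasurable
  exact Integrable.of_bound ((continuous_misfitEnergy h θ).comp_aestronglyMeasurable
    (h1.prodMk (hu.const_smul (2 : ℝ)))) B
    (Filter.Eventually.of_forall fun x => abs_misfitEnergy_le hB θ x _)

/-- The factor 2 comes from evaluating at twice the displacement; it cancels against the 2 from
differentiating the quadratic elastic energy, so that energy carries no factor one half. -/
lemma hasDerivAt_misfitEnergy {Φ : Plane → ℝ} (h : ContDiff ℝ 1 Φ) (θ : ℝ) (x a b : Plane)
    (t : ℝ) : HasDerivAt (fun s : ℝ => misfitEnergy Φ θ x ((2 : ℝ) • (a + s • b)))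
      (-(2 * (inner ℝ (misfitForce Φ θ x ((2 : ℝ) • (a + t • b))) b : ℝ))) t := by
  have h1 : ∀ r, HasDerivAt (fun s : ℝ => Φ (x - act (rot r) ((2 : ℝ) • (a + s • b))))
      (-(2 * (inner ℝ (act (rot r)ᵀ (gradient Φ (x - act (rot r) ((2 : ℝ) • (a + t • b))))) b : ℝ)))
      t := by
    intro r
    have h2 : HasDerivAt (fun s : ℝ => x - act (rot r) ((2 : ℝ) • (a + s • b)))
        (-act (rot r) ((2 : ℝ) • b)) t := by
      have h3 : HasDerivAt (fun s : ℝ => (2 : ℝ) • (a + s • b)) ((2 : ℝ) • b) t := by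
        exact ((((hasDerivAt_id t).smul_const b).const_add a).const_smul (2 : ℝ)).congr_deriv
          (by simp)
      exact ((actL (rot r)).hasFDerivAt.comp_hasDerivAt t h3).const_sub x
    have h4 : HasFDerivAt Φ (fderiv ℝ Φ (x - act (rot r) ((2 : ℝ) • (a + t • b)))) _ :=
      (h.differentiable (by norm_num) _).hasFDerivAt
    have h5 := h4.comp_hasDerivAt t h2
    refine HasDerivAt.congr_deriv h5 ?_
    have h6 : act (rot r) ((2 : ℝ) • b) = (2 : ℝ) • act (rot r) b := (actL (rot r)).map_smul 2 b
    rw [inner_act_transpose, gradient_eq, map_neg, h6, map_smul,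
      InnerProductSpace.toDual_symm_apply, smul_eq_mul]
  have h6 := ((h1 ((Real.pi - θ) / 2)).const_mul (1 / 2)).add
    ((h1 ((Real.pi + θ) / 2)).const_mul (1 / 2))
  refine HasDerivAt.congr_deriv h6 ?_
  simp only [misfitForce, inner_add_left, real_inner_smul_left]
  ring

lemma hasDerivAt_integral_misfitEnergy {E : Mat} (hE : E.det ≠ 0) {Φ : Plane → ℝ}
    (h : ContDiff ℝ 1 Φ) (hp : IsPeriodic E Φ) (θ : ℝ) {u v : Plane → Plane}
    (hu : MemLp u 2 (cellMeasure E)) (hv : MemLp v 2 (cellMeasure E)) :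
    HasDerivAt (fun s : ℝ => ∫ x, misfitEnergy Φ θ x ((2 : ℝ) • (u x + s • v x)) ∂cellMeasure E)
      (∫ x, -(2 * (inner ℝ (misfitForce Φ θ x ((2 : ℝ) • u x)) (v x) : ℝ)) ∂cellMeasure E) 0 := by
  have := isProbabilityMeasure_cellMeasure hE
  have hm : ∀ s : ℝ, AEStronglyMeasurable (fun x => u x + s • v x) (cellMeasure E) := fun s =>
    (hu.add (hv.const_smul s)).1
  have h0 := (integrable_inner_misfitForce hE h hp θ hu.1 hv).const_mul 2
  have key := hasDerivAt_integral_of_dominated_loc_of_deriv_le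
    (F := fun s x => misfitEnergy Φ θ x ((2 : ℝ) • (u x + s • v x)))
    (F' := fun s x => -(2 * (inner ℝ (misfitForce Φ θ x ((2 : ℝ) • (u x + s • v x))) (v x) : ℝ)))
    (bound := fun x => 2 * (supGrad Φ * ‖v x‖)) (x₀ := (0 : ℝ)) (s := Set.univ)
    (μ := cellMeasure E) Filter.univ_mem
    (Filter.Eventually.of_forall fun s => (integrable_misfitEnergy hE h.continuous hp θ (hm s)).1)
    (integrable_misfitEnergy hE h.continuous hp θ (hm 0))
    (by simpa only [zero_smul, add_zero] using! h0.neg.1)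
    (Filter.Eventually.of_forall fun x s _ => by
      rw [norm_neg, norm_mul, Real.norm_ofNat]
      gcongr
      exact (norm_inner_le_norm _ _).trans
        (mul_le_mul_of_nonneg_right (norm_misfitForce_le hE h hp θ x _) (norm_nonneg _)))
    (((hv.integrable (by norm_num)).norm.const_mul _).const_mul _)
    (Filter.Eventually.of_forall fun x s _ => hasDerivAt_misfitEnergy h θ x (u x) (v x) s)
  simpa using key.2

lemma integral_elastic_add_smul {E : Mat} (hE : E.det ≠ 0) {u v : Plane → Plane}
    {G H : Plane → Mat} (hu : MemSobolev E u G) (hv : MemSobolev E v H) (lam mu t : ℝ) :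
    ∫ x, elasticPairing lam mu (G x + t • H x) (G x + t • H x) ∂cellMeasure E =
      ∫ x, elasticPairing lam mu (G x) (G x) ∂cellMeasure E +
        t * (2 * ∫ x, elasticPairing lam mu (G x) (H x) ∂cellMeasure E) +
        t ^ 2 * ∫ x, elasticPairing lam mu (H x) (H x) ∂cellMeasure E := by
  have h1 : ∀ x, elasticPairing lam mu (G x + t • H x) (G x + t • H x) =
      elasticPairing lam mu (G x) (G x) + (2 * t) * elasticPairing lam mu (G x) (H x) +
        t ^ 2 * elasticPairing lam mu (H x) (H x) := by
    intro x
    rw [elasticPairing_add_smul_left, elasticPairing_comm lam mu (G x),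
      elasticPairing_comm lam mu (H x), elasticPairing_add_smul_left, elasticPairing_add_smul_left,
      elasticPairing_comm lam mu (H x) (G x)]
    ring
  have i1 := hu.integrable_elastic hE hu lam mu
  have i2 := (hu.integrable_elastic hE hv lam mu).const_mul (2 * t)
  have i3 := (hv.integrable_elastic hE hv lam mu).const_mul (t ^ 2)
  have i4 : Integrable (fun x => elasticPairing lam mu (G x) (G x) +
    (2 * t) * elasticPairing lam mu (G x) (H x)) (cellMeasure E) := i1.add i2
  simp only [h1]
  rw [integral_add i4 i3, integral_add i1 i2, integral_const_mul, integral_const_mul]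
  ring

/-- Minimizers of the total energy solve the Euler–Lagrange equation. -/
lemma isSolution_of_minimizer {E : Mat} (hE : E.det ≠ 0) {lam mu : ℝ} {Φ : Plane → ℝ}
    (hΦ : ContDiff ℝ 1 Φ) (hp : IsPeriodic E Φ) {θ : ℝ} {u : Plane → Plane} {G : Plane → Mat}
    (hu : MemSobolev E u G) (hmin : ∀ v H, MemSobolev E v H →
      ∫ x, elasticPairing lam mu (G x) (G x) ∂cellMeasure E + 1 / (4 * Real.sin (θ / 2) ^ 2) *
          ∫ x, misfitEnergy Φ θ x ((2 : ℝ) • u x) ∂cellMeasure E ≤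
        ∫ x, elasticPairing lam mu (H x) (H x) ∂cellMeasure E + 1 / (4 * Real.sin (θ / 2) ^ 2) *
          ∫ x, misfitEnergy Φ θ x ((2 : ℝ) • v x) ∂cellMeasure E) :
    IsSolution E lam mu Φ θ u G := by
  refine ⟨hu, fun v H hv => ?_⟩
  rw [average_cell, average_cell]
  set c := 1 / (4 * Real.sin (θ / 2) ^ 2)
  have h1 := hasDerivAt_integral_misfitEnergy hE hΦ hp θ (hu.memLp_cell hE) (hv.memLp_cell hE)
  set q0 := ∫ x, elasticPairing lam mu (G x) (G x) ∂cellMeasure E with hq0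
  set q1 := ∫ x, elasticPairing lam mu (G x) (H x) ∂cellMeasure E
  set q2 := ∫ x, elasticPairing lam mu (H x) (H x) ∂cellMeasure E
  have h2 : HasDerivAt (fun t : ℝ => q0 + t * (2 * q1) + t ^ 2 * q2) (2 * q1) 0 := by
    have h3 := (((hasDerivAt_id (0 : ℝ)).mul_const (2 * q1)).const_add q0).add
      (((hasDerivAt_id (0 : ℝ)).pow 2).mul_const q2)
    exact h3.congr_deriv (by simp)
  have h3 := h2.add (h1.const_mul c)
  have h4 : IsLocalMin ((fun t : ℝ => q0 + t * (2 * q1) + t ^ 2 * q2) + fun t : ℝ =>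
      c * ∫ x, misfitEnergy Φ θ x ((2 : ℝ) • (u x + t • v x)) ∂cellMeasure E) 0 := by
    refine Filter.Eventually.of_forall fun t => ?_
    have h5 := hmin _ _ (hu.add_smul hE hv t)
    rw [integral_elastic_add_smul hE hu hv] at h5
    simpa using h5
  have h5 := h4.hasDerivAt_eq_zero h3
  rw [integral_neg, integral_const_mul] at h5
  linarith

/-- The elastic energy of a Fourier mode. -/
def modeEnergy (E : Mat) (lam mu : ℝ) (c : Fin 2 → (Fin 2 → ℤ) → ℂ) (n : Fin 2 → ℤ) : ℝ :=
  (lam + mu) * ‖∑ i, I * (freq E n i : ℝ) * c i n‖ ^ 2 +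
    mu * (‖freq E n‖ ^ 2 * ∑ i, ‖c i n‖ ^ 2)

lemma modeEnergy_nonneg (E : Mat) {lam mu : ℝ} (hl : 0 ≤ lam) (hm : 0 ≤ mu)
    (c : Fin 2 → (Fin 2 → ℤ) → ℂ) (n : Fin 2 → ℤ) : 0 ≤ modeEnergy E lam mu c n := by
  unfold modeEnergy; positivity

/-- Korn's identity makes the elastic energy a sum of nonnegative continuous functions of the
individual coefficients, which gives lower semicontinuity under coefficientwise convergence. -/
lemma MemSobolev.hasSum_modeEnergy {E : Mat} (hE : E.det ≠ 0) {u : Plane → Plane}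
    {G : Plane → Mat} (h : MemSobolev E u G) (lam mu : ℝ) :
    HasSum (modeEnergy E lam mu (vcoef E u))
      (∫ x, elasticPairing lam mu (G x) (G x) ∂cellMeasure E) := by
  have hG := h.memLp_grad_cell hE
  have htr : MemLp (fun x => G x 0 0 + 1 * G x 1 1) 2 (cellMeasure E) :=
    (hG 0 0).add ((hG 1 1).const_mul 1)
  have h1 := parseval_real_sq hE htr
  have h0 := rcoef_add_smul hE (hG 0 0) (hG 1 1) 1
  simp only [h.rcoef_grad hE] at h0
  simp only [h0] at h1
  simp only [Complex.ofReal_one, one_mul] at h1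
  have h2 := (h1.mul_left (lam + mu)).add ((h.hasSum_grad hE).mul_left mu)
  have i1 : Integrable (fun x => (lam + mu) * (G x 0 0 + G x 1 1) ^ 2) (cellMeasure E) := by
    simpa using htr.integrable_sq.const_mul (lam + mu)
  have i2 : Integrable (fun x => mu * ∑ i, ∑ j, G x i j ^ 2) (cellMeasure E) :=
    (integrable_finsetSum _ fun i _ => integrable_finsetSum _ fun j _ =>
      (hG i j).integrable_sq).const_mul mu
  rw [h.integral_elastic hE h]
  simp only [← sq, Matrix.trace_fin_two]
  rw [integral_add i1 i2, integral_const_mul, integral_const_mul]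
  refine h2.congr_fun fun n => ?_
  simp [modeEnergy, ampSq, vcoef, Fin.sum_univ_two]

lemma exists_finset_freq {E : Mat} (hE : E.det ≠ 0) (R : ℝ) :
    ∃ T : Finset (Fin 2 → ℤ), ∀ n ∉ T, R ≤ ‖freq E n‖ ^ 2 := by
  obtain ⟨b, hb, h⟩ := exists_norm_le_freq hE
  have hf : (Metric.closedBall (0 : Fin 2 → ℤ) (Real.sqrt R / b)).Finite :=
    (isCompact_closedBall _ _).finite_of_discrete
  refine ⟨hf.toFinset, fun n hn => ?_⟩
  rw [Set.Finite.mem_toFinset, mem_closedBall_zero_iff, not_le, div_lt_iff₀ hb] at hn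
  exact (Real.lt_sq_of_sqrt_lt (hn.trans_le ((mul_comm _ _).trans_le (h n)))).le

/-- Low frequencies and the Dirichlet energy control the `L²` distance. -/
lemma integral_norm_sub_sq_le {E : Mat} (hE : E.det ≠ 0) {M δ : ℝ} (hδ : 0 < δ)
    {T : Finset (Fin 2 → ℤ)} (hT : ∀ n ∉ T, δ⁻¹ ≤ ‖freq E n‖ ^ 2) {u v : Plane → Plane}
    {G H : Plane → Mat} (hu : MemSobolev E u G) (hv : MemSobolev E v H)
    (hM : 0 ≤ M) (huM : vcoef E u ∈ coefSet E M) (hvM : vcoef E v ∈ coefSet E M) :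
    ∫ x, ‖u x - v x‖ ^ 2 ∂cellMeasure E ≤
      ∑ n ∈ T, ∑ l, ‖vcoef E u l n - vcoef E v l n‖ ^ 2 + δ * (4 * M) := by
  have hw := hu.add_smul hE hv (-1)
  obtain ⟨s1, b1⟩ := coefSet_hasSum hM huM
  obtain ⟨s2, b2⟩ := coefSet_hasSum hM hvM
  set d : (Fin 2 → ℤ) → ℝ := fun n => ∑ l, ‖vcoef E u l n - vcoef E v l n‖ ^ 2 with hd
  have hc : ampSq E (fun x => u x + (-1 : ℝ) • v x) = d := by
    funext n
    simp only [ampSq, hd, vcoef]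
    congr! 3 with l
    have := rcoef_add_smul hE (memLp_proj (hu.memLp_cell hE) l) (memLp_proj (hv.memLp_cell hE) l)
      (-1) n
    simpa [sub_eq_add_neg] using this
  have h1 := hasSum_ampSq hE (hw.memLp_cell hE)
  have h2 := hw.hasSum_grad hE
  rw [hc] at h1 h2
  have hd0 : ∀ n, 0 ≤ d n := fun n => by positivity
  -- From `‖a - b‖² ≤ 2 ‖a‖² + 2 ‖b‖²`, each of the two energies being at most `M`.
  have h3 : ∑' n, ‖freq E n‖ ^ 2 * d n ≤ 4 * M := by
    have h4 : ∀ n, ‖freq E n‖ ^ 2 * d n ≤ 2 * (‖freq E n‖ ^ 2 * ∑ l, ‖vcoef E u l n‖ ^ 2) +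
        2 * (‖freq E n‖ ^ 2 * ∑ l, ‖vcoef E v l n‖ ^ 2) := by
      intro n
      have h5 : d n ≤ 2 * ∑ l, ‖vcoef E u l n‖ ^ 2 + 2 * ∑ l, ‖vcoef E v l n‖ ^ 2 := by
        simp only [hd, Finset.mul_sum, ← Finset.sum_add_distrib]
        refine Finset.sum_le_sum fun l _ => ?_
        have h6 := pow_le_pow_left₀ (norm_nonneg _) (norm_sub_le (vcoef E u l n) (vcoef E v l n)) 2
        nlinarith [sq_nonneg (‖vcoef E u l n‖ - ‖vcoef E v l n‖)]
      have := mul_le_mul_of_nonneg_left h5 (sq_nonneg ‖freq E n‖)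
      linarith
    refine (h2.summable.tsum_le_tsum h4 ((s1.mul_left 2).add (s2.mul_left 2))).trans ?_
    rw [(s1.mul_left 2).tsum_add (s2.mul_left 2), tsum_mul_left, tsum_mul_left]
    linarith
  have h4 : HasSum (fun n => if n ∈ T then d n else 0) (∑ n ∈ T, d n) := by
    have := hasSum_sum_of_ne_finset_zero (L := .unconditional _) (s := T)
      (f := fun n => if n ∈ T then d n else 0) fun n hn => if_neg hn
    rwa [Finset.sum_congr rfl fun n hn => if_pos hn] at this
  -- Frequencies in `T` are counted in full; outside `T` one has `1 ≤ δ ‖ξ‖²`, so the energy takes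
  -- over.
  have h5 := hasSum_le (fun n => ?_) h1 (h4.add (h2.summable.hasSum.mul_left δ))
  · simp only [neg_smul, one_smul, ← sub_eq_add_neg] at h5
    refine h5.trans ?_
    gcongr
  · have h6 := hd0 n
    split_ifs with hn
    · have : 0 ≤ δ * (‖freq E n‖ ^ 2 * d n) := by positivity
      linarith
    · have h7 := hT n hn
      rw [inv_le_iff_one_le_mul₀ hδ] at h7
      rw [zero_add, ← mul_assoc, mul_comm δ]
      exact le_mul_of_one_le_left h6 h7

/-- The misfit energy is weakly continuous on bounded sets. -/
lemma continuous_integral_misfitEnergy {E : Mat} (hE : E.det ≠ 0) {Φ : Plane → ℝ}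
    (hΦ : ContDiff ℝ 1 Φ) (hp : IsPeriodic E Φ) (θ : ℝ) {M : ℝ} (hM : 0 ≤ M)
    {U : coefSet E M → Plane → Plane} {G : coefSet E M → Plane → Mat}
    (hU : ∀ c, MemSobolev E (U c) (G c)) (hUc : ∀ c, vcoef E (U c) = c) :
    Continuous fun c => ∫ x, misfitEnergy Φ θ x ((2 : ℝ) • U c x) ∂cellMeasure E := by
  have hint := fun c => integrable_misfitEnergy hE hΦ.continuous hp θ ((hU c).memLp_cell hE).1
  have hS := supGrad_nonneg Φ
  have key : ∀ c c', |∫ x, misfitEnergy Φ θ x ((2 : ℝ) • U c x) ∂cellMeasure E -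
      ∫ x, misfitEnergy Φ θ x ((2 : ℝ) • U c' x) ∂cellMeasure E| ≤
      2 * supGrad Φ * Real.sqrt (∫ x, ‖U c x - U c' x‖ ^ 2 ∂cellMeasure E) := by
    intro c c'
    have hm := ((hU c).memLp_cell hE).sub ((hU c').memLp_cell hE)
    have := isProbabilityMeasure_cellMeasure hE
    rw [← integral_sub (hint c) (hint c')]
    refine (abs_integral_le_integral_abs).trans ?_
    calc _ ≤ ∫ x, 2 * supGrad Φ * ‖U c x - U c' x‖ ∂cellMeasure E := by
          refine integral_mono ((hint c).sub (hint c')).abs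
            ((hm.integrable (by norm_num)).norm.const_mul _) fun x => ?_
          refine (abs_misfitEnergy_sub_le hE hΦ hp θ x _ _).trans_eq ?_
          rw [← smul_sub, norm_smul, Real.norm_ofNat]
          ring
      _ ≤ _ := by
          rw [integral_const_mul]
          exact mul_le_mul_of_nonneg_left (integral_norm_le_sqrt hE hm) (by positivity)
  refine continuous_iff_continuousAt.2 fun c' => Metric.tendsto_nhds.2 fun ε hε => ?_
  set S := 2 * supGrad Φ
  -- The high frequencies contribute at most `δ * (4 * M)` uniformly over `coefSet`; once `δ` is
  -- fixed, only finitely many coefficients remain, and these converge.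
  have h1 : ∃ δ > 0, S * Real.sqrt (0 + δ * (4 * M)) < ε := by
    have hc : Continuous fun δ : ℝ => S * Real.sqrt (0 + δ * (4 * M)) := by fun_prop
    have h2 : Filter.Tendsto (fun δ : ℝ => S * Real.sqrt (0 + δ * (4 * M)))
        (nhdsWithin 0 (Set.Ioi 0))
        (nhds 0) := by
      have := hc.tendsto 0
      simp only [zero_mul, add_zero, Real.sqrt_zero, mul_zero] at this
      exact this.mono_left nhdsWithin_le_nhds |>.congr fun δ => by simp
    obtain ⟨δ, h3, h4⟩ := ((h2.eventually (gt_mem_nhds hε)).and self_mem_nhdsWithin).exists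
    exact ⟨δ, h4, h3⟩
  obtain ⟨δ, hδ, hδε⟩ := h1
  obtain ⟨T, hT⟩ := exists_finset_freq hE δ⁻¹
  have h2 : Continuous fun c : coefSet E M =>
      S * Real.sqrt (∑ n ∈ T, ∑ l, ‖c.1 l n - c'.1 l n‖ ^ 2 + δ * (4 * M)) := by
    have h4 : Continuous fun c : Fin 2 → (Fin 2 → ℤ) → ℂ =>
        S * Real.sqrt (∑ n ∈ T, ∑ l, ‖c l n - c'.1 l n‖ ^ 2 + δ * (4 * M)) := by fun_prop
    exact h4.comp continuous_subtype_val
  have h3 := h2.tendsto c'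
  simp only [sub_self, norm_zero, ne_eq, OfNat.ofNat_ne_zero, not_false_eq_true, zero_pow,
    Finset.sum_const_zero] at h3
  filter_upwards [h3.eventually (gt_mem_nhds hδε)] with c hc
  refine lt_of_le_of_lt (key c c') (lt_of_le_of_lt ?_ hc)
  have h4 := integral_norm_sub_sq_le hE hδ hT (hU c) (hU c') hM (by rw [hUc]; exact c.2)
    (by rw [hUc]; exact c'.2)
  rw [hUc, hUc] at h4
  gcongr

/-- The total energy has a minimizer. -/
lemma exists_minimizer {E : Mat} (hE : E.det ≠ 0) {lam mu : ℝ} (hl : 0 ≤ lam) (hm : 0 < mu)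
    {Φ : Plane → ℝ} (hΦ : ContDiff ℝ 1 Φ) (hp : IsPeriodic E Φ) (θ : ℝ) {k : ℝ} (hk : 0 ≤ k) :
    ∃ u G, MemSobolev E u G ∧ ∀ v H, MemSobolev E v H →
      ∫ x, elasticPairing lam mu (G x) (G x) ∂cellMeasure E +
          k * ∫ x, misfitEnergy Φ θ x ((2 : ℝ) • u x) ∂cellMeasure E ≤
        ∫ x, elasticPairing lam mu (H x) (H x) ∂cellMeasure E +
          k * ∫ x, misfitEnergy Φ θ x ((2 : ℝ) • v x) ∂cellMeasure E := by
  have := isProbabilityMeasure_cellMeasure hE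
  obtain ⟨B, hB⟩ := hp.exists_bound hE hΦ.continuous
  have hB0 : 0 ≤ B := (norm_nonneg _).trans (hB 0)
  -- Beyond this Dirichlet energy, Korn gives a total energy above `2 k B - k B = k B`, which is at
  -- least that of the zero displacement; so it is enough to minimize over `coefSet E M`.
  set M := 2 * (k * B) / mu with hMd
  have hM : 0 ≤ M := by positivity
  choose U G hU hUc using fun c : coefSet E M => exists_memSobolev hE hM c.2
  have hPb : ∀ u : Plane → Plane, |∫ x, misfitEnergy Φ θ x ((2 : ℝ) • u x) ∂cellMeasure E| ≤ B := by
    intro u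
    have h1 := norm_integral_le_of_norm_le_const (μ := cellMeasure E) (C := B)
      (f := fun x => misfitEnergy Φ θ x ((2 : ℝ) • u x))
      (Filter.Eventually.of_forall fun x => abs_misfitEnergy_le hB θ x ((2 : ℝ) • u x))
    simpa using h1
  have hq := modeEnergy_nonneg E hl hm.le
  set P : coefSet E M → ℝ := fun c => ∫ x, misfitEnergy Φ θ x ((2 : ℝ) • U c x) ∂cellMeasure E
    with hP
  have hPc : Continuous P := continuous_integral_misfitEnergy hE hΦ hp θ hM hU hUc
  -- Adding `B` makes the misfit part nonnegative, so that the whole functional takes extended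
  -- nonnegative values.
  set f : coefSet E M → ENNReal := fun c => ∑' n, ENNReal.ofReal (modeEnergy E lam mu c.1 n) +
    ENNReal.ofReal (k * (P c + B)) with hf
  have hfl : LowerSemicontinuous f := by
    refine (lowerSemicontinuous_tsum fun n => Continuous.lowerSemicontinuous ?_).add
      (Continuous.lowerSemicontinuous ?_)
    · have h1 : Continuous fun c => modeEnergy E lam mu c n := by
        unfold modeEnergy
        fun_prop
      exact ENNReal.continuous_ofReal.comp (h1.comp continuous_subtype_val)
    · exact ENNReal.continuous_ofReal.comp (by fun_prop)
  have hzero : (0 : Fin 2 → (Fin 2 → ℤ) → ℂ) ∈ coefSet E M := by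
    simp [coefSet]
  have hne : (Set.univ : Set (coefSet E M)).Nonempty := ⟨⟨0, hzero⟩, trivial⟩
  have hcs : CompactSpace (coefSet E M) := isCompact_iff_compactSpace.1 (isCompact_coefSet hE hM)
  obtain ⟨c, -, hmin⟩ := (hfl.lowerSemicontinuousOn Set.univ).exists_isMinOn hne isCompact_univ
  have hfJ : ∀ c, f c = ENNReal.ofReal (∫ x, elasticPairing lam mu (G c x) (G c x) ∂cellMeasure E +
      k * (P c + B)) := by
    intro c
    have h1 := (hU c).hasSum_modeEnergy hE lam mu
    rw [hUc] at h1
    simp only [hf]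
    rw [← ENNReal.ofReal_tsum_of_nonneg (hq c.1) h1.summable, h1.tsum_eq, ENNReal.ofReal_add]
    · rw [← h1.tsum_eq]; exact tsum_nonneg (hq c.1)
    · exact mul_nonneg hk (by linarith [(abs_le.1 (hPb (U c))).1])
  have hJ0 : ∀ c,
      0 ≤ ∫ x, elasticPairing lam mu (G c x) (G c x) ∂cellMeasure E + k * (P c + B) := by
    intro c
    have h1 := (hU c).hasSum_modeEnergy hE lam mu
    rw [← h1.tsum_eq]
    exact add_nonneg (tsum_nonneg (hq _)) (mul_nonneg hk (by linarith [(abs_le.1 (hPb (U c))).1]))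
  have hmin' : ∀ c', ∫ x, elasticPairing lam mu (G c x) (G c x) ∂cellMeasure E + k * P c ≤
      ∫ x, elasticPairing lam mu (G c' x) (G c' x) ∂cellMeasure E + k * P c' := by
    intro c'
    have h1 := isMinOn_iff.1 hmin c' trivial
    rw [hfJ, hfJ, ENNReal.ofReal_le_ofReal_iff (hJ0 c')] at h1
    linarith
  refine ⟨U c, G c, hU c, fun v H hv => ?_⟩
  by_cases hvM : ∫ x, ∑ i, ∑ j, H x i j ^ 2 ∂cellMeasure E ≤ M
  · set c' : coefSet E M := ⟨vcoef E v, mem_coefSet hE hv hvM⟩ with hc'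
    refine (hmin' c').trans_eq ?_
    have h1 := (hU c').hasSum_modeEnergy hE lam mu
    rw [hUc] at h1
    rw [h1.unique (hv.hasSum_modeEnergy hE lam mu)]
    have h2 : U c' =ᵐ[cellMeasure E] v := by
      have h3 : ∀ l, (fun x => (U c' x l : ℂ)) =ᵐ[cellMeasure E] fun x => (v x l : ℂ) := fun l =>
        ae_eq_of_coef_eq hE ((memLp_proj ((hU c').memLp_cell hE) l).ofReal (K := ℂ))
          ((memLp_proj (hv.memLp_cell hE) l).ofReal (K := ℂ)) fun n =>
            congrFun (congrFun (hUc c') l) n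
      filter_upwards [ae_all_iff.2 h3] with x hx
      ext l
      exact_mod_cast hx l
    congr 2
    exact integral_congr_ae (h2.mono fun x hx => by simp only [hx])
  · have h1 := hmin' ⟨0, hzero⟩
    have h2 := hv.korn hE hl hm.le
    have h3 := (hU ⟨0, hzero⟩).hasSum_modeEnergy hE lam mu
    rw [hUc] at h3
    have h4 : ∫ x, elasticPairing lam mu (G ⟨0, hzero⟩ x) (G ⟨0, hzero⟩ x) ∂cellMeasure E = 0 := by
      rw [← h3.tsum_eq]
      simp [modeEnergy]
    rw [h4, zero_add] at h1
    have h5 : k * P ⟨0, hzero⟩ ≤ k * B := mul_le_mul_of_nonneg_left (abs_le.1 (hPb _)).2 hk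
    have h6 := mul_le_mul_of_nonneg_left (abs_le.1 (hPb v)).1 hk
    have h7 : 2 * (k * B) < mu * ∫ x, ∑ i, ∑ j, H x i j ^ 2 ∂cellMeasure E := by
      rw [not_le, hMd, div_lt_iff₀ hm] at hvM
      linarith
    linarith

theorem exists_isSolution {E : Mat} (hE : E.det ≠ 0) {lam mu : ℝ} (hl : 0 ≤ lam) (hm : 0 < mu)
    {Φ : Plane → ℝ} (hΦ : ContDiff ℝ 1 Φ) (hp : IsPeriodic E Φ) (θ : ℝ) :
    ∃ u G, IsSolution E lam mu Φ θ u G := by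
  obtain ⟨u, G, hu, h⟩ := exists_minimizer hE hl hm hΦ hp θ
    (k := 1 / (4 * Real.sin (θ / 2) ^ 2)) (by positivity)
  exact ⟨u, G, isSolution_of_minimizer hE hΦ hp hu h⟩

/-! ### Passing from `sin(θ/2)` to `θ`, and the main theorem. -/

lemma sin_half_ne_zero {θ : ℝ} (h : ∀ n : ℤ, θ ≠ n * Real.pi) : Real.sin (θ / 2) ≠ 0 := by
  intro h0
  obtain ⟨n, hn⟩ := Real.sin_eq_zero_iff.1 h0
  exact h (2 * n) (by push_cast; linarith)

/-- Jordan's inequality `2 |x| / π ≤ |sin x|` at `x = θ / 2`, squared. -/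
lemma sq_div_pi_sq_le_sin_half_sq {θ : ℝ} (h : |θ| < Real.pi) :
    θ ^ 2 / Real.pi ^ 2 ≤ Real.sin (θ / 2) ^ 2 := by
  have hpi := Real.pi_pos
  have h1 := Real.mul_abs_le_abs_sin (x := θ / 2) (by
    rw [abs_div, abs_of_pos (by norm_num : (0 : ℝ) < 2)]; linarith)
  have h2 : 2 / Real.pi * |θ / 2| = |θ| / Real.pi := by
    rw [abs_div, abs_of_pos (by norm_num : (0 : ℝ) < 2)]; ring
  rw [h2] at h1
  have h3 := pow_le_pow_left₀ (by positivity) h1 2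
  rwa [div_pow, sq_abs, sq_abs] at h3

end Bilayer

end

theorem mainTheorem2 (E : Bilayer.Mat) (hE : E.det ≠ 0) :
    (∃ (C₀ C₁ : ℝ) (C : ℕ → ℝ → ℝ → ℝ), 0 < C₁ ∧ 2 * C₁ < C₀ ∧
      ∀ lam mu : ℝ, 0 ≤ lam → 0 < mu →
      ∀ Φ : Bilayer.Plane → ℝ, ContDiff ℝ 2 Φ → Bilayer.IsPeriodic E Φ →
      ∀ θ : ℝ, (∀ n : ℤ, θ ≠ n * Real.pi) →
        -- (a) existence, and the bound for every solution
        (∃ u G, Bilayer.IsSolution E lam mu Φ θ u G) ∧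
        (∀ u G, Bilayer.IsSolution E lam mu Φ θ u G →
          Bilayer.sobolevNorm E u G ≤
            1 / (mu * C₁) * (Bilayer.supGrad Φ / (4 * Real.sin (θ / 2) ^ 2))) ∧
        -- (b) uniqueness
        (|θ| < Real.pi → Bilayer.supDeriv 2 Φ / θ ^ 2 < mu * C₀ / 2 →
          ∀ u G u' G', Bilayer.IsSolution E lam mu Φ θ u G →
            Bilayer.IsSolution E lam mu Φ θ u' G' → u =ᵐ[volume] u') ∧
        -- (c) smoothness, and the bounds on the derivatives
        (ContDiff ℝ ∞ Φ → ∀ u G, Bilayer.IsSolution E lam mu Φ θ u G →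
          ∃ w : Bilayer.Plane → Bilayer.Plane,
            ContDiff ℝ ∞ w ∧ Bilayer.IsPeriodic E w ∧ u =ᵐ[volume] w ∧
            ∀ k : ℕ, 2 ≤ k → Bilayer.derivL2Norm E k w ≤
              C k mu (Bilayer.cNorm (k + 1) Φ) / Real.sin (θ / 2) ^ (2 * k))) ∧
    -- the bound of (a) and the uniqueness criterion with identified constants
    (∀ lam mu : ℝ, 0 ≤ lam → 0 < mu →
      ∀ Φ : Bilayer.Plane → ℝ, ContDiff ℝ 2 Φ → Bilayer.IsPeriodic E Φ →
      ∀ θ : ℝ, (∀ n : ℤ, θ ≠ n * Real.pi) →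
        (∀ u G, Bilayer.IsSolution E lam mu Φ θ u G →
          Bilayer.sobolevNorm E u G ≤
            1 / (mu * (Bilayer.gap E / (1 + Bilayer.gap E))) *
              (Bilayer.supGrad Φ / (4 * Real.sin (θ / 2) ^ 2))) ∧
        (Bilayer.supDeriv 2 Φ / (4 * Real.sin (θ / 2) ^ 2) < mu * Bilayer.gap E / 2 →
          ∀ u G u' G', Bilayer.IsSolution E lam mu Φ θ u G →
            Bilayer.IsSolution E lam mu Φ θ u' G' → u =ᵐ[volume] u')) := by
  have hL := Bilayer.gap_pos hE
  set L := Bilayer.gap E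
  have hpi := Real.pi_pos
  have hpi1 : 1 ≤ Real.pi ^ 2 := by nlinarith [Real.pi_gt_three]
  obtain ⟨C, hC⟩ := Bilayer.exists_regularity_constants hE
  -- `C₀` is what Jordan's inequality leaves of the criterion with `4 sin²(θ/2)`. The sharper `L /
  -- (1 + L)` would serve in (a), but it is divided by `π²` so that `2 * C₁ < C₀` holds for every
  -- lattice.
  refine ⟨⟨4 * L / Real.pi ^ 2, L / (1 + L) / Real.pi ^ 2, C, by positivity, ?_, ?_⟩, ?_⟩
  · have h1 : L / (1 + L) ≤ L := div_le_self hL.le (by linarith)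
    rw [← mul_div_assoc]
    exact div_lt_div_of_pos_right (by linarith) (by positivity)
  · intro lam mu hl hm Φ hΦ hp θ hθ
    have hΦ1 : ContDiff ℝ 1 Φ := hΦ.of_le (by norm_num)
    have hs := Bilayer.sin_half_ne_zero hθ
    have hs2 : 0 < Real.sin (θ / 2) ^ 2 := by positivity
    refine ⟨Bilayer.exists_isSolution hE hl hm hΦ1 hp θ, fun u G h => ?_,
      fun hθpi hlt u G u' G' h h' => ?_,
      fun hΦs u G h => hC lam mu Φ θ u G hl hm hΦs hp hs h⟩
    · refine (h.sobolevNorm_le hE hl hm hΦ1 hp).trans ?_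
      have hS := Bilayer.supGrad_nonneg Φ
      have h1 : L / (1 + L) / Real.pi ^ 2 ≤ L / (1 + L) := div_le_self (by positivity) hpi1
      gcongr
    · refine h.unique hE hl hm hΦ hp ?_ h'
      have h0 : θ ≠ 0 := by simpa using hθ 0
      have h1 := Bilayer.sq_div_pi_sq_le_sin_half_sq hθpi
      rw [div_lt_iff₀ (by positivity)] at hlt ⊢
      have h2 : mu * (4 * L / Real.pi ^ 2) / 2 * θ ^ 2 =
          2 * mu * L * (θ ^ 2 / Real.pi ^ 2) := by ring
      have h3 : 2 * mu * L * (θ ^ 2 / Real.pi ^ 2) ≤ 2 * mu * L * Real.sin (θ / 2) ^ 2 := by gcongr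
      change _ < mu * L / 2 * _
      linarith
  · intro lam mu hl hm Φ hΦ hp θ hθ
    exact ⟨fun u G h => h.sobolevNorm_le hE hl hm (hΦ.of_le (by norm_num)) hp,
      fun hlt u G u' G' h h' => h.unique hE hl hm hΦ hp hlt h'⟩
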